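/- For a finite graph $G$ and $S\subseteq V(G)$ let $N(S)$ be the set of vertices outside $S$ that have a neighbour in $S$. The strong $4$-core of $G$ is the largest set $S\subseteq V(G)$ such that every vertex of $S\cup N(S)$ has at least $4$ neighbours in $S$ (it exists, since the union of sets with this property has the property). Let $V_{black}(G)$ be the strong $4$-core of $G$, $V_{blue}(G)=N(V_{black}(G))$, and $V_{red}(G)$ the set of the remaining vertices. Let $G^{r/b}$ be the subgraph of $G$ induced by $V_{blue}(G)\cup V_{red}(G)$, and $G'$ the subgraph of $G$ induced by $V_{black}(G)\cup V_{blue}(G)$. Theorem. There is a constant $C$ such that the following holds for all $n\ge 1$ and all real $c$ with $20\le c\le n$. Let $G\sim G(n,c/n)$ be the binomial random graph on $n$ labelled vertices. Let $U=U(G)\subseteq V_{blue}(G)$ be any set and $M=M(G)$ any matching on $V_{blue}(G)\setminus U$ (a set of pairwise disjoint pairs of vertices of $V_{blue}(G)\setminus U$, not necessarily edges of $G$), where $U$ and $M$ may depend on the colour classes $V_{black}(G),V_{blue}(G),V_{red}(G)$ and on the graph $G^{r/b}$, but not on the edges of $G$ that have a black endpoint. Then, with probability at least $1-C/n^2$,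 the graph $G'[V(G')\setminus U]\cup M$ has a Hamilton cycle that uses all the edges of $M$. -/

import Mathlib

namespace StrongCore

variable {V : Type*}

/-- `N(S)`: the vertices outside `S` that are adjacent to a vertex of `S`. -/
def outerNeighbors (G : SimpleGraph V) (S : Set V) : Set V :=
  {v | v ∉ S ∧ ∃ u ∈ S, G.Adj u v}

/-- Every vertex of `S ∪ N(S)` has at least `k` neighbours in `S`. -/
def HasStrongProperty (G : SimpleGraph V) (k : ℕ) (S : Set V) : Prop :=
  ∀ v ∈ S ∪ outerNeighbors G S, (k : ℕ∞) ≤ (G.neighborSet v ∩ S).encard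

/-- The strong `k`-core of `G`: the largest set with the property above, obtained as the union
of all such sets (see `isGreatest_strongCore`). -/
def strongCore (G : SimpleGraph V) (k : ℕ) : Set V :=
  ⋃₀ {S | HasStrongProperty G k S}

theorem isGreatest_strongCore (G : SimpleGraph V) (k : ℕ) :
    IsGreatest {S | HasStrongProperty G k S} (strongCore G k) := by
  refine ⟨?_, fun S hS => Set.subset_sUnion_of_mem hS⟩
  have key : ∀ v, (∃ S, HasStrongProperty G k S ∧ v ∈ S ∪ outerNeighbors G S) →
      (k : ℕ∞) ≤ (G.neighborSet v ∩ strongCore G k).encard := by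
    rintro v ⟨S, hS, hv⟩
    exact (hS v hv).trans
      (Set.encard_le_encard (Set.inter_subset_inter_right _ (Set.subset_sUnion_of_mem hS)))
  rintro v (⟨S, hS, hv⟩ | ⟨hv, u, ⟨S, hS, hu⟩, huv⟩)
  · exact key v ⟨S, hS, Or.inl hv⟩
  · exact key v ⟨S, hS, Or.inr ⟨fun h => hv ⟨S, hS, h⟩, u, hu, huv⟩⟩

/-- The black vertices: the strong `4`-core. -/
def black (G : SimpleGraph V) : Set V := strongCore G 4

/-- The blue vertices: the vertices outside the strong `4`-core with a neighbour in it.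
All vertices that are neither black nor blue are red. -/
def blue (G : SimpleGraph V) : Set V := outerNeighbors G (black G)

/-- `G₁` and `G₂` have the same red/blue/black colouring and the same subgraph induced by the
blue and red vertices; they may differ only in the edges with a black endpoint. -/
def SameRedBlue (G₁ G₂ : SimpleGraph V) : Prop :=
  black G₁ = black G₂ ∧ blue G₁ = blue G₂ ∧
    ∀ u v, u ∉ black G₁ → v ∉ black G₁ → (G₁.Adj u v ↔ G₂.Adj u v)

/-- The vertex set of `G' - U`, where `G'` is induced by the black and blue vertices. -/
def keptVerts (G : SimpleGraph V) (U : Set V) : Set V := (black G ∪ blue G) \ U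

/-- The graph `(G' - U) ∪ M`. -/
def augmented (G : SimpleGraph V) (U : Set V) (M : (⊤ : SimpleGraph V).Subgraph) :
    SimpleGraph (keptVerts G U) :=
  G.induce (keptVerts G U) ⊔ M.spanningCoe.induce (keptVerts G U)

/-- `(G' - U) ∪ M` has a Hamilton cycle that uses all the edges of `M`. -/
def HasHamiltonCycleThrough [DecidableEq V] (G : SimpleGraph V) (U : Set V)
    (M : (⊤ : SimpleGraph V).Subgraph) : Prop :=
  ∃ (a : keptVerts G U) (w : (augmented G U M).Walk a a), w.IsHamiltonianCycle ∧
    ∀ x y : keptVerts G U, M.Adj x y → s(x, y) ∈ w.edges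

end StrongCore

/-! Let `B` be the core and `K₀ = B ∪ N(B)`. The random graph is a family of independent coin flips
on `Sym2 V`. If the pairs between `B` and `K₀` are changed so that every vertex of `K₀` still has
four neighbours in `B`, the colours do not change (`black_blue_eq_of_agree`). Hence, given the
colours and all other pairs, `U` and `M` are fixed, and the free pairs are independent flips
conditioned on the single increasing event `degEvent`. The core has at least `0.998 n` vertices up
to probability `O(n⁻²)` (`prob_core_small_le`): otherwise greedy peeling yields about `n / 2000`
vertices whose outer neighbourhood is at most three times as large.

For the conditional problem, consider longest paths built from edges with a black endpoint and
matching pairs, containing with each matched vertex its pair. Pósa rotations about black vertices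
never break a matching pair. Let `S` be the set of ends obtained by rotations and `T` its black
neighbours outside `S`. Then `|T| < 2|S|`, and minimum degree four gives at least `|S| + |T| + 2`
edges from `S` to `B` (`Frame.IsMaxSys.denseSpot`). Small sets of this kind are unlikely, the two
surplus edges giving the factor `n⁻²`; medium ones would leave two large sets without an edge
between them. So `|S| ≥ 0.26 n`, and quadratically many pairs are boosters: adding one creates a
Hamilton cycle or a longer path.

Sprinkling is replaced by a switching (`Frame.switching`). From a non-Hamiltonian configuration
delete an edge inside `B` that some longest path avoids and no degree condition needs; reinserting
it is not a boost. With `m` edges among the `N` pairs inside `B`, there are `m` minus few deletions,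
and at most `N - m - boosters` insertions. As `m` is nearly at least `pN`, the weighted difference
is at least about `p · boosters` minus the number of undeletable edges. For `c` near 20 this is
positive only because far fewer than `n` edges are undeletable: each pivot of a nontrivial rotation
provides a path edge that some longest path avoids (`Frame.IsMaxSys.card_unavoidable_le`). So
non-Hamiltonicity is at most a constant times as likely as atypicality (`Frame.prob_not_ham_le`).

Atypicality is bounded under the conditioning by Harris' inequality: most typical properties are
increasing, so conditioning only helps; dense spots are handled by dropping the degree conditions on
`S ∪ T` at a cost of `10/9` per vertex (`prob_spot_le`). -/

set_option linter.unusedSectionVars false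

namespace StrongCore

/-! ### Product measures on finite cubes: independence, Harris, Chernoff -/

section BernoulliProduct

variable {E : Type*} [Fintype E]

/-- The weight of a configuration of independent Bernoulli variables with parameter `p`. -/
noncomputable def wt (p : ℝ) (ω : E → Bool) : ℝ := ∏ e, if ω e then p else 1 - p

open Classical in
/-- The probability of an event for independent Bernoulli variables with parameter `p`. -/
noncomputable def prob [DecidableEq E] (p : ℝ) (A : Set (E → Bool)) : ℝ :=
  ∑ ω, if ω ∈ A then wt p ω else 0

/-- The event `A` is determined by the coordinates in `S`. -/
def DeterminedBy (A : Set (E → Bool)) (S : Set E) : Prop :=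
  ∀ ω ω' : E → Bool, (∀ e ∈ S, ω e = ω' e) → (ω ∈ A ↔ ω' ∈ A)

theorem DeterminedBy.mono {A : Set (E → Bool)} {S T : Set E} (h : DeterminedBy A S)
    (hST : S ⊆ T) : DeterminedBy A T :=
  fun ω ω' hω => h ω ω' fun e he => hω e (hST he)

theorem DeterminedBy.inter {A B : Set (E → Bool)} {S : Set E} (hA : DeterminedBy A S)
    (hB : DeterminedBy B S) : DeterminedBy (A ∩ B) S :=
  fun ω ω' hω => and_congr (hA ω ω' hω) (hB ω ω' hω)

variable {p : ℝ}

theorem wt_nonneg (h0 : 0 ≤ p) (h1 : p ≤ 1) (ω : E → Bool) : 0 ≤ wt p ω :=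
  Finset.prod_nonneg fun e _ => by split_ifs <;> linarith

variable [DecidableEq E]

theorem prob_eq_sum_filter (A : Set (E → Bool)) [DecidablePred (· ∈ A)] :
    prob p A = ∑ ω with ω ∈ A, wt p ω := by
  unfold prob
  rw [Finset.sum_filter]
  congr!

theorem prob_nonneg (h0 : 0 ≤ p) (h1 : p ≤ 1) (A : Set (E → Bool)) : 0 ≤ prob p A := by
  classical
  refine Finset.sum_nonneg fun ω _ => ?_
  split_ifs
  · exact wt_nonneg h0 h1 ω
  · exact le_rfl

theorem prob_mono (h0 : 0 ≤ p) (h1 : p ≤ 1) {A B : Set (E → Bool)} (h : A ⊆ B) :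
    prob p A ≤ prob p B := by
  classical
  refine Finset.sum_le_sum fun ω _ => ?_
  have := wt_nonneg h0 h1 ω
  by_cases hA : ω ∈ A
  · simp [hA, h hA]
  · simp only [hA, if_false]
    split_ifs
    · exact this
    · exact le_rfl

theorem prob_union_le (h0 : 0 ≤ p) (h1 : p ≤ 1) (A B : Set (E → Bool)) :
    prob p (A ∪ B) ≤ prob p A + prob p B := by
  classical
  unfold prob
  rw [← Finset.sum_add_distrib]
  refine Finset.sum_le_sum fun ω _ => ?_
  have := wt_nonneg h0 h1 ω
  by_cases hA : ω ∈ A <;> by_cases hB : ω ∈ B <;> simp [hA, hB, this]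

theorem prob_le_sum (h0 : 0 ≤ p) (h1 : p ≤ 1) {ι : Type*} (s : Finset ι) (A : Set (E → Bool))
    (B : ι → Set (E → Bool)) (h : ∀ ω ∈ A, ∃ i ∈ s, ω ∈ B i) :
    prob p A ≤ ∑ i ∈ s, prob p (B i) := by
  classical
  unfold prob
  rw [Finset.sum_comm]
  refine Finset.sum_le_sum fun ω _ => ?_
  have hw := wt_nonneg h0 h1 ω
  have hn : ∀ i ∈ s, 0 ≤ if ω ∈ B i then wt p ω else 0 := fun i _ => by
    split_ifs
    · exact hw
    · exact le_rfl
  by_cases hA : ω ∈ A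
  · obtain ⟨i, hi, hB⟩ := h ω hA
    rw [if_pos hA]
    calc wt p ω = if ω ∈ B i then wt p ω else 0 := by rw [if_pos hB]
      _ ≤ _ := Finset.single_le_sum hn hi
  · rw [if_neg hA]
    exact Finset.sum_nonneg hn

theorem sum_wt : ∑ ω : E → Bool, wt p ω = 1 := by
  have h := Finset.prod_univ_sum (fun _ : E => (Finset.univ : Finset Bool))
    (fun _ b => if b then p else 1 - p)
  simp only [Fintype.piFinset_univ] at h
  unfold wt
  rw [← h]
  simp

theorem prob_univ : prob p (Set.univ : Set (E → Bool)) = 1 := by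
  classical
  simp [prob, sum_wt]

theorem prob_empty : prob p (∅ : Set (E → Bool)) = 0 := by
  classical
  simp [prob]

theorem prob_add_compl (A : Set (E → Bool)) : prob p A + prob p Aᶜ = 1 := by
  classical
  rw [← sum_wt (E := E) (p := p)]
  unfold prob
  rw [← Finset.sum_add_distrib]
  refine Finset.sum_congr rfl fun ω _ => ?_
  by_cases h : ω ∈ A <;> simp [h]

/-- Split the coordinates into those in `S` and the rest: the weight factorises and each event
depends on one half only. -/
theorem prob_indep {A B : Set (E → Bool)} {S T : Set E} (hA : DeterminedBy A S)
    (hB : DeterminedBy B T) (hST : Disjoint S T) : prob p (A ∩ B) = prob p A * prob p B := by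
  classical
  let e := (Equiv.piEquivPiSubtypeProd (fun i => i ∈ S) (fun _ : E => Bool))
  have hsum : ∀ f : (E → Bool) → ℝ, ∑ ω, f ω = ∑ x, ∑ y, f (e.symm (x, y)) := fun f => by
    rw [← Fintype.sum_prod_type' (f := fun x y => f (e.symm (x, y)))]
    exact (Equiv.sum_comp e.symm f).symm
  have hw : ∀ x y, wt p (e.symm (x, y)) = wt p x * wt p y := fun x y => by
    unfold wt
    rw [← Fintype.prod_subtype_mul_prod_subtype (fun i => i ∈ S)]
    congr 1
    · refine Finset.prod_congr rfl fun i _ => ?_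
      simp [e, Equiv.piEquivPiSubtypeProd, i.2]
    · refine Finset.prod_congr rfl fun i _ => ?_
      simp [e, Equiv.piEquivPiSubtypeProd, i.2]
  -- Any reference values do, since each event ignores the other half.
  let x₀ : {i // i ∈ S} → Bool := fun _ => false
  let y₀ : {i // i ∉ S} → Bool := fun _ => false
  have hA' : ∀ x y, e.symm (x, y) ∈ A ↔ e.symm (x, y₀) ∈ A := fun x y =>
    hA _ _ fun i hi => by simp [e, Equiv.piEquivPiSubtypeProd, hi]
  have hB' : ∀ x y, e.symm (x, y) ∈ B ↔ e.symm (x₀, y) ∈ B := fun x y =>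
    hB _ _ fun i hi => by
      have : i ∉ S := fun h => hST.le_bot ⟨h, hi⟩
      simp [e, Equiv.piEquivPiSubtypeProd, this]
  have h1 : prob p A = ∑ x, if e.symm (x, y₀) ∈ A then wt p x else 0 := by
    unfold prob
    rw [hsum]
    refine Finset.sum_congr rfl fun x _ => ?_
    simp only [hA' x, hw]
    split_ifs
    · rw [← Finset.mul_sum, sum_wt, mul_one]
    · simp
  have h2 : prob p B = ∑ y, if e.symm (x₀, y) ∈ B then wt p y else 0 := by
    unfold prob
    rw [hsum, Finset.sum_comm]
    refine Finset.sum_congr rfl fun y _ => ?_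
    simp only [hB' _ y, hw]
    split_ifs
    · rw [← Finset.sum_mul, sum_wt, one_mul]
    · simp
  rw [h1, h2, Finset.sum_mul_sum]
  unfold prob
  rw [hsum]
  refine Finset.sum_congr rfl fun x _ => Finset.sum_congr rfl fun y _ => ?_
  simp only [Set.mem_inter_iff, hA' x y, hB' x y, hw]
  by_cases h : e.symm (x, y₀) ∈ A <;> by_cases h' : e.symm (x₀, y) ∈ B <;> simp [h, h']

theorem prob_iInter_indep {ι : Type*} [DecidableEq ι] (s : Finset ι) (A : ι → Set (E → Bool))
    (S : ι → Set E) (hA : ∀ i ∈ s, DeterminedBy (A i) (S i))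
    (hS : ∀ i ∈ s, ∀ j ∈ s, i ≠ j → Disjoint (S i) (S j)) :
    prob p {ω | ∀ i ∈ s, ω ∈ A i} = ∏ i ∈ s, prob p (A i) := by
  induction s using Finset.induction_on with
  | empty => simp [Set.ofPred_true, prob_univ]
  | insert a s ha ih =>
    rw [Finset.prod_insert ha, ← ih (fun i hi => hA i (Finset.mem_insert_of_mem hi))
      (fun i hi j hj => hS i (Finset.mem_insert_of_mem hi) j (Finset.mem_insert_of_mem hj))]
    have : {ω | ∀ i ∈ insert a s, ω ∈ A i} = A a ∩ {ω | ∀ i ∈ s, ω ∈ A i} := by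
      ext ω; simp
    rw [this]
    refine prob_indep (hA a (Finset.mem_insert_self a s)) (T := ⋃ i ∈ s, S i) ?_ ?_
    · intro ω ω' h
      refine forall₂_congr fun i hi => hA i (Finset.mem_insert_of_mem hi) ω ω' fun e he =>
        h e (Set.mem_biUnion hi he)
    · rw [Set.disjoint_iUnion₂_right]
      exact fun i hi => hS a (Finset.mem_insert_self a s) i (Finset.mem_insert_of_mem hi)
        (fun h => ha (h ▸ hi))

theorem prob_coord_true (e : E) : prob p {ω | ω e = true} = p := by
  classical
  have h := Finset.prod_univ_sum (fun i : E => if i = e then {true} else (Finset.univ : Finset Bool))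
    (fun _ b => if b then p else 1 - p)
  have h2 : prob p {ω : E → Bool | ω e = true} = ∑ ω ∈ Fintype.piFinset
      (fun i : E => if i = e then {true} else (Finset.univ : Finset Bool)), wt p ω := by
    rw [prob_eq_sum_filter]
    refine Finset.sum_congr ?_ fun _ _ => rfl
    ext ω
    simp only [Finset.mem_filter, Finset.mem_univ, true_and, Fintype.mem_piFinset, Set.mem_ofPred_eq]
    constructor
    · intro h i
      by_cases hi : i = e
      · subst hi; simp [h]
      · simp [hi]
    · intro h; simpa using h e
  rw [h2]
  unfold wt
  rw [← h, Finset.prod_eq_single e]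
  · simp
  · intro b _ hb; simp [hb]
  · simp

theorem determinedBy_coord (e : E) (b : Bool) : DeterminedBy {ω : E → Bool | ω e = b} {e} :=
  fun ω ω' h => by simp [h e rfl]

theorem prob_coord_false (e : E) : prob p {ω | ω e = false} = 1 - p := by
  have h := prob_add_compl (p := p) {ω : E → Bool | ω e = true}
  rw [prob_coord_true] at h
  have h2 : {ω : E → Bool | ω e = true}ᶜ = {ω | ω e = false} := by ext ω; simp
  rw [h2] at h
  linarith

theorem prob_all_true (F : Finset E) : prob p {ω | ∀ e ∈ F, ω e = true} = p ^ F.card := by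
  have := prob_iInter_indep (p := p) F (fun e => {ω | ω e = true}) (fun e => {e})
    (fun e _ => determinedBy_coord e true) (fun i _ j _ h => by simpa using h)
  simpa [prob_coord_true] using this

theorem prob_all_false (F : Finset E) : prob p {ω | ∀ e ∈ F, ω e = false} = (1 - p) ^ F.card := by
  have := prob_iInter_indep (p := p) F (fun e => {ω | ω e = false}) (fun e => {e})
    (fun e _ => determinedBy_coord e false) (fun i _ j _ h => by simpa using h)
  simpa [prob_coord_false] using this

theorem determinedBy_all (F : Finset E) (b : Bool) :
    DeterminedBy {ω : E → Bool | ∀ e ∈ F, ω e = b} F :=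
  fun ω ω' h => forall₂_congr fun e he => by rw [h e he]

/-- **Harris inequality**. -/
theorem prob_mul_le_inter (h0 : 0 ≤ p) (h1 : p ≤ 1) {A B : Set (E → Bool)} (hA : IsUpperSet A)
    (hB : IsUpperSet B) : prob p A * prob p B ≤ prob p (A ∩ B) := by
  classical
  have hmono : ∀ {C : Set (E → Bool)}, IsUpperSet C →
      Monotone (fun ω => if ω ∈ C then (1 : ℝ) else 0) := fun {C} hC ω ω' h => by
    by_cases hω : ω ∈ C
    · simp [hω, hC h hω]
    · simp only [hω, if_false]
      split_ifs <;> norm_num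
  have key := fkg (fun ω => if ω ∈ A then (1 : ℝ) else 0)
    (fun ω => if ω ∈ B then (1 : ℝ) else 0) (wt p) (wt_nonneg h0 h1)
    (fun ω => by dsimp only [Pi.zero_apply]; split_ifs <;> norm_num)
    (fun ω => by dsimp only [Pi.zero_apply]; split_ifs <;> norm_num) (hmono hA) (hmono hB) (fun ω ω' => by
      unfold wt
      rw [← Finset.prod_mul_distrib, ← Finset.prod_mul_distrib]
      refine le_of_eq (Finset.prod_congr rfl fun e _ => ?_)
      simp only [Pi.inf_apply, Pi.sup_apply]
      rcases Bool.eq_false_or_eq_true (ω e) with h | h <;>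
        rcases Bool.eq_false_or_eq_true (ω' e) with h' | h' <;> simp [h, h', mul_comm])
  rw [sum_wt, one_mul] at key
  unfold prob
  refine le_trans (le_of_eq ?_) (key.trans (le_of_eq ?_))
  · simp
  · refine Finset.sum_congr rfl fun ω _ => ?_
    by_cases h : ω ∈ A <;> by_cases h' : ω ∈ B <;> simp [h, h']

/-- Harris for the complement of `A`. This makes conditioning on the increasing event `degEvent`
harmless for decreasing bad events. -/
theorem prob_inter_le_mul (h0 : 0 ≤ p) (h1 : p ≤ 1) {A B : Set (E → Bool)} (hA : IsLowerSet A)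
    (hB : IsUpperSet B) : prob p (A ∩ B) ≤ prob p A * prob p B := by
  classical
  have h := prob_mul_le_inter h0 h1 hA.compl hB
  have h2 : prob p (A ∩ B) + prob p (Aᶜ ∩ B) = prob p B := by
    unfold prob
    rw [← Finset.sum_add_distrib]
    refine Finset.sum_congr rfl fun ω _ => ?_
    by_cases h : ω ∈ A <;> by_cases h' : ω ∈ B <;> simp [h, h']
  have h3 := prob_add_compl (p := p) A
  have h4 : prob p Aᶜ = 1 - prob p A := by linarith
  rw [h4] at h
  linarith

theorem prod_prob_le_iInter {ι : Type*} [DecidableEq ι] (h0 : 0 ≤ p) (h1 : p ≤ 1) (s : Finset ι)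
    (A : ι → Set (E → Bool)) (hA : ∀ i ∈ s, IsUpperSet (A i)) :
    ∏ i ∈ s, prob p (A i) ≤ prob p {ω | ∀ i ∈ s, ω ∈ A i} := by
  induction s using Finset.induction_on with
  | empty => simp [Set.ofPred_true, prob_univ]
  | insert a s ha ih =>
    rw [Finset.prod_insert ha]
    have h := ih fun i hi => hA i (Finset.mem_insert_of_mem hi)
    have : {ω | ∀ i ∈ insert a s, ω ∈ A i} = A a ∩ {ω | ∀ i ∈ s, ω ∈ A i} := by
      ext ω; simp
    rw [this]
    refine (mul_le_mul_of_nonneg_left h (prob_nonneg h0 h1 _)).trans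
      (prob_mul_le_inter h0 h1 (hA a (Finset.mem_insert_self a s)) ?_)
    intro ω ω' hω h i hi
    exact hA i (Finset.mem_insert_of_mem hi) hω (h i hi)

/-- Switching the coordinate `e` off changes the weight by the factor `(1 - p) / p`. -/
theorem wt_update_false {ω : E → Bool} {e : E} (h : ω e = true) :
    wt p ω * (1 - p) = wt p (Function.update ω e false) * p := by
  unfold wt
  rw [← Finset.mul_prod_erase _ _ (Finset.mem_univ e), ← Finset.mul_prod_erase (a := e) _
    (fun i => if Function.update ω e false i = true then p else 1 - p) (Finset.mem_univ e)]
  have : ∏ x ∈ Finset.univ.erase e, (if Function.update ω e false x = true then p else 1 - p)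
      = ∏ x ∈ Finset.univ.erase e, (if ω x = true then p else 1 - p) :=
    Finset.prod_congr rfl fun x hx => by
      rw [Function.update_of_ne (Finset.ne_of_mem_erase hx)]
  rw [this]
  simp [h]
  ring

theorem sum_wt_mul_pow (F : Finset E) (t : ℝ) :
    ∑ ω : E → Bool, wt p ω * t ^ (F.filter fun e => ω e = true).card
      = (1 - p + p * t) ^ F.card := by
  have h := Finset.prod_univ_sum (fun _ : E => (Finset.univ : Finset Bool))
    (fun e b => (if b then p else 1 - p) * if b ∧ e ∈ F then t else 1)
  simp only [Fintype.piFinset_univ] at h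
  have h2 : ∀ ω : E → Bool, wt p ω * t ^ (F.filter fun e => ω e = true).card =
      ∏ e, ((if ω e then p else 1 - p) * if ω e ∧ e ∈ F then t else 1) := fun ω => by
    rw [Finset.prod_mul_distrib, ← Finset.prod_filter, Finset.prod_const]
    unfold wt
    congr 3
    ext e
    simp [and_comm]
  simp_rw [h2]
  rw [← h]
  have h3 : ∀ e : E, ∑ j : Bool, (if j then p else 1 - p) * (if j = true ∧ e ∈ F then t else 1) =
      if e ∈ F then 1 - p + p * t else 1 := fun e => by
    by_cases he : e ∈ F <;> simp [he]
    ring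
  simp_rw [h3]
  simp

/-- **Chernoff bound** for the lower tail. -/
theorem prob_card_le (h0 : 0 ≤ p) (h1 : p ≤ 1) (F : Finset E) {t a : ℝ} (ht0 : 0 < t) (ht1 : t ≤ 1)
    : prob p {ω | ((F.filter fun e => ω e = true).card : ℝ) ≤ a}
      ≤ t ^ (-a) * Real.exp (-(p * (1 - t) * F.card)) := by
  classical
  have hmain : prob p {ω | ((F.filter fun e => ω e = true).card : ℝ) ≤ a}
      ≤ t ^ (-a) * ∑ ω : E → Bool, wt p ω * t ^ (F.filter fun e => ω e = true).card := by
    unfold prob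
    rw [Finset.mul_sum]
    refine Finset.sum_le_sum fun ω _ => ?_
    have hw := wt_nonneg h0 h1 ω
    split_ifs with h
    -- Markov's inequality for `t ^ X`, where `X` counts the successes and `t ≤ 1`: on the event, `X
    -- - a ≤ 0`.
    · have : 1 ≤ t ^ (-a) * t ^ (F.filter fun e => ω e = true).card := by
        rw [← Real.rpow_natCast, ← Real.rpow_add ht0]
        refine Real.one_le_rpow_of_pos_of_le_one_of_nonpos ht0 ht1 ?_
        have : ((F.filter fun e => ω e = true).card : ℝ) ≤ a := h
        linarith
      nlinarith
    · positivity
  refine hmain.trans ?_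
  rw [sum_wt_mul_pow]
  refine mul_le_mul_of_nonneg_left ?_ (by positivity)
  have : 1 - p + p * t ≤ Real.exp (-(p * (1 - t))) := by
    have := Real.add_one_le_exp (-(p * (1 - t)))
    linarith
  calc (1 - p + p * t) ^ F.card ≤ Real.exp (-(p * (1 - t))) ^ F.card :=
        pow_le_pow_left₀ (by nlinarith) this _
    _ = _ := by rw [← Real.exp_nat_mul]; congr 1; ring

theorem one_sub_pow_le (h1 : p ≤ 1) (k : ℕ) : (1 - p) ^ k ≤ Real.exp (-(p * k)) := by
  have : 1 - p ≤ Real.exp (-p) := by have := Real.add_one_le_exp (-p); linarith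
  calc (1 - p) ^ k ≤ Real.exp (-p) ^ k := pow_le_pow_left₀ (by linarith) this _
    _ = _ := by rw [← Real.exp_nat_mul]; congr 1; ring

/-- Union bound over no success and a single success at a named place. At the mean 6.3 used later,
Chernoff loses a factor above 2, too much for the union bound over about `3 ^ n` pairs of sets. -/
theorem prob_card_le_one (h0 : 0 ≤ p) (h1 : p ≤ 1) (F : Finset E) :
    prob p {ω | (F.filter fun e => ω e = true).card ≤ 1}
      ≤ (1 + p * F.card) * Real.exp (-(p * (F.card - 1))) := by
  classical
  let A : Option E → Set (E → Bool) := fun o => match o with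
    | none => {ω | ∀ e ∈ F, ω e = false}
    | some e => {ω | ω e = true} ∩ {ω | ∀ e' ∈ F.erase e, ω e' = false}
  have h := prob_le_sum h0 h1 (insert none (F.map Function.Embedding.some))
    {ω | (F.filter fun e => ω e = true).card ≤ 1} A (fun ω hω => by
      rcases Nat.le_one_iff_eq_zero_or_eq_one.mp (show _ ≤ 1 from hω) with h | h
      · refine ⟨none, by simp, fun e he => ?_⟩
        rw [Finset.card_eq_zero, Finset.filter_eq_empty_iff] at h
        simpa using h he
      · obtain ⟨e, he⟩ := Finset.card_eq_one.mp h
        have hm : ∀ x, x ∈ F ∧ ω x = true ↔ x = e := fun x => by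
          have := Finset.ext_iff.mp he x; simpa using this
        refine ⟨some e, by simpa using ((hm e).2 rfl).1, ((hm e).2 rfl).2, fun x hx => ?_⟩
        by_contra hc
        exact (Finset.ne_of_mem_erase hx)
          ((hm x).1 ⟨Finset.mem_of_mem_erase hx, by simpa using hc⟩))
  refine h.trans ?_
  rw [Finset.sum_insert (by simp), Finset.sum_map]
  have hsome : ∀ e ∈ F, prob p (A (Function.Embedding.some e)) =
      p * (1 - p) ^ (F.card - 1) := fun e he => by
    have := prob_indep (p := p) (determinedBy_coord e true) (determinedBy_all (F.erase e) false)
      (by simp)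
    rw [prob_coord_true, prob_all_false, Finset.card_erase_of_mem he] at this
    exact this
  rw [Finset.sum_congr rfl hsome, Finset.sum_const, nsmul_eq_mul]
  have hnone : prob p (A none) = (1 - p) ^ F.card := prob_all_false F
  rw [hnone]
  rcases Nat.eq_zero_or_pos F.card with hF | hF
  · simp [hF, h0]
  · have e1 := one_sub_pow_le h1 (F.card - 1)
    have e2 : (1 - p) ^ F.card ≤ (1 - p) ^ (F.card - 1) :=
      pow_le_pow_of_le_one (by linarith) (by linarith) (by omega)
    rw [Nat.cast_sub hF, Nat.cast_one] at e1
    have e3 : 0 ≤ (1 - p) ^ (F.card - 1) := pow_nonneg (by linarith) _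
    nlinarith [mul_nonneg h0 (Nat.cast_nonneg (α := ℝ) F.card)]

end BernoulliProduct

/-! ### Consecutive entries of duplicate-free lists -/

section ListAdjacency

variable {V : Type*}

/-- `a` and `b` are consecutive entries of `l`, in some order. -/
def Nb (l : List V) (a b : V) : Prop := [a, b] <:+: l ∨ [b, a] <:+: l

theorem Nb.symm {l : List V} {a b : V} (h : Nb l a b) : Nb l b a := Or.symm h

theorem pair_infix_cons {l : List V} {x a b : V} :
    [a, b] <:+: x :: l ↔ (x = a ∧ l.head? = some b) ∨ [a, b] <:+: l := by
  rw [List.infix_cons_iff, List.cons_prefix_cons]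
  cases l with
  | nil => simp
  | cons y l => simp [List.cons_prefix_cons, eq_comm]

theorem pair_infix_append {l₁ l₂ : List V} {a b : V} :
    [a, b] <:+: l₁ ++ l₂ ↔
      [a, b] <:+: l₁ ∨ [a, b] <:+: l₂ ∨ (l₁.getLast? = some a ∧ l₂.head? = some b) := by
  induction l₁ with
  | nil => simp
  | cons x l ih =>
    rw [List.cons_append, pair_infix_cons, pair_infix_cons, ih]
    cases l with
    | nil => simp; tauto
    | cons y l => simp [List.getLast?_cons_cons]; tauto

theorem Nb.mem_left {l : List V} {a b : V} (h : Nb l a b) : a ∈ l := by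
  rcases h with h | h <;> exact h.subset (by simp)

theorem Nb.mem_right {l : List V} {a b : V} (h : Nb l a b) : b ∈ l := h.symm.mem_left

theorem nb_append {l₁ l₂ : List V} {a b : V} :
    Nb (l₁ ++ l₂) a b ↔ Nb l₁ a b ∨ Nb l₂ a b ∨ (l₁.getLast? = some a ∧ l₂.head? = some b) ∨
      (l₁.getLast? = some b ∧ l₂.head? = some a) := by
  unfold Nb
  rw [pair_infix_append, pair_infix_append]
  tauto

theorem nb_cons {l : List V} {x a b : V} :
    Nb (x :: l) a b ↔ Nb l a b ∨ (x = a ∧ l.head? = some b) ∨ (x = b ∧ l.head? = some a) := by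
  unfold Nb
  rw [pair_infix_cons, pair_infix_cons]
  tauto

theorem nb_reverse {l : List V} {a b : V} : Nb l.reverse a b ↔ Nb l a b := by
  have h : ∀ x y : V, [x, y] <:+: l.reverse ↔ [y, x] <:+: l := fun x y => by
    rw [← List.reverse_infix]; simp
  unfold Nb
  rw [h, h, or_comm]

theorem next_unique {l : List V} (hl : l.Nodup) {a b c : V} (hb : [a, b] <:+: l)
    (hc : [a, c] <:+: l) : b = c := by
  induction l with
  | nil => simp at hb
  | cons x l ih =>
    rw [pair_infix_cons] at hb hc
    have hx := (List.nodup_cons.mp hl).1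
    rcases hb with ⟨rfl, hb⟩ | hb <;> rcases hc with ⟨h, hc⟩ | hc
    · simpa [hb] using hc
    · exact absurd (hc.subset (by simp)) hx
    · subst h; exact absurd (hb.subset (by simp)) hx
    · exact ih (List.nodup_cons.mp hl).2 hb hc

theorem prev_unique {l : List V} (hl : l.Nodup) {a b c : V} (hb : [b, a] <:+: l)
    (hc : [c, a] <:+: l) : b = c := by
  have h : ∀ x y : V, [x, y] <:+: l → [y, x] <:+: l.reverse := fun x y h => by
    rw [← List.reverse_infix] at h; simpa using h
  exact next_unique (List.nodup_reverse.mpr hl) (h _ _ hb) (h _ _ hc)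

theorem not_prev_head {l : List V} (hl : l.Nodup) {a u : V} (hu : l.head? = some u) :
    ¬ [a, u] <:+: l := by
  cases l with
  | nil => simp at hu
  | cons x l =>
    obtain rfl : x = u := by simpa using hu
    rw [pair_infix_cons]
    have hx := (List.nodup_cons.mp hl).1
    rintro (⟨rfl, h⟩ | h)
    · exact hx (List.mem_of_mem_head? h)
    · exact hx (h.subset (by simp))

/-- Each entry of a duplicate-free list has at most two neighbours in it, and the first one at
most one. -/
theorem card_nb_pairs_le [Fintype V] [DecidableEq V] {l : List V} (hl : l.Nodup) {S : Finset V}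
    {u : V} (hu : l.head? = some u) (huS : u ∈ S) (X : Finset (V × V))
    (hX : ∀ x ∈ X, x.1 ∈ S ∧ Nb l x.1 x.2) : X.card + 1 ≤ 2 * S.card := by
  classical
  -- The flag tells successor from predecessor, and either is unique. The value `(u, false)` is
  -- never taken, as the head has no predecessor; this is the `+ 1`.
  let f : V × V → V × Bool := fun x => (x.1, decide ([x.1, x.2] <:+: l))
  have hf : Set.InjOn f X := by
    rintro ⟨a, b⟩ hab ⟨a', b'⟩ hab' h
    simp only [f, Prod.mk.injEq, decide_eq_decide] at h
    obtain ⟨rfl, h⟩ := h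
    have h1 : Nb l a b := (hX _ hab).2
    have h2 : Nb l a b' := (hX _ hab').2
    by_cases hc : [a, b] <:+: l
    · rw [next_unique hl hc (h.mp hc)]
    · rw [prev_unique hl (h1.resolve_left hc) (h2.resolve_left fun h' => hc (h.mpr h'))]
  have hsub : X.image f ⊆ (S ×ˢ Finset.univ).erase (u, false) := by
    intro y hy
    obtain ⟨⟨a, b⟩, hab, rfl⟩ := Finset.mem_image.mp hy
    refine Finset.mem_erase.mpr
      ⟨?_, Finset.mem_product.mpr ⟨(hX _ hab).1, Finset.mem_univ _⟩⟩
    simp only [f, ne_eq, Prod.mk.injEq, decide_eq_false_iff_not, not_and, not_not]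
    rintro rfl
    rcases (hX _ hab).2 with h | h
    · exact h
    · exact absurd h (not_prev_head hl hu)
  have := Finset.card_le_card hsub
  rw [Finset.card_image_of_injOn hf, Finset.card_erase_of_mem (by simpa using huS),
    Finset.card_product] at this
  have hS : 0 < S.card := Finset.card_pos.mpr ⟨u, huS⟩
  simp at this
  omega

/-- The set of pairs of consecutive entries of a list. -/
def listEdges [DecidableEq V] (l : List V) : Finset (Sym2 V) :=
  ((l.zip l.tail).map fun x => s(x.1, x.2)).toFinset

theorem mem_listEdges [DecidableEq V] {l : List V} {a b : V} :
    s(a, b) ∈ listEdges l ↔ Nb l a b := by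
  have h : ∀ x y : V, (x, y) ∈ l.zip l.tail ↔ [x, y] <:+: l := fun x y => by
    induction l with
    | nil => simp
    | cons z l ih =>
      rw [pair_infix_cons]
      cases l with
      | nil => simp
      | cons w l =>
        rw [← ih]
        simp [eq_comm]
  simp only [listEdges, List.mem_toFinset, List.mem_map, Prod.exists, h, Nb, Sym2.eq_iff]
  constructor
  · rintro ⟨x, y, hxy, ⟨rfl, rfl⟩ | ⟨rfl, rfl⟩⟩
    · exact Or.inl hxy
    · exact Or.inr hxy
  · rintro (h | h)
    · exact ⟨a, b, h, Or.inl ⟨rfl, rfl⟩⟩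
    · exact ⟨b, a, h, Or.inr ⟨rfl, rfl⟩⟩

theorem card_listEdges_le [DecidableEq V] (l : List V) : (listEdges l).card ≤ l.length := by
  refine (List.toFinset_card_le _).trans ?_
  simp

end ListAdjacency

/-! ### Pósa rotations that respect the matching -/

section Systems

variable {V : Type*}

/-- The black vertices `B`, the vertices `K` that the Hamilton cycle has to visit, and the
matching `M` that it has to use. -/
structure Frame (V : Type*) where
  B : Finset V
  K : Finset V
  M : V → V → Prop
  B_subset : B ⊆ K
  M_symm : ∀ {a b}, M a b → M b a
  M_mem : ∀ {a b}, M a b → a ∈ K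
  M_notMem : ∀ {a b}, M a b → a ∉ B
  M_unique : ∀ {a b c}, M a b → M a c → b = c
  M_irrefl : ∀ a, ¬ M a a

/-- The usable links: edges of `H` with a black endpoint, and the pairs of the matching. -/
def Frame.Lnk (F : Frame V) (H : SimpleGraph V) (u v : V) : Prop :=
  (H.Adj u v ∧ (u ∈ F.B ∨ v ∈ F.B)) ∨ F.M u v

theorem Frame.Lnk.symm {F : Frame V} {H : SimpleGraph V} {u v : V} (h : F.Lnk H u v) :
    F.Lnk H v u :=
  h.imp (fun h => ⟨h.1.symm, h.2.symm⟩) F.M_symm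

theorem Frame.Lnk.adj_of_mem {F : Frame V} {H : SimpleGraph V} {u v : V} (h : F.Lnk H u v)
    (hv : v ∈ F.B) : H.Adj u v :=
  h.elim And.left fun h => absurd hv (F.M_notMem (F.M_symm h))

/-- A path, given by the list of its vertices, that contains with every matched vertex also its
matching edge. -/
structure Frame.IsSys (F : Frame V) (H : SimpleGraph V) (l : List V) : Prop where
  nodup : l.Nodup
  mem_K : ∀ v ∈ l, v ∈ F.K
  lnk : ∀ a b, Nb l a b → F.Lnk H a b
  closed : ∀ a b, F.M a b → a ∈ l → Nb l a b

/-- A path of maximum length. -/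
def Frame.IsMaxSys (F : Frame V) (H : SimpleGraph V) (l : List V) : Prop :=
  F.IsSys H l ∧ ∀ l', F.IsSys H l' → l'.length ≤ l.length

theorem Frame.IsSys.mono {F : Frame V} {H H' : SimpleGraph V} (h : H ≤ H') {l : List V}
    (hl : F.IsSys H l) : F.IsSys H' l :=
  ⟨hl.nodup, hl.mem_K, fun a b hab => (hl.lnk a b hab).imp (fun x => ⟨h x.1, x.2⟩) id, hl.closed⟩

theorem Frame.IsSys.reverse {F : Frame V} {H : SimpleGraph V} {l : List V}
    (hl : F.IsSys H l) : F.IsSys H l.reverse :=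
  ⟨List.nodup_reverse.mpr hl.nodup, fun v hv => hl.mem_K v (List.mem_reverse.mp hv),
    fun a b h => hl.lnk a b (nb_reverse.mp h),
    fun a b h ha => nb_reverse.mpr (hl.closed a b h (List.mem_reverse.mp ha))⟩

theorem Frame.IsSys.length_le {F : Frame V} {H : SimpleGraph V} {l : List V}
    (hl : F.IsSys H l) : l.length ≤ F.K.card := by
  classical
  rw [← List.toFinset_card_of_nodup hl.nodup]
  exact Finset.card_le_card fun v hv => hl.mem_K v (List.mem_toFinset.mp hv)

theorem Frame.exists_isMaxSys (F : Frame V) (H : SimpleGraph V) : ∃ l, F.IsMaxSys H l := by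
  have hne : {k | ∃ l, F.IsSys H l ∧ l.length = k}.Nonempty :=
    ⟨0, [], ⟨List.nodup_nil, by simp, fun a b h => by simpa using h.mem_left,
      fun a b _ h => by simp at h⟩, rfl⟩
  have hbdd : BddAbove {k | ∃ l, F.IsSys H l ∧ l.length = k} :=
    ⟨F.K.card, by rintro k ⟨l, hl, rfl⟩; exact hl.length_le⟩
  obtain ⟨l, hl, hk⟩ := Nat.sSup_mem hne hbdd
  exact ⟨l, hl, fun l' hl' => hk ▸ le_csSup hbdd ⟨l', hl', rfl⟩⟩

/-- Exchanging one link of a path for another one preserves the path structure, as long as the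
removed link has a black endpoint. -/
theorem Frame.IsSys.exchange {F : Frame V} {H : SimpleGraph V} {l l' : List V}
    (hl : F.IsSys H l) (hp : l'.Perm l) {u v y z : V} (huv : F.Lnk H u v) (hz : z ∈ F.B)
    (h1 : ∀ a b, Nb l' a b → Nb l a b ∨ (a = u ∧ b = v) ∨ (a = v ∧ b = u))
    (h2 : ∀ a b, Nb l a b → Nb l' a b ∨ (a = y ∧ b = z) ∨ (a = z ∧ b = y)) :
    F.IsSys H l' := by
  refine ⟨hp.nodup_iff.mpr hl.nodup, fun v hv => hl.mem_K v (hp.mem_iff.mp hv), fun a b h => ?_,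
    fun a b h ha => ?_⟩
  · rcases h1 a b h with h | ⟨rfl, rfl⟩ | ⟨rfl, rfl⟩
    · exact hl.lnk a b h
    · exact huv
    · exact huv.symm
  · rcases h2 a b (hl.closed a b h (hp.mem_iff.mp ha)) with h' | ⟨rfl, rfl⟩ | ⟨rfl, rfl⟩
    · exact h'
    -- Matched vertices are not black, so the removed link is not a matching pair.
    · exact absurd hz (F.M_notMem (F.M_symm h))
    · exact absurd hz (F.M_notMem h)

/-- A path one of whose ends is adjacent to a vertex outside can be extended. -/
theorem Frame.IsSys.extend {F : Frame V} {H : SimpleGraph V} {l : List V} (hl : F.IsSys H l)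
    {u y : V} (hu : l.head? = some u) (hy : y ∈ F.K) (hyl : y ∉ l)
    (hadj : H.Adj y u) (hB : y ∈ F.B ∨ u ∈ F.B) : ∃ l', F.IsSys H l' ∧ l.length < l'.length := by
  have hlnk : F.Lnk H y u := Or.inl ⟨hadj, hB⟩
  have key : ∀ a b, Nb (y :: l) a b → F.Lnk H a b := fun a b h => by
    rcases nb_cons.mp h with h' | ⟨rfl, h'⟩ | ⟨rfl, h'⟩
    · exact hl.lnk a b h'
    · rw [hu] at h'; cases h'; exact hlnk
    · rw [hu] at h'; cases h'; exact hlnk.symm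
  -- A partner of `y` is also off the path, by closedness, and has to be prepended together with
  -- `y`.
  by_cases hM : ∃ y', F.M y y'
  · obtain ⟨y', hy'⟩ := hM
    have hy'l : y' ∉ l := fun h => hyl (hl.closed y' y (F.M_symm hy') h).mem_right
    have hne : y ≠ y' := fun h => F.M_irrefl y (by rwa [← h] at hy')
    refine ⟨y' :: y :: l, ⟨?_, ?_, ?_, ?_⟩, by simp⟩
    · simp [hl.nodup, hyl, hy'l, hne.symm]
    · simp only [List.mem_cons]
      rintro v (rfl | rfl | hv)
      · exact F.M_mem (F.M_symm hy')
      · exact hy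
      · exact hl.mem_K v hv
    · intro a b h
      rcases nb_cons.mp h with h' | ⟨rfl, h'⟩ | ⟨rfl, h'⟩
      · exact key a b h'
      · obtain rfl : y = b := by simpa using h'
        exact Or.inr (F.M_symm hy')
      · obtain rfl : y = a := by simpa using h'
        exact Or.inr hy'
    · intro a b hab ha
      rw [nb_cons, nb_cons]
      simp only [List.mem_cons] at ha
      rcases ha with rfl | rfl | ha
      · obtain rfl := F.M_unique hab (F.M_symm hy')
        simp
      · obtain rfl := F.M_unique hab hy'
        simp
      · exact Or.inl (Or.inl (hl.closed a b hab ha))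
  · refine ⟨y :: l, ⟨?_, ?_, key, ?_⟩, by simp⟩
    · simp [hl.nodup, hyl]
    · simp only [List.mem_cons]
      rintro v (rfl | hv)
      · exact hy
      · exact hl.mem_K v hv
    · intro a b hab ha
      rcases List.mem_cons.mp ha with rfl | ha
      · exact absurd ⟨b, hab⟩ hM
      · exact nb_cons.mpr (Or.inl (hl.closed a b hab ha))

/-- A rotation: the end `u` of the path is joined to the black vertex `v` of the path, and the
link of `v` in the direction of `u` is removed. -/
def Frame.Rot (F : Frame V) (H : SimpleGraph V) (l l' : List V) : Prop :=
  ∃ u l₁ v l₂, l = (u :: l₁) ++ v :: l₂ ∧ v ∈ F.B ∧ H.Adj u v ∧ l' = (u :: l₁).reverse ++ v :: l₂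

/-- Compared with `nb_unrotate`, the link `u v` replaces the one from the last entry of `u :: l₁` to
`v`; nothing else changes. -/
theorem nb_rotate {u v a b : V} {l₁ l₂ : List V} :
    Nb ((u :: l₁).reverse ++ v :: l₂) a b ↔ Nb (u :: l₁) a b ∨ Nb (v :: l₂) a b ∨
      (a = u ∧ b = v) ∨ (a = v ∧ b = u) := by
  rw [nb_append, nb_reverse, List.getLast?_reverse]
  simp only [List.head?_cons, Option.some.injEq]
  constructor
  · rintro (h | h | ⟨rfl, rfl⟩ | ⟨rfl, rfl⟩) <;> simp [*]
  · rintro (h | h | ⟨rfl, rfl⟩ | ⟨rfl, rfl⟩) <;> simp [*]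

theorem nb_unrotate {u v a b : V} {l₁ l₂ : List V} :
    Nb ((u :: l₁) ++ v :: l₂) a b ↔ Nb (u :: l₁) a b ∨ Nb (v :: l₂) a b ∨
      (a = (u :: l₁).getLast (by simp) ∧ b = v) ∨ (a = v ∧ b = (u :: l₁).getLast (by simp)) := by
  rw [nb_append, List.getLast?_eq_some_getLast (by simp)]
  simp only [List.head?_cons, Option.some.injEq]
  constructor
  · rintro (h | h | ⟨rfl, rfl⟩ | ⟨rfl, rfl⟩) <;> simp [*]
  · rintro (h | h | ⟨rfl, rfl⟩ | ⟨rfl, rfl⟩) <;> simp [*]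

theorem Frame.Rot.isSys {F : Frame V} {H : SimpleGraph V} {l l' : List V} (h : F.Rot H l l')
    (hl : F.IsSys H l) : F.IsSys H l' := by
  obtain ⟨u, l₁, v, l₂, rfl, hv, huv, rfl⟩ := h
  refine hl.exchange ((List.reverse_perm _).append_right _) (u := u) (v := v)
    (y := (u :: l₁).getLast (by simp)) (z := v) (Or.inl ⟨huv, Or.inr hv⟩) hv ?_ ?_
  · intro a b h
    rw [nb_rotate] at h
    rw [nb_unrotate]
    tauto
  · intro a b h
    rw [nb_unrotate] at h
    rw [nb_rotate]
    tauto

theorem Frame.Rot.length_eq {F : Frame V} {H : SimpleGraph V} {l l' : List V}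
    (h : F.Rot H l l') : l'.length = l.length := by
  obtain ⟨u, l₁, v, l₂, rfl, hv, huv, rfl⟩ := h
  simp only [List.length_append, List.length_reverse]

theorem Frame.Rot.getLast?_eq {F : Frame V} {H : SimpleGraph V} {l l' : List V}
    (h : F.Rot H l l') : l'.getLast? = l.getLast? := by
  obtain ⟨u, l₁, v, l₂, rfl, hv, huv, rfl⟩ := h
  rw [List.getLast?_append, List.getLast?_append, List.getLast?_eq_some_getLast (by simp)]
  rfl

/-- The removed link has the black endpoint `v`, so it is an edge of `H`, and rotating along it
undoes the rotation. -/
theorem Frame.Rot.symm {F : Frame V} {H : SimpleGraph V} {l l' : List V} (h : F.Rot H l l')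
    (hl : F.IsSys H l) : F.Rot H l' l := by
  obtain ⟨u, l₁, v, l₂, rfl, hv, huv, rfl⟩ := h
  obtain ⟨y, l₃, h3⟩ : ∃ y l₃, (u :: l₁).reverse = y :: l₃ := List.exists_cons_of_ne_nil (by simp)
  have hy : (u :: l₁).getLast (by simp) = y := by
    have := congrArg List.head? h3
    rw [List.head?_reverse, List.getLast?_eq_some_getLast (by simp)] at this
    simpa using this
  refine ⟨y, l₃, v, l₂, by rw [h3], hv, ?_, ?_⟩
  · refine (hl.lnk y v ?_).adj_of_mem hv
    rw [nb_unrotate]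
    exact Or.inr (Or.inr (Or.inl ⟨hy.symm, rfl⟩))
  · rw [← h3, List.reverse_reverse]

/-- Reachability by rotations. -/
def Frame.Reach (F : Frame V) (H : SimpleGraph V) : List V → List V → Prop :=
  Relation.ReflTransGen (F.Rot H)

theorem Frame.Reach.isMaxSys {F : Frame V} {H : SimpleGraph V} {l l' : List V}
    (h : F.Reach H l l') (hl : F.IsMaxSys H l) :
    F.IsMaxSys H l' ∧ l'.getLast? = l.getLast? ∧ F.Reach H l' l ∧ l'.length = l.length := by
  induction h with
  | refl => exact ⟨hl, rfl, Relation.ReflTransGen.refl, rfl⟩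
  | tail _ h ih =>
    obtain ⟨h1, h2, h3, h4⟩ := ih
    exact ⟨⟨h.isSys h1.1, fun l' hl' => h.length_eq ▸ h1.2 l' hl'⟩, h.getLast?_eq.trans h2,
      Relation.ReflTransGen.head (h.symm h1.1) h3, h.length_eq.trans h4⟩

theorem Frame.IsMaxSys.reverse {F : Frame V} {H : SimpleGraph V} {l : List V}
    (hl : F.IsMaxSys H l) : F.IsMaxSys H l.reverse :=
  ⟨hl.1.reverse, fun l' hl' => by simpa using hl.2 l' hl'⟩

/-- The ends of the paths reachable by rotations. -/
def Frame.EndSet (F : Frame V) (H : SimpleGraph V) (P : List V) : Set V :=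
  {u | ∃ Q, F.Reach H P Q ∧ Q.head? = some u}

/-- Follows from reversibility of rotations; it lets arguments about the end set start from any
reachable path. -/
theorem Frame.Reach.endSet_eq {F : Frame V} {H : SimpleGraph V} {l l' : List V}
    (h : F.Reach H l l') (hl : F.IsMaxSys H l) : F.EndSet H l' = F.EndSet H l := by
  ext u
  constructor
  · rintro ⟨Q, hQ, hu⟩
    exact ⟨Q, h.trans hQ, hu⟩
  · rintro ⟨Q, hQ, hu⟩
    exact ⟨Q, (h.isMaxSys hl).2.2.1.trans hQ, hu⟩

theorem Frame.endSet_subset {F : Frame V} {H : SimpleGraph V} {P : List V}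
    (hP : F.IsMaxSys H P) {u : V} (hu : u ∈ F.EndSet H P) : u ∈ F.K := by
  obtain ⟨Q, hQ, hu⟩ := hu
  exact (hQ.isMaxSys hP).1.1.mem_K u (List.mem_of_mem_head? hu)

/-- A black neighbour of an end of a maximum path lies on the path, and rotating there gives
another end. -/
theorem Frame.IsMaxSys.rotate {F : Frame V} {H : SimpleGraph V} {Q : List V}
    (hQ : F.IsMaxSys H Q) {u w : V} (hu : Q.head? = some u) (hw : w ∈ F.B) (huw : H.Adj u w) :
    ∃ l₁ l₂, Q = (u :: l₁) ++ w :: l₂ ∧ F.Rot H Q ((u :: l₁).reverse ++ w :: l₂) := by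
  have hwQ : w ∈ Q := by
    by_contra hc
    obtain ⟨l', hl', hlt⟩ := hQ.1.extend hu (F.B_subset hw) hc huw.symm (Or.inl hw)
    exact absurd (hQ.2 l' hl') (not_le.mpr hlt)
  obtain ⟨a, l₂, rfl⟩ := List.append_of_mem hwQ
  cases a with
  | nil =>
    obtain rfl : w = u := by simpa using hu
    exact absurd huw (H.irrefl)
  | cons x l₁ =>
    obtain rfl : x = u := by simpa using hu
    exact ⟨l₁, l₂, rfl, x, l₁, w, l₂, rfl, hw, huw, rfl⟩

theorem head?_reverse_append {u w : V} {l₁ l₂ : List V} :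
    ((u :: l₁).reverse ++ w :: l₂).head? = some ((u :: l₁).getLast (by simp)) := by
  rw [List.head?_append, List.head?_reverse, List.getLast?_eq_some_getLast (by simp)]
  rfl

/-- For `l₁ = []` the rotation is the identity and the link persists; the definition of a pivot
excludes this case. -/
theorem not_nb_rotated {u w : V} {l₁ l₂ : List V} (hnd : ((u :: l₁) ++ w :: l₂).Nodup)
    (hne : l₁ ≠ []) :
    ¬ Nb ((u :: l₁).reverse ++ w :: l₂) w ((u :: l₁).getLast (by simp)) := by
  rw [List.nodup_append] at hnd
  have hd := hnd.2.2
  have hy : (u :: l₁).getLast (by simp) ∈ u :: l₁ := List.getLast_mem _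
  have hyu : (u :: l₁).getLast (by simp) ≠ u := by
    rw [List.getLast_cons hne]
    intro h
    exact (List.nodup_cons.mp hnd.1).1 (h ▸ List.getLast_mem hne)
  rw [nb_rotate]
  rintro (h | h | ⟨h, h'⟩ | ⟨h, h'⟩)
  · exact hd _ h.mem_left _ (by simp) rfl
  · exact hd _ hy _ h.mem_right rfl
  · exact hd u (by simp) w (by simp) h.symm
  · exact hyu h'

/-- The link structure at a vertex that never becomes an end. -/
theorem Frame.Reach.nb_invariant {F : Frame V} {H : SimpleGraph V} {P Q : List V}
    (hP : F.IsMaxSys H P) (hQ : F.Reach H P Q) {w : V} (hw : w ∉ F.EndSet H P) :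
    (∃ y ∈ F.EndSet H P, Nb P w y ∧ ∃ Q', F.Reach H P Q' ∧ ¬ Nb Q' w y) ∨
      ∀ a, Nb Q w a ↔ Nb P w a := by
  induction hQ with
  | refl => exact Or.inr fun _ => Iff.rfl
  | @tail Q Q' hQ hrot ih =>
    rcases ih with ih | ih
    · exact Or.inl ih
    have hQ' : F.Reach H P Q' := hQ.tail hrot
    obtain ⟨u, l₁, v, l₂, rfl, hv, huv, rfl⟩ := hrot
    have hu : u ∈ F.EndSet H P := ⟨_, hQ, rfl⟩
    have hy : (u :: l₁).getLast (by simp) ∈ F.EndSet H P := ⟨_, hQ', head?_reverse_append⟩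
    have hwu : w ≠ u := fun h => hw (h ▸ hu)
    have hwy : w ≠ (u :: l₁).getLast (by simp) := fun h => hw (h ▸ hy)
    -- A rotation changes links only at its pivot and at the old and new ends, and `w` is never an
    -- end. The first nontrivial rotation about `w` removes a link that is still one of `P` and
    -- leads to the new end.
    by_cases hwv : w = v
    · subst hwv
      by_cases hl : l₁ = []
      · subst hl
        exact Or.inr ih
      · refine Or.inl ⟨_, hy, (ih _).mp ?_, _, hQ',
          not_nb_rotated (Frame.Reach.isMaxSys hQ hP).1.1.nodup hl⟩
        rw [nb_unrotate]
        exact Or.inr (Or.inr (Or.inr ⟨rfl, rfl⟩))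
    · refine Or.inr fun a => Iff.trans ?_ (ih a)
      rw [nb_rotate, nb_unrotate]
      simp [hwu, hwv, hwy]

/-- A black neighbour of the end set has a neighbour on the path that lies in the end set. -/
theorem Frame.IsMaxSys.exists_nb {F : Frame V} {H : SimpleGraph V} {P : List V}
    (hP : F.IsMaxSys H P) {u w : V} (hu : u ∈ F.EndSet H P) (hw : w ∉ F.EndSet H P)
    (hwB : w ∈ F.B) (huw : H.Adj u w) : ∃ y ∈ F.EndSet H P, Nb P y w := by
  obtain ⟨Q, hQ, hQu⟩ := hu
  rcases hQ.nb_invariant hP hw with ⟨y, hy, h, _⟩ | h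
  · exact ⟨y, hy, h.symm⟩
  · obtain ⟨l₁, l₂, rfl, hrot⟩ := (hQ.isMaxSys hP).1.rotate hQu hwB huw
    refine ⟨_, ⟨_, hQ.tail hrot, head?_reverse_append⟩, ((h _).mp ?_).symm⟩
    rw [nb_unrotate]
    exact Or.inr (Or.inr (Or.inr ⟨rfl, rfl⟩))

/-- The vertices at which a nontrivial rotation is possible. -/
def Frame.Pivot (F : Frame V) (H : SimpleGraph V) (P : List V) : Set V :=
  {w | w ∈ F.B ∧ w ∉ F.EndSet H P ∧
    ∃ u Q, F.Reach H P Q ∧ Q.head? = some u ∧ H.Adj u w ∧ ¬ [u, w] <+: Q}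

/-- At a pivot some link of the path to the end set is missing in another maximum path. -/
theorem Frame.IsMaxSys.exists_avoidable {F : Frame V} {H : SimpleGraph V} {P : List V}
    (hP : F.IsMaxSys H P) {w : V} (hw : w ∈ F.Pivot H P) :
    ∃ y ∈ F.EndSet H P, Nb P w y ∧ ∃ Q', F.Reach H P Q' ∧ ¬ Nb Q' w y := by
  obtain ⟨hwB, hwS, u, Q, hQ, hQu, huw, hnp⟩ := hw
  rcases hQ.nb_invariant hP hwS with h | h
  · exact h
  · obtain ⟨l₁, l₂, rfl, hrot⟩ := (hQ.isMaxSys hP).1.rotate hQu hwB huw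
    have hl : l₁ ≠ [] := by
      rintro rfl
      exact hnp ⟨l₂, rfl⟩
    refine ⟨_, ⟨_, hQ.tail hrot, head?_reverse_append⟩, (h _).mp ?_, _, hQ.tail hrot,
      not_nb_rotated (Frame.Reach.isMaxSys hQ hP).1.1.nodup hl⟩
    rw [nb_unrotate]
    exact Or.inr (Or.inr (Or.inr ⟨rfl, rfl⟩))

/-- If some edge with a black endpoint joins two ends, then some reachable path has a link between
two ends. -/
theorem Frame.IsMaxSys.exists_nb_inside {F : Frame V} {H : SimpleGraph V} {P : List V}
    (hP : F.IsMaxSys H P) {u v : V} (hu : u ∈ F.EndSet H P)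
    (hvB : v ∈ F.B) (huv : H.Adj u v) :
    ∃ Q, F.Reach H P Q ∧ ∃ y ∈ F.EndSet H P, Nb Q v y := by
  obtain ⟨Q, hQ, hQu⟩ := hu
  obtain ⟨l₁, l₂, rfl, hrot⟩ := (hQ.isMaxSys hP).1.rotate hQu hvB huv
  refine ⟨_, hQ, _, ⟨_, hQ.tail hrot, head?_reverse_append⟩, ?_⟩
  rw [nb_unrotate]
  exact Or.inr (Or.inr (Or.inr ⟨rfl, rfl⟩))

end Systems

/-! ### Edge counts at end sets, and pivots -/

open Classical in
/-- The edges of `H` between `S` and `B`. -/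
noncomputable def edgesTo {V : Type*} (H : SimpleGraph V) (S B : Finset V) : Finset (Sym2 V) :=
  ((S ×ˢ B).filter fun x => H.Adj x.1 x.2).image fun x => s(x.1, x.2)

/-- A set `S` with few neighbours `T` in `B` that sends many edges to `B`. -/
structure DenseSpot {V : Type*} (H : SimpleGraph V) (B S T : Finset V) : Prop where
  subset : T ⊆ B
  disj : Disjoint S T
  card_le : T.card + 1 ≤ 2 * S.card
  no_edge : ∀ u ∈ S, ∀ w ∈ B, w ∉ S → w ∉ T → ¬ H.Adj u w
  edges : S.card + T.card + 2 ≤ (edgesTo H S B).card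

section Counting

variable {V : Type*} [Fintype V] [DecidableEq V]

theorem mem_edgesTo {H : SimpleGraph V} {S B : Finset V} {e : Sym2 V} :
    e ∈ edgesTo H S B ↔ ∃ u ∈ S, ∃ w ∈ B, H.Adj u w ∧ e = s(u, w) := by
  classical
  simp only [edgesTo, Finset.mem_image, Finset.mem_filter, Finset.mem_product, Prod.exists]
  constructor
  · rintro ⟨u, w, ⟨⟨hu, hw⟩, h⟩, rfl⟩
    exact ⟨u, hu, w, hw, h, rfl⟩
  · rintro ⟨u, hu, w, hw, h, rfl⟩
    exact ⟨u, w, ⟨⟨hu, hw⟩, h⟩, rfl⟩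

/-- Edge counting at a set `S` all of whose elements have at least four neighbours in `B`. -/
theorem exists_edge_counts (H : SimpleGraph V) (S B T : Finset V)
    (hdeg : ∀ u ∈ S, ∃ N : Finset V, 4 ≤ N.card ∧ ∀ w ∈ N, w ∈ B ∧ H.Adj u w)
    (hT : ∀ w ∈ T, w ∈ B ∧ w ∉ S ∧ ∃ u ∈ S, H.Adj u w) :
    ∃ i a : ℕ, (edgesTo H S B).card = i + a ∧ 4 * S.card ≤ i + 2 * a ∧ T.card ≤ i ∧
      (1 ≤ a → ∃ u ∈ S, ∃ v ∈ S, v ∈ B ∧ H.Adj u v) := by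
  classical
  set X := (S ×ˢ B).filter fun x => H.Adj x.1 x.2 with hX
  let f : V × V → Sym2 V := fun x => s(x.1, x.2)
  -- Ordered pairs leaving `S` inject into edges; those staying inside `S` cover each edge at most
  -- twice. This yields the inequality with `i + 2 * a`.
  let X₁ := X.filter fun x => x.2 ∉ S
  let X₂ := X.filter fun x => x.2 ∈ S
  have hXm : ∀ x, x ∈ X ↔ (x.1 ∈ S ∧ x.2 ∈ B) ∧ H.Adj x.1 x.2 := fun x => by
    simp [hX]
  have hinj : Set.InjOn f X₁ := by
    rintro ⟨a, b⟩ h ⟨a', b'⟩ h' heq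
    simp only [X₁, Finset.coe_filter, Set.mem_ofPred_eq, hXm] at h h'
    rcases Sym2.eq_iff.mp heq with ⟨h1, h2⟩ | ⟨h1, h2⟩
    · simp_all
    · exact absurd (show b' ∈ S from (show a = b' from h1) ▸ h.1.1.1) h'.2
  have hdisj : Disjoint (X₁.image f) (X₂.image f) := by
    rw [Finset.disjoint_left]
    intro e he he'
    obtain ⟨⟨a, b⟩, h, rfl⟩ := Finset.mem_image.mp he
    obtain ⟨⟨a', b'⟩, h', heq⟩ := Finset.mem_image.mp he'
    simp only [X₁, X₂, Finset.mem_filter, hXm] at h h'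
    rcases Sym2.eq_iff.mp heq with ⟨h1, h2⟩ | ⟨h1, h2⟩
    · exact h.2 ((show b' = b from h2) ▸ h'.2)
    · exact h.2 ((show a' = b from h1) ▸ h'.1.1.1)
  have hunion : edgesTo H S B = X₁.image f ∪ X₂.image f := by
    rw [← Finset.image_union]
    have : X₁ ∪ X₂ = X := by
      ext x
      simp only [X₁, X₂, Finset.mem_union, Finset.mem_filter]
      tauto
    rw [this]
    unfold edgesTo
    congr!
  have hX₂ : X₂.card ≤ 2 * (X₂.image f).card := by
    refine Finset.card_le_mul_card_image X₂ 2 fun e he => ?_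
    obtain ⟨⟨a, b⟩, -, rfl⟩ := Finset.mem_image.mp he
    refine (Finset.card_le_card (t := {(a, b), (b, a)}) ?_).trans Finset.card_le_two
    rintro ⟨a', b'⟩ h
    have h := (Finset.mem_filter.mp h).2
    rcases Sym2.eq_iff.mp h with ⟨h1, h2⟩ | ⟨h1, h2⟩ <;> simp_all
  have hXc : X.card = X₁.card + X₂.card := by
    have := Finset.card_filter_add_card_filter_not (s := X) (fun x => x.2 ∈ S)
    simp only [X₁, X₂]
    omega
  have hXS : 4 * S.card ≤ X.card := by
    have h1 : X.card = ∑ u ∈ S, (X.filter fun x => x.1 = u).card :=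
      Finset.card_eq_sum_card_fiberwise fun x hx => ((hXm x).mp hx).1.1
    rw [h1, mul_comm, ← smul_eq_mul, ← Finset.sum_const]
    refine Finset.sum_le_sum fun u hu => ?_
    obtain ⟨N, hN, hNw⟩ := hdeg u hu
    refine hN.trans ?_
    rw [← Finset.card_image_of_injective N (Prod.mk_right_injective u)]
    refine Finset.card_le_card fun x hx => ?_
    obtain ⟨w, hw, rfl⟩ := Finset.mem_image.mp hx
    exact Finset.mem_filter.mpr ⟨(hXm _).mpr ⟨⟨hu, (hNw w hw).1⟩, (hNw w hw).2⟩, rfl⟩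
  have hTX : T.card ≤ X₁.card := by
    refine (Finset.card_le_card (t := X₁.image Prod.snd) fun w hw => ?_).trans
      Finset.card_image_le
    obtain ⟨hwB, hwS, u, hu, huw⟩ := hT w hw
    exact Finset.mem_image.mpr ⟨(u, w), Finset.mem_filter.mpr
      ⟨(hXm _).mpr ⟨⟨hu, hwB⟩, huw⟩, hwS⟩, rfl⟩
  refine ⟨(X₁.image f).card, (X₂.image f).card, ?_, ?_, ?_, ?_⟩
  · rw [hunion, Finset.card_union_of_disjoint hdisj]
  · rw [Finset.card_image_of_injOn hinj]
    omega
  · rwa [Finset.card_image_of_injOn hinj]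
  · intro h
    obtain ⟨e, he⟩ := Finset.card_pos.mp h
    obtain ⟨⟨u, v⟩, hx, -⟩ := Finset.mem_image.mp he
    simp only [X₂, Finset.mem_filter, hXm] at hx
    exact ⟨u, hx.1.1.1, v, hx.2, hx.1.1.2, hx.1.2⟩

open Classical in
/-- The end set as a finset. -/
noncomputable def Frame.ends (F : Frame V) (H : SimpleGraph V) (P : List V) : Finset V :=
  Finset.univ.filter fun u => u ∈ F.EndSet H P

theorem Frame.mem_ends {F : Frame V} {H : SimpleGraph V} {P : List V} {u : V} :
    u ∈ F.ends H P ↔ u ∈ F.EndSet H P := by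
  simp [Frame.ends]

open Classical in
/-- The neighbours in `B` of `S` outside `S`. -/
noncomputable def nbrsIn (H : SimpleGraph V) (B S : Finset V) : Finset V :=
  B.filter fun w => w ∉ S ∧ ∃ u ∈ S, H.Adj u w

theorem mem_nbrsIn {H : SimpleGraph V} {B S : Finset V} {w : V} :
    w ∈ nbrsIn H B S ↔ w ∈ B ∧ w ∉ S ∧ ∃ u ∈ S, H.Adj u w := by
  simp [nbrsIn]

/-- Every vertex of `S` has at least four neighbours in `B`. -/
def MinDegFour (H : SimpleGraph V) (B S : Finset V) : Prop :=
  ∀ u ∈ S, ∃ N : Finset V, 4 ≤ N.card ∧ ∀ w ∈ N, w ∈ B ∧ H.Adj u w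

/-- On each reachable path every vertex of `T` has a path neighbour in `S`, and at most `2|S| - 1`
such places exist. Let `i` edges leave `S` and `a` lie inside it, so `4|S| ≤ i + 2a` and `|T| ≤ i`.
If `a = 0`, then `i ≥ 4|S| ≥ |S| + |T| + 2`. Otherwise some reachable path has a link between two
ends, which takes two further places, so `|T| + 3 ≤ 2|S|`; then `2(i + a) ≥ 4|S| + |T| ≥ 2|S| + 2|T|
+ 3`, and integrality finishes. -/
theorem Frame.IsMaxSys.denseSpot {F : Frame V} {H : SimpleGraph V} {P : List V}
    (hP : F.IsMaxSys H P) (hne : P ≠ []) (hdeg : MinDegFour H F.B F.K) :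
    DenseSpot H F.B (F.ends H P) (nbrsIn H F.B (F.ends H P)) := by
  classical
  set S := F.ends H P with hS
  set T := nbrsIn H F.B S with hT
  have hSm : ∀ u, u ∈ S ↔ u ∈ F.EndSet H P := fun u => Frame.mem_ends
  have hSne : S.Nonempty := by
    obtain ⟨x, l, rfl⟩ := List.exists_cons_of_ne_nil hne
    exact ⟨x, (hSm x).mpr ⟨_, Relation.ReflTransGen.refl, rfl⟩⟩
  have base : ∀ Q, F.Reach H P Q → ∀ X : Finset (V × V),
      (∀ x ∈ X, x.1 ∈ S ∧ Nb Q x.1 x.2) → X.card + 1 ≤ 2 * S.card := fun Q hQ X hX => by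
    have hQm := hQ.isMaxSys hP
    have hQne : Q ≠ [] := fun h => by
      have := hQm.2.2.2
      rw [h] at this
      exact hne (List.length_eq_zero_iff.mp this.symm)
    obtain ⟨x, l, rfl⟩ := List.exists_cons_of_ne_nil hQne
    exact card_nb_pairs_le hQm.1.1.nodup (u := x) rfl ((hSm x).mpr ⟨_, hQ, rfl⟩) X hX
  have hTnb : ∀ Q, F.Reach H P Q → ∃ X : Finset (V × V), X.card = T.card ∧
      (∀ x ∈ X, x.2 ∉ S) ∧ ∀ x ∈ X, x.1 ∈ S ∧ Nb Q x.1 x.2 := fun Q hQ => by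
    have hQm := hQ.isMaxSys hP
    have h : ∀ w, w ∈ T → ∃ y, y ∈ S ∧ Nb Q y w := fun w hw => by
      obtain ⟨hwB, hwS, u, hu, huw⟩ := mem_nbrsIn.mp hw
      have he := hQ.endSet_eq hP
      obtain ⟨y, hy, h⟩ := hQm.1.exists_nb (he ▸ (hSm u).mp hu)
        (fun h => hwS ((hSm w).mpr (he ▸ h))) hwB huw
      exact ⟨y, (hSm y).mpr (he ▸ hy), h⟩
    choose! y hy using h
    refine ⟨T.image fun w => (y w, w), ?_, ?_, ?_⟩
    · exact Finset.card_image_of_injective _ fun a b h => (Prod.mk.inj h).2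
    · intro x hx
      obtain ⟨w, hw, rfl⟩ := Finset.mem_image.mp hx
      exact (mem_nbrsIn.mp hw).2.1
    · intro x hx
      obtain ⟨w, hw, rfl⟩ := Finset.mem_image.mp hx
      exact hy w hw
  have hcard : T.card + 1 ≤ 2 * S.card := by
    obtain ⟨X, hXc, -, hX⟩ := hTnb P Relation.ReflTransGen.refl
    exact hXc ▸ base P Relation.ReflTransGen.refl X hX
  obtain ⟨i, a, h1, h2, h3, h4⟩ := exists_edge_counts H S F.B T
    (fun u hu => hdeg u (Frame.endSet_subset hP ((hSm u).mp hu)))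
    (fun w hw => mem_nbrsIn.mp hw)
  refine ⟨Finset.filter_subset _ _, ?_, hcard, ?_, ?_⟩
  · rw [Finset.disjoint_right]
    exact fun w hw => (mem_nbrsIn.mp hw).2.1
  · exact fun u hu w hw hwS hwT huw => hwT (mem_nbrsIn.mpr ⟨hw, hwS, u, hu, huw⟩)
  · rw [h1]
    have hS1 : 1 ≤ S.card := Finset.card_pos.mpr hSne
    rcases Nat.eq_zero_or_pos a with ha | ha
    · omega
    · obtain ⟨u, hu, v, hv, hvB, huv⟩ := h4 ha
      obtain ⟨Q, hQ, y, hy, hvy⟩ := hP.exists_nb_inside ((hSm u).mp hu) hvB huv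
      have hyS := (hSm y).mpr hy
      obtain ⟨X, hXc, hXS, hX⟩ := hTnb Q hQ
      have hvy' : v ≠ y := by
        rintro rfl
        have hnd := (hQ.isMaxSys hP).1.1.nodup
        rcases hvy with h | h <;>
          exact absurd (h.sublist.nodup hnd) (by simp)
      have := base Q hQ (insert (v, y) (insert (y, v) X)) (by
        intro x hx
        simp only [Finset.mem_insert] at hx
        rcases hx with rfl | rfl | hx
        · exact ⟨hv, hvy⟩
        · exact ⟨hyS, hvy.symm⟩
        · exact hX x hx)
      rw [Finset.card_insert_of_notMem, Finset.card_insert_of_notMem] at this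
      · omega
      · exact fun h => hXS _ h hv
      · simp only [Finset.mem_insert, Prod.mk.injEq, not_or]
        exact ⟨fun h => hvy' h.1, fun h => hXS _ h hyS⟩

open Classical in
/-- The pivots as a finset. -/
noncomputable def Frame.pivots (F : Frame V) (H : SimpleGraph V) (P : List V) : Finset V :=
  Finset.univ.filter fun u => u ∈ F.Pivot H P

theorem Frame.mem_pivots {F : Frame V} {H : SimpleGraph V} {P : List V} {u : V} :
    u ∈ F.pivots H P ↔ u ∈ F.Pivot H P := by
  simp [Frame.pivots]

open Classical in
/-- The set of the edges contained in all maximum paths has at most `|K|` minus the number of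
pivots elements. -/
theorem Frame.IsMaxSys.card_unavoidable_le {F : Frame V} {H : SimpleGraph V} {P : List V}
    (hP : F.IsMaxSys H P) :
    (Finset.univ.filter fun e : Sym2 V => ∀ Q, F.IsMaxSys H Q → e ∈ listEdges Q).card
      + (F.pivots H P).card ≤ F.K.card := by
  have h : ∀ w, w ∈ F.pivots H P → ∃ y, y ∈ F.EndSet H P ∧ Nb P w y ∧
      ∃ Q', F.Reach H P Q' ∧ ¬ Nb Q' w y := fun w hw =>
    hP.exists_avoidable (Frame.mem_pivots.mp hw)
  choose! y hy using h
  -- Of the two entries exactly one is an end, so the unordered pair determines the pivot.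
  have hinj : Set.InjOn (fun w => s(w, y w)) (F.pivots H P) := by
    intro a ha b hb hab
    have ha' := hy a ha
    have hb' := hy b hb
    rcases Sym2.eq_iff.mp hab with ⟨h1, _⟩ | ⟨h1, _⟩
    · exact h1
    · exact absurd (h1 ▸ hb'.1) (Frame.mem_pivots.mp ha).2.1
  have hdisj : Disjoint
      (Finset.univ.filter fun e : Sym2 V => ∀ Q, F.IsMaxSys H Q → e ∈ listEdges Q)
      ((F.pivots H P).image fun w => s(w, y w)) := by
    rw [Finset.disjoint_right]
    intro e he
    obtain ⟨w, hw, rfl⟩ := Finset.mem_image.mp he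
    obtain ⟨-, -, Q', hQ', hnb⟩ := hy w hw
    simp only [Finset.mem_filter, Finset.mem_univ, true_and, not_forall]
    exact ⟨Q', (hQ'.isMaxSys hP).1, fun h => hnb (mem_listEdges.mp h)⟩
  rw [← Finset.card_image_of_injOn hinj, ← Finset.card_union_of_disjoint hdisj]
  refine (Finset.card_le_card (t := listEdges P) ?_).trans
    ((card_listEdges_le P).trans hP.1.length_le)
  refine Finset.union_subset (fun e he => (Finset.mem_filter.mp he).2 P hP) fun e he => ?_
  obtain ⟨w, hw, rfl⟩ := Finset.mem_image.mp he
  exact mem_listEdges.mpr (hy w hw).2.1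

/-- Each end has at most one neighbour among the black vertices that are neither ends nor
pivots. -/
theorem Frame.nbr_unique_of_not_pivot {F : Frame V} {H : SimpleGraph V} {P : List V}
    {u w w' : V} (hu : u ∈ F.EndSet H P) (hw : w ∈ F.B) (hwS : w ∉ F.EndSet H P)
    (hwp : w ∉ F.Pivot H P) (hw' : w' ∈ F.B) (hwS' : w' ∉ F.EndSet H P)
    (hwp' : w' ∉ F.Pivot H P) (huw : H.Adj u w) (huw' : H.Adj u w') : w = w' := by
  obtain ⟨Q, hQ, hQu⟩ := hu
  -- For one fixed `Q` starting at `u`, a neighbour that is not a pivot can only be the second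
  -- entry.
  have h1 : [u, w] <+: Q := by
    by_contra h
    exact hwp ⟨hw, hwS, u, Q, hQ, hQu, huw, h⟩
  have h2 : [u, w'] <+: Q := by
    by_contra h
    exact hwp' ⟨hw', hwS', u, Q, hQ, hQu, huw', h⟩
  obtain ⟨t, rfl⟩ := h1
  obtain ⟨t', h⟩ := h2
  have h3 : w' = w ∧ t' = t := by simpa using h
  exact h3.1.symm

end Counting

/-! ### Boosters: pairs whose addition makes progress -/

section Boosters

variable {V : Type*}

/-- There is a Hamilton cycle on `K` through all the edges of the matching. -/
def Frame.Ham (F : Frame V) (H : SimpleGraph V) : Prop :=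
  ∃ l u x, F.IsSys H l ∧ (∀ v ∈ F.K, v ∈ l) ∧ l.head? = some u ∧ l.getLast? = some x ∧
    F.Lnk H u x ∧ 3 ≤ l.length

theorem Frame.Ham.mono {F : Frame V} {H H' : SimpleGraph V} (h : H ≤ H') (hH : F.Ham H) :
    F.Ham H' := by
  obtain ⟨l, u, x, hl, hK, hu, hx, hux, h3⟩ := hH
  exact ⟨l, u, x, hl.mono h, hK, hu, hx, hux.imp (fun y => ⟨h y.1, y.2⟩) id, h3⟩

/-- The maximum number of vertices of a path. -/
noncomputable def Frame.lam (F : Frame V) (H : SimpleGraph V) : ℕ :=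
  (F.exists_isMaxSys H).choose.length

theorem Frame.IsSys.length_le_lam {F : Frame V} {H : SimpleGraph V} {l : List V}
    (hl : F.IsSys H l) : l.length ≤ F.lam H :=
  (F.exists_isMaxSys H).choose_spec.2 l hl

theorem Frame.IsMaxSys.length_eq {F : Frame V} {H : SimpleGraph V} {l : List V}
    (hl : F.IsMaxSys H l) : l.length = F.lam H :=
  le_antisymm hl.1.length_le_lam (hl.2 _ (F.exists_isMaxSys H).choose_spec.1)

theorem Frame.lam_mono {F : Frame V} {H H' : SimpleGraph V} (h : H ≤ H') :
    F.lam H ≤ F.lam H' :=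
  ((F.exists_isMaxSys H).choose_spec.1.mono h).length_le_lam

/-- Joining the black ends of a maximum path gives a Hamilton cycle or a longer path. -/
theorem Frame.IsMaxSys.boost {F : Frame V} {H H' : SimpleGraph V} {Q : List V}
    (hQ : F.IsMaxSys H Q) (h3 : 3 ≤ Q.length)
    (hconn : (∃ y ∈ F.K, y ∉ Q) → ∃ y ∈ F.K, y ∉ Q ∧ ∃ v ∈ Q, v ∈ F.B ∧ H.Adj y v)
    {u x : V} (hu : Q.head? = some u) (hx : Q.getLast? = some x) (huB : u ∈ F.B)
    (hHH : H ≤ H') (hux : H'.Adj u x) : F.Ham H' ∨ F.lam H < F.lam H' := by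
  classical
  by_cases hall : ∃ y ∈ F.K, y ∉ Q
  · right
    obtain ⟨y, hyK, hyQ, v, hv, hvB, hyv⟩ := hconn hall
    obtain ⟨q₁, q₂, rfl⟩ := List.append_of_mem hv
    -- The new edge closes `Q` to a cycle, which is cut open just before `v`. The removed link has
    -- the black endpoint `v`, and `v` becomes an end to which `y` can be attached.
    have hsys : F.IsSys H' ((v :: q₂) ++ q₁) := by
      cases q₁ with
      | nil => simpa using hQ.1.mono hHH
      | cons z q₁ =>
        obtain rfl : z = u := by simpa using hu
        have hx' : (v :: q₂).getLast? = some x := by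
          rwa [List.getLast?_append, List.getLast?_eq_some_getLast (l := v :: q₂) (by simp)] at hx
        refine (hQ.1.mono hHH).exchange List.perm_append_comm (u := x) (v := z)
          (y := (z :: q₁).getLast (by simp)) (z := v) (Or.inl ⟨hux.symm, Or.inr huB⟩) hvB ?_ ?_
        · intro a b h
          rw [nb_append, hx'] at h
          rw [nb_append]
          simp only [List.head?_cons, Option.some.injEq] at h ⊢
          rcases h with h | h | ⟨rfl, rfl⟩ | ⟨rfl, rfl⟩ <;> simp [*]
        · intro a b h
          rw [nb_append, List.getLast?_eq_some_getLast (l := z :: q₁) (by simp)] at h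
          rw [nb_append]
          simp only [List.head?_cons, Option.some.injEq] at h ⊢
          rcases h with h | h | ⟨rfl, rfl⟩ | ⟨rfl, rfl⟩ <;> simp [*]
    obtain ⟨l', hl', hlt⟩ := hsys.extend (u := v) (y := y) rfl hyK
      (by simp only [List.mem_append] at hyQ ⊢; tauto) (hHH hyv) (Or.inr hvB)
    have h1 := hl'.length_le_lam
    have h2 := hQ.length_eq
    simp only [List.length_append] at hlt h2
    omega
  · left
    push Not at hall
    exact ⟨Q, u, x, hQ.1.mono hHH, hall, hu, hx, Or.inl ⟨hux, Or.inl huB⟩, h3⟩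

open Classical in
/-- The pairs of black vertices that are the two ends of a maximum path. -/
noncomputable def Frame.boosters [Fintype V] (F : Frame V) (H : SimpleGraph V) :
    Finset (Sym2 V) :=
  Finset.univ.filter fun e => ∃ Q u x, F.IsMaxSys H Q ∧ Q.head? = some u ∧ Q.getLast? = some x ∧
    u ∈ F.B ∧ x ∈ F.B ∧ e = s(u, x)

/-- Each black end of `P` is the last vertex of some reversed maximum path. Rotating that path gives
at least `k` black ends on its other side, and an unordered pair arises at most twice. -/
theorem Frame.IsMaxSys.card_boosters [Fintype V] [DecidableEq V] {F : Frame V}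
    {H : SimpleGraph V} {P : List V} (hP : F.IsMaxSys H P) {k : ℕ}
    (hk : ∀ Q, F.IsMaxSys H Q → k ≤ (F.ends H Q ∩ F.B).card) :
    (F.ends H P ∩ F.B).card * k ≤ 2 * (F.boosters H).card := by
  classical
  have h : ∀ x, x ∈ F.ends H P ∩ F.B → ∃ Q, F.IsMaxSys H Q ∧ Q.getLast? = some x := fun x hx => by
    obtain ⟨Q, hQ, hQx⟩ := Frame.mem_ends.mp (Finset.mem_inter.mp hx).1
    exact ⟨Q.reverse, (hQ.isMaxSys hP).1.reverse, by simpa using hQx⟩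
  choose! R hR using h
  let X : Finset (V × V) := (F.ends H P ∩ F.B).biUnion fun x =>
    (F.ends H (R x) ∩ F.B).image fun u => (x, u)
  have hX : (F.ends H P ∩ F.B).card * k ≤ X.card := by
    rw [Finset.card_biUnion]
    · rw [← smul_eq_mul, ← Finset.sum_const]
      refine Finset.sum_le_sum fun x hx => ?_
      rw [Finset.card_image_of_injective _ (Prod.mk_right_injective x)]
      exact hk _ (hR x hx).1
    · intro x _ y _ hxy
      simp only [Function.onFun]
      rw [Finset.disjoint_left]
      intro z hz hz'
      obtain ⟨a, -, rfl⟩ := Finset.mem_image.mp hz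
      obtain ⟨b, -, hb⟩ := Finset.mem_image.mp hz'
      exact hxy (Prod.mk.inj hb).1.symm
  refine hX.trans ?_
  have h1 : X.card ≤ 2 * (X.image fun x => s(x.1, x.2)).card := by
    refine Finset.card_le_mul_card_image X 2 fun e he => ?_
    obtain ⟨⟨a, b⟩, -, rfl⟩ := Finset.mem_image.mp he
    refine (Finset.card_le_card (t := {(a, b), (b, a)}) ?_).trans Finset.card_le_two
    rintro ⟨a', b'⟩ h
    have h := (Finset.mem_filter.mp h).2
    rcases Sym2.eq_iff.mp h with ⟨h1, h2⟩ | ⟨h1, h2⟩ <;> simp_all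
  refine h1.trans (Nat.mul_le_mul_left 2 (Finset.card_le_card fun e he => ?_))
  obtain ⟨⟨a, b⟩, hab, rfl⟩ := Finset.mem_image.mp he
  obtain ⟨x, hx, hxb⟩ := Finset.mem_biUnion.mp hab
  obtain ⟨u, hu, huu⟩ := Finset.mem_image.mp hxb
  obtain ⟨rfl, rfl⟩ := Prod.mk.inj huu
  obtain ⟨hu1, hu2⟩ := Finset.mem_inter.mp hu
  obtain ⟨Q, hQ, hQu⟩ := Frame.mem_ends.mp hu1
  obtain ⟨hRm, hRx⟩ := hR x hx
  have hQm := hQ.isMaxSys hRm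
  exact Finset.mem_filter.mpr ⟨Finset.mem_univ _, Q, u, x, hQm.1, hQu, hQm.2.1.trans hRx, hu2,
    (Finset.mem_inter.mp hx).2, Sym2.eq_swap⟩

/-- A maximum path avoiding an edge remains one after the deletion of the edge. -/
theorem Frame.lam_eq_of_avoid [DecidableEq V] {F : Frame V} {H H' : SimpleGraph V} (hHH : H' ≤ H)
    {e : Sym2 V} (hadj : ∀ a b, H.Adj a b → s(a, b) ≠ e → H'.Adj a b) {Q : List V}
    (hQ : F.IsMaxSys H Q) (he : e ∉ listEdges Q) : F.lam H' = F.lam H := by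
  refine le_antisymm (Frame.lam_mono hHH) ?_
  rw [← hQ.length_eq]
  refine Frame.IsSys.length_le_lam ⟨hQ.1.nodup, hQ.1.mem_K, fun a b h => ?_, hQ.1.closed⟩
  refine (hQ.1.lnk a b h).imp (fun h' => ⟨hadj a b h'.1 ?_, h'.2⟩) id
  rintro rfl
  exact he (mem_listEdges.mpr h)

end Boosters

/-! ### The switching: deletions against insertions inside the core -/

section Switching

variable {V : Type*} [Fintype V] [DecidableEq V]

/-- The graph of a configuration. -/
def toGraph (ω : Sym2 V → Bool) : SimpleGraph V where
  Adj u v := u ≠ v ∧ ω s(u, v) = true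
  symm := ⟨fun u v h => ⟨h.1.symm, by rw [Sym2.eq_swap]; exact h.2⟩⟩
  loopless := ⟨fun u h => h.1 rfl⟩

theorem toGraph_adj {ω : Sym2 V → Bool} {u v : V} :
    (toGraph ω).Adj u v ↔ u ≠ v ∧ ω s(u, v) = true := Iff.rfl

theorem toGraph_mono {ω ω' : Sym2 V → Bool} (h : ω ≤ ω') : toGraph ω ≤ toGraph ω' := by
  intro u v huv
  refine ⟨huv.1, ?_⟩
  have := h s(u, v)
  rw [huv.2] at this
  exact top_le_iff.mp this

/-- The pairs of distinct elements of `B`. -/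
def pairsIn (B : Finset V) : Finset (Sym2 V) := B.sym2.filter fun e => ¬ e.IsDiag

theorem mem_pairsIn {B : Finset V} {u v : V} : s(u, v) ∈ pairsIn B ↔ (u ∈ B ∧ v ∈ B) ∧ u ≠ v := by
  simp [pairsIn]

theorem card_pairsIn (B : Finset V) : (pairsIn B).card = B.card.choose 2 := by
  classical
  have : pairsIn B = B.offDiag.image Sym2.mk.uncurry := by
    ext e
    induction e with | _ u v => ?_
    rw [mem_pairsIn]
    simp only [Finset.mem_image, Finset.mem_offDiag, Prod.exists, Function.uncurry_apply_pair]
    constructor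
    · rintro ⟨⟨hu, hv⟩, h⟩
      exact ⟨u, v, ⟨hu, hv, h⟩, rfl⟩
    · rintro ⟨a, b, ⟨ha, hb, h⟩, heq⟩
      rcases Sym2.eq_iff.mp heq with ⟨rfl, rfl⟩ | ⟨rfl, rfl⟩
      · exact ⟨⟨ha, hb⟩, h⟩
      · exact ⟨⟨hb, ha⟩, h.symm⟩
  rw [this]
  exact Sym2.card_image_offDiag B

/-- The neighbours of `v` in `B`. -/
def nbrs (ω : Sym2 V → Bool) (B : Finset V) (v : V) : Finset V :=
  B.filter fun w => v ≠ w ∧ ω s(v, w) = true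

theorem mem_nbrs {ω : Sym2 V → Bool} {B : Finset V} {v w : V} :
    w ∈ nbrs ω B v ↔ w ∈ B ∧ (toGraph ω).Adj v w := by
  simp [nbrs, toGraph_adj]

theorem minDegFour_iff {ω : Sym2 V → Bool} {B S : Finset V} :
    MinDegFour (toGraph ω) B S ↔ ∀ v ∈ S, 4 ≤ (nbrs ω B v).card := by
  refine forall₂_congr fun v _ => ⟨?_, fun h => ⟨nbrs ω B v, h, fun w hw => mem_nbrs.mp hw⟩⟩
  rintro ⟨N, hN, hNw⟩
  exact hN.trans (Finset.card_le_card fun w hw => mem_nbrs.mpr (hNw w hw))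

/-- The configurations in which every vertex of `S` has at least four neighbours in `B`. -/
def degEvent (B S : Finset V) : Set (Sym2 V → Bool) := {ω | ∀ v ∈ S, 4 ≤ (nbrs ω B v).card}

/-- The number of edges inside `B`. -/
def numEdges (ω : Sym2 V → Bool) (B : Finset V) : ℕ :=
  ((pairsIn B).filter fun e => ω e = true).card

/-- The vertices of `B` with at most four neighbours in `B`. -/
def lowDeg (ω : Sym2 V → Bool) (B : Finset V) : Finset V :=
  B.filter fun v => (nbrs ω B v).card ≤ 4

open Classical in
/-- The edges inside `B` whose deletion changes neither the length of a maximum path nor the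
minimum degree condition. -/
noncomputable def Frame.out (F : Frame V) (S : Finset V) (ω : Sym2 V → Bool) : Finset (Sym2 V) :=
  (pairsIn F.B).filter fun e => ω e = true ∧
    F.lam (toGraph (Function.update ω e false)) = F.lam (toGraph ω) ∧
    Function.update ω e false ∈ degEvent F.B S

open Classical in
/-- The missing pairs inside `B` whose addition neither creates a Hamilton cycle nor a longer
path. -/
noncomputable def Frame.inn (F : Frame V) (ω : Sym2 V → Bool) : Finset (Sym2 V) :=
  (pairsIn F.B).filter fun e => ω e = false ∧
    F.lam (toGraph (Function.update ω e true)) = F.lam (toGraph ω) ∧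
    ¬ F.Ham (toGraph (Function.update ω e true))

theorem update_false_le (ω : Sym2 V → Bool) (e : Sym2 V) : Function.update ω e false ≤ ω := by
  intro x
  by_cases hx : x = e
  · subst hx; simp
  · simp [hx]

theorem le_update_true (ω : Sym2 V → Bool) (e : Sym2 V) : ω ≤ Function.update ω e true := by
  intro x
  by_cases hx : x = e
  · subst hx; simp [Bool.le_true]
  · simp [hx]

/-- The switching inequality. -/
theorem Frame.switching (F : Frame V) (S : Finset V) {p κ : ℝ} (h0 : 0 ≤ p) (h1 : p ≤ 1)
    (T : Set (Sym2 V → Bool))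
    (hκ : ∀ ω ∈ (degEvent F.B S ∩ T) ∩ {ω | ¬ F.Ham (toGraph ω)},
      κ ≤ (1 - p) * (F.out S ω).card - p * (F.inn ω).card) :
    κ * prob p ((degEvent F.B S ∩ T) ∩ {ω | ¬ F.Ham (toGraph ω)}) ≤
      p * (pairsIn F.B).card * prob p (degEvent F.B S ∩ Tᶜ) := by
  classical
  set D := degEvent F.B S
  set A := (D ∩ T) ∩ {ω | ¬ F.Ham (toGraph ω)} with hA
  have hsum : ∀ (C : Set (Sym2 V → Bool)) [DecidablePred (· ∈ C)], ∀ f : (Sym2 V → Bool) → Finset (Sym2 V),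
      ∑ ω with ω ∈ C, wt p ω * (f ω).card =
        ∑ x ∈ (Finset.univ.filter (· ∈ C)).sigma f, wt p x.1 := fun C _ f => by
    rw [Finset.sum_sigma]
    refine Finset.sum_congr rfl fun ω _ => ?_
    dsimp only
    rw [Finset.sum_const, nsmul_eq_mul, mul_comm]
  -- Send `(ω, e)` to the configuration with `e` switched off, remembering `e`; this is injective.
  -- If the image is in `T`, it is again in `A` and `e` lies in its `F.inn`. If not, any pair inside
  -- the core is allowed for `e`.
  have hkey : (1 - p) * ∑ ω with ω ∈ A, wt p ω * (F.out S ω).card ≤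
      p * (∑ ω with ω ∈ A, wt p ω * (F.inn ω).card +
        ∑ ω with ω ∈ D ∩ Tᶜ, wt p ω * (pairsIn F.B).card) := by
    rw [hsum A (F.out S), hsum A F.inn, hsum (D ∩ Tᶜ) (fun _ => pairsIn F.B), ← Finset.sum_union, Finset.mul_sum,
      Finset.mul_sum]
    · calc ∑ x ∈ (Finset.univ.filter (· ∈ A)).sigma (F.out S), (1 - p) * wt p x.1
          = ∑ x ∈ (Finset.univ.filter (· ∈ A)).sigma (F.out S),
              p * wt p (Function.update x.1 x.2 false) := by
            refine Finset.sum_congr rfl fun x hx => ?_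
            have h := wt_update_false (p := p)
              (Finset.mem_filter.mp (Finset.mem_sigma.mp hx).2).2.1
            linarith
        _ = ∑ y ∈ ((Finset.univ.filter (· ∈ A)).sigma (F.out S)).image
              (fun x => (⟨Function.update x.1 x.2 false, x.2⟩ : Σ _ : Sym2 V → Bool, Sym2 V)),
              p * wt p y.1 := by
            rw [Finset.sum_image]
            rintro ⟨ω, e⟩ hx ⟨ω', e'⟩ hx' h
            have hω := (Finset.mem_filter.mp (Finset.mem_sigma.mp hx).2).2.1
            have hω' := (Finset.mem_filter.mp (Finset.mem_sigma.mp hx').2).2.1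
            simp only [Sigma.mk.injEq, heq_eq_eq] at h hω hω'
            obtain ⟨h, rfl⟩ := h
            have : ω = ω' := by
              ext x
              by_cases hxe : x = e
              · subst hxe; rw [hω, hω']
              · have := congrFun h x
                simpa [hxe] using this
            rw [this]
        _ ≤ _ := by
            refine Finset.sum_le_sum_of_subset_of_nonneg ?_ fun x _ _ =>
              mul_nonneg h0 (wt_nonneg h0 h1 _)
            intro y hy
            obtain ⟨⟨ω, e⟩, hx, rfl⟩ := Finset.mem_image.mp hy
            obtain ⟨hω, he⟩ := Finset.mem_sigma.mp hx
            have hωA : ω ∈ A := (Finset.mem_filter.mp hω).2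
            obtain ⟨heB, hωe, hlam, hD⟩ := Finset.mem_filter.mp he
            simp only at hωe hlam hD
            have hback : Function.update (Function.update ω e false) e true = ω := by
              rw [Function.update_idem, ← hωe, Function.update_eq_self]
            have hnH : ¬ F.Ham (toGraph (Function.update ω e false)) := fun h =>
              hωA.2 (h.mono (toGraph_mono (update_false_le ω e)))
            by_cases hT : Function.update ω e false ∈ T
            · refine Finset.mem_union_left _ (Finset.mem_sigma.mpr
                ⟨Finset.mem_filter.mpr ⟨Finset.mem_univ _, ⟨hD, hT⟩, hnH⟩,
                Finset.mem_filter.mpr ⟨heB, ?_, ?_, ?_⟩⟩)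
              · simp
              · simp only [hback, hlam]
              · simp only [hback]; exact hωA.2
            · exact Finset.mem_union_right _ (Finset.mem_sigma.mpr
                ⟨Finset.mem_filter.mpr ⟨Finset.mem_univ _, hD, hT⟩, heB⟩)
    · rw [Finset.disjoint_left]
      intro x hx hx'
      have h1 := (Finset.mem_filter.mp (Finset.mem_sigma.mp hx).1).2
      have h2 := (Finset.mem_filter.mp (Finset.mem_sigma.mp hx').1).2
      exact h2.2 h1.1.2
  rw [prob_eq_sum_filter, prob_eq_sum_filter]
  have h2 : κ * ∑ ω with ω ∈ A, wt p ω ≤ (1 - p) * ∑ ω with ω ∈ A, wt p ω * (F.out S ω).card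
      - p * ∑ ω with ω ∈ A, wt p ω * (F.inn ω).card := by
    rw [Finset.mul_sum, Finset.mul_sum, Finset.mul_sum, ← Finset.sum_sub_distrib]
    refine Finset.sum_le_sum fun ω hω => ?_
    have := hκ ω (Finset.mem_filter.mp hω).2
    have hw := wt_nonneg h0 h1 ω
    nlinarith
  rw [← Finset.sum_mul] at hkey
  linarith

/-- An edge inside the core is deletable unless every maximum path contains it or it meets a core
vertex of degree at most four. The first kind is bounded by `card_unavoidable_le`, the second by
four edges per such vertex. -/
theorem Frame.card_out (F : Frame V) {S : Finset V} {ω : Sym2 V → Bool}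
    (hS : ω ∈ degEvent F.B S) {P : List V} (hP : F.IsMaxSys (toGraph ω) P) :
    numEdges ω F.B + (F.pivots (toGraph ω) P).card ≤
      (F.out S ω).card + F.K.card + 4 * (lowDeg ω F.B).card := by
  classical
  have h1 := hP.card_unavoidable_le
  set U := Finset.univ.filter fun e : Sym2 V =>
    ∀ Q, F.IsMaxSys (toGraph ω) Q → e ∈ listEdges Q
  let W : Finset (Sym2 V) := (lowDeg ω F.B).biUnion fun v => (nbrs ω F.B v).image fun w => s(v, w)
  have hW : W.card ≤ 4 * (lowDeg ω F.B).card := by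
    rw [mul_comm]
    refine Finset.card_biUnion_le_card_mul _ _ _ fun v hv => ?_
    exact Finset.card_image_le.trans (Finset.mem_filter.mp hv).2
  have hsub : ((pairsIn F.B).filter fun e => ω e = true) ⊆ F.out S ω ∪ (U ∪ W) := by
    intro e he
    obtain ⟨heB, hωe⟩ := Finset.mem_filter.mp he
    rw [Finset.mem_union, Finset.mem_union]
    by_cases hU : e ∈ U
    · exact Or.inr (Or.inl hU)
    by_cases hWe : e ∈ W
    · exact Or.inr (Or.inr hWe)
    refine Or.inl (Finset.mem_filter.mpr ⟨heB, hωe, ?_, ?_⟩)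
    · simp only [U, Finset.mem_filter, Finset.mem_univ, true_and, not_forall] at hU
      obtain ⟨Q, hQ, heQ⟩ := hU
      refine Frame.lam_eq_of_avoid (toGraph_mono (update_false_le ω e)) (fun a b hab hne => ?_)
        hQ heQ
      exact ⟨hab.1, by rw [Function.update_of_ne hne]; exact hab.2⟩
    · induction e with | _ a b => ?_
      obtain ⟨⟨ha, hb⟩, hab⟩ := mem_pairsIn.mp heB
      have hadj : (toGraph ω).Adj a b := ⟨hab, hωe⟩
      have hda : 5 ≤ (nbrs ω F.B a).card := by
        by_contra hc
        exact hWe (Finset.mem_biUnion.mpr ⟨a, Finset.mem_filter.mpr ⟨ha, by omega⟩,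
          Finset.mem_image.mpr ⟨b, mem_nbrs.mpr ⟨hb, hadj⟩, rfl⟩⟩)
      have hdb : 5 ≤ (nbrs ω F.B b).card := by
        by_contra hc
        exact hWe (Finset.mem_biUnion.mpr ⟨b, Finset.mem_filter.mpr ⟨hb, by omega⟩,
          Finset.mem_image.mpr ⟨a, mem_nbrs.mpr ⟨ha, hadj.symm⟩, Sym2.eq_swap⟩⟩)
      intro v hv
      have hgen : ∀ z, (∀ w, s(v, w) = s(a, b) → w = z) →
          (nbrs ω F.B v).erase z ⊆ nbrs (Function.update ω s(a, b) false) F.B v := by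
        intro z hz w hw
        obtain ⟨hwz, hw⟩ := Finset.mem_erase.mp hw
        obtain ⟨hwB, hvw⟩ := mem_nbrs.mp hw
        refine mem_nbrs.mpr ⟨hwB, hvw.1, ?_⟩
        rw [Function.update_of_ne fun h => hwz (hz w h)]
        exact hvw.2
      by_cases hva : v = a
      · subst hva
        have := Finset.card_le_card (hgen b fun w h => by
          rcases Sym2.eq_iff.mp h with h | h
          · exact h.2
          · exact absurd h.1 hab)
        have h2 := Finset.pred_card_le_card_erase (a := b) (s := nbrs ω F.B v)
        omega
      · by_cases hvb : v = b
        · subst hvb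
          have := Finset.card_le_card (hgen a fun w h => by
            rcases Sym2.eq_iff.mp h with h | h
            · exact absurd h.1 hva
            · exact h.2)
          have h2 := Finset.pred_card_le_card_erase (a := a) (s := nbrs ω F.B v)
          omega
        · refine (hS v hv).trans (Finset.card_le_card fun w hw => ?_)
          obtain ⟨hwB, hvw⟩ := mem_nbrs.mp hw
          refine mem_nbrs.mpr ⟨hwB, hvw.1, ?_⟩
          rw [Function.update_of_ne]
          · exact hvw.2
          · intro h
            rcases Sym2.eq_iff.mp h with h | h
            · exact hva h.1
            · exact hvb h.1
  have h2 := Finset.card_le_card hsub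
  have h3 := Finset.card_union_le (F.out S ω) (U ∪ W)
  have h4 := Finset.card_union_le U W
  have h5 : numEdges ω F.B = ((pairsIn F.B).filter fun e => ω e = true).card := rfl
  omega

/-- Edges, boosters and `F.inn` are disjoint sets of pairs. A booster that was already an edge
would, by `boost` with an unchanged graph, give a Hamilton cycle or a path longer than the maximum.
-/
theorem Frame.card_inn (F : Frame V) {ω : Sym2 V → Bool} (hH : ¬ F.Ham (toGraph ω))
    (hconn : ∀ Q, F.IsMaxSys (toGraph ω) Q → 3 ≤ Q.length ∧
      ((∃ y ∈ F.K, y ∉ Q) → ∃ y ∈ F.K, y ∉ Q ∧ ∃ v ∈ Q, v ∈ F.B ∧ (toGraph ω).Adj y v)) :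
    (F.inn ω).card + numEdges ω F.B + (F.boosters (toGraph ω)).card ≤ (pairsIn F.B).card := by
  classical
  have hb : ∀ e ∈ F.boosters (toGraph ω), e ∈ pairsIn F.B ∧ ω e = false ∧ e ∉ F.inn ω := by
    intro e he
    obtain ⟨Q, u, x, hQ, hu, hx, huB, hxB, rfl⟩ := (Finset.mem_filter.mp he).2
    obtain ⟨h3, hc⟩ := hconn Q hQ
    have hux : u ≠ x := by
      rintro rfl
      cases Q with
      | nil => simp at hu
      | cons y Q =>
        cases Q with
        | nil => simp at h3
        | cons z Q =>
          obtain rfl : y = u := by simpa using hu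
          have := hQ.1.nodup
          rw [List.getLast?_cons_cons] at hx
          exact (List.nodup_cons.mp this).1 (List.mem_of_getLast? hx)
    have hadd := hQ.boost h3 hc hu hx huB (toGraph_mono (le_update_true ω s(u, x)))
      ⟨hux, by simp⟩
    refine ⟨mem_pairsIn.mpr ⟨⟨huB, hxB⟩, hux⟩, ?_, ?_⟩
    · by_contra hω
      have hω : ω s(u, x) = true := by simpa using hω
      have : Function.update ω s(u, x) true = ω := by rw [← hω, Function.update_eq_self]
      rw [this] at hadd
      exact hadd.elim hH (lt_irrefl _)
    · intro hin
      obtain ⟨-, -, hlam, hnH⟩ := Finset.mem_filter.mp hin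
      rcases hadd with h | h
      · exact hnH h
      · omega
  have hd1 : Disjoint (F.inn ω) (F.boosters (toGraph ω)) :=
    Finset.disjoint_right.mpr fun e he => (hb e he).2.2
  have hd2 : Disjoint (F.inn ω ∪ F.boosters (toGraph ω))
      ((pairsIn F.B).filter fun e => ω e = true) := by
    rw [Finset.disjoint_left]
    intro e he he'
    have h1 := (Finset.mem_filter.mp he').2
    rcases Finset.mem_union.mp he with h | h
    · rw [(Finset.mem_filter.mp h).2.1] at h1
      exact Bool.false_ne_true h1
    · rw [(hb e h).2.1] at h1
      exact Bool.false_ne_true h1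
  have hinn : F.inn ω ⊆ pairsIn F.B := Finset.filter_subset _ _
  have := Finset.card_le_card (Finset.union_subset (Finset.union_subset hinn
    fun e he => (hb e he).1) (Finset.filter_subset (fun e => ω e = true) (pairsIn F.B)))
  rw [Finset.card_union_of_disjoint hd2, Finset.card_union_of_disjoint hd1] at this
  have h5 : numEdges ω F.B = ((pairsIn F.B).filter fun e => ω e = true).card := rfl
  omega

end Switching

/-! ### Typical configurations and the balance of the switching -/

section Typical

variable {V : Type*} [Fintype V] [DecidableEq V]

/-- Between sets of large size there is an edge. -/
def bigEvent (B K : Finset V) : Set (Sym2 V → Bool) :=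
  {ω | ∀ S ⊆ K, ∀ W ⊆ B, Disjoint S W →
    0.056 * (Fintype.card V : ℝ) ^ 2 ≤ S.card * W.card → ∃ u ∈ S, ∃ w ∈ W, (toGraph ω).Adj u w}

/-- Between sets of very large size some vertex has two neighbours. -/
def hugeEvent (B K : Finset V) : Set (Sym2 V → Bool) :=
  {ω | ∀ S ⊆ K, ∀ W ⊆ B, Disjoint S W → 0.26 * (Fintype.card V : ℝ) ≤ S.card →
    0.315 * (Fintype.card V : ℝ) ≤ W.card → ∃ u ∈ S, 2 ≤ (nbrs ω W u).card}

/-- There is no dense spot of small size. -/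
def smallEvent (B K : Finset V) : Set (Sym2 V → Bool) :=
  {ω | ∀ S ⊆ K, ∀ T, (S.card : ℝ) < 0.075 * Fintype.card V → ¬ DenseSpot (toGraph ω) B S T}

/-- There are few vertices of degree at most four. -/
def lowEvent (B : Finset V) : Set (Sym2 V → Bool) :=
  {ω | ((lowDeg ω B).card : ℝ) ≤ 0.002 * Fintype.card V}

/-- The number of edges inside `B` is not much smaller than its mean. -/
def edgeEvent (p : ℝ) (B : Finset V) : Set (Sym2 V → Bool) :=
  {ω | 0.998 * (p * (pairsIn B).card) ≤ numEdges ω B}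

/-- The typical configurations. -/
def typical (p : ℝ) (B K : Finset V) : Set (Sym2 V → Bool) :=
  bigEvent B K ∩ hugeEvent B K ∩ smallEvent B K ∩ lowEvent B ∩ edgeEvent p B

variable {F : Frame V} {K : Finset V} {ω : Sym2 V → Bool}

/-- With `s = |S|`, the lower bound `s (0.998 n - 3 s)` for the product of the sizes is concave in
`s`. At `0.075 n` and `0.26 n` it is about `0.0580 n²` and `0.0567 n²`, both above the threshold
`0.056 n²`. -/
theorem exists_edge_of_bigEvent (hbig : ω ∈ bigEvent F.B K)
    (hB : 0.998 * (Fintype.card V : ℝ) ≤ F.B.card) {S T : Finset V} (hSK : S ⊆ K)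
    (hT : (T.card : ℝ) ≤ 2 * S.card) (h1 : 0.075 * (Fintype.card V : ℝ) ≤ S.card)
    (h2 : (S.card : ℝ) ≤ 0.26 * Fintype.card V) :
    ∃ u ∈ S, ∃ w ∈ F.B, w ∉ S ∧ w ∉ T ∧ (toGraph ω).Adj u w := by
  have hcard : F.B.card ≤ (F.B \ (S ∪ T)).card + (S.card + T.card) := by
    have := Finset.le_card_sdiff (S ∪ T) F.B
    have := Finset.card_union_le S T
    omega
  have hcard' : (F.B.card : ℝ) ≤ (F.B \ (S ∪ T)).card + (S.card + T.card) := by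
    exact_mod_cast hcard
  obtain ⟨u, hu, w, hw, h⟩ := hbig S hSK (F.B \ (S ∪ T)) Finset.sdiff_subset
    (Finset.disjoint_left.mpr fun x hx hx' =>
      (Finset.mem_sdiff.mp hx').2 (Finset.mem_union_left _ hx)) (by
    have h3 : 0.998 * (Fintype.card V : ℝ) - 3 * S.card ≤ (F.B \ (S ∪ T)).card := by linarith
    have h4 : (S.card : ℝ) * (0.998 * (Fintype.card V : ℝ) - 3 * S.card) ≤
      S.card * (F.B \ (S ∪ T)).card := mul_le_mul_of_nonneg_left h3 (Nat.cast_nonneg _)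
    nlinarith [mul_nonneg (sub_nonneg.mpr h1) (sub_nonneg.mpr h2)])
  rw [Finset.mem_sdiff, Finset.mem_union, not_or] at hw
  exact ⟨u, hu, w, hw.1, hw.2.1, hw.2.2, h⟩

theorem Frame.IsMaxSys.ne_nil {H : SimpleGraph V} {Q : List V} (hQ : F.IsMaxSys H Q)
    (hB : F.B.Nonempty) : Q ≠ [] := by
  obtain ⟨b, hb⟩ := hB
  rintro rfl
  have := hQ.2 [b] ⟨by simp, by simpa using F.B_subset hb, fun x y h => ?_, fun x y h hx => ?_⟩
  · simp at this
  · rw [nb_cons] at h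
    rcases h with h | h | h
    · simpa using h.mem_left
    · simp at h
    · simp at h
  · obtain rfl : x = b := by simpa using hx
    exact absurd hb (F.M_notMem h)

theorem Frame.IsMaxSys.three_le_length {H : SimpleGraph V} {Q : List V} (hQ : F.IsMaxSys H Q)
    (hB : F.B.Nonempty) (hdeg : MinDegFour H F.B F.K) : 3 ≤ Q.length := by
  obtain ⟨u, l, rfl⟩ := List.exists_cons_of_ne_nil (hQ.ne_nil hB)
  obtain ⟨N, hN, hNw⟩ := hdeg u (hQ.1.mem_K u (by simp))
  have h : N ⊆ (u :: l).toFinset := fun w hw => by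
    obtain ⟨l₁, l₂, h, -⟩ := hQ.rotate (u := u) (w := w) rfl (hNw w hw).1 (hNw w hw).2
    rw [List.mem_toFinset, h]
    simp
  have h1 := Finset.card_le_card h
  have h2 := List.toFinset_card_le (u :: l)
  omega

/-- The end set is a dense spot: `smallEvent` excludes sizes below `0.075 n`, and `bigEvent` those
from there to `0.26 n`. -/
theorem Frame.IsMaxSys.card_ends_ge {P : List V} (hP : F.IsMaxSys (toGraph ω) P)
    (hKF : F.K ⊆ K) (hB : 0.998 * (Fintype.card V : ℝ) ≤ F.B.card) (hBne : F.B.Nonempty)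
    (hdeg : MinDegFour (toGraph ω) F.B F.K) (hbig : ω ∈ bigEvent F.B K)
    (hsmall : ω ∈ smallEvent F.B K) :
    0.26 * (Fintype.card V : ℝ) ≤ (F.ends (toGraph ω) P).card := by
  have hd := hP.denseSpot (hP.ne_nil hBne) hdeg
  have hSK : F.ends (toGraph ω) P ⊆ K := fun u hu =>
    hKF (Frame.endSet_subset hP (Frame.mem_ends.mp hu))
  have h1 : 0.075 * (Fintype.card V : ℝ) ≤ (F.ends (toGraph ω) P).card := by
    by_contra hc
    exact hsmall _ hSK _ (not_le.mp hc) hd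
  by_contra hc
  have hT : ((nbrsIn (toGraph ω) F.B (F.ends (toGraph ω) P)).card : ℝ)
      ≤ 2 * (F.ends (toGraph ω) P).card := by
    exact_mod_cast (Nat.le_succ _).trans hd.card_le
  obtain ⟨u, hu, w, hw, hwS, hwT, h⟩ :=
    exists_edge_of_bigEvent hbig hB hSK hT h1 (le_of_lt (not_le.mp hc))
  exact hd.no_edge u hu w hw hwS hwT h

theorem card_inter_ge {S : Finset V} (hB : 0.998 * (Fintype.card V : ℝ) ≤ F.B.card) :
    (S.card : ℝ) - 0.002 * Fintype.card V ≤ (S ∩ F.B).card := by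
  have h1 := Finset.card_union_add_card_inter S F.B
  have h2 := Finset.card_le_univ (S ∪ F.B)
  have h3 : ((S ∪ F.B).card : ℝ) + (S ∩ F.B).card = S.card + F.B.card := by exact_mod_cast h1
  have h4 : ((S ∪ F.B).card : ℝ) ≤ Fintype.card V := by exact_mod_cast h2
  linarith

/-- Otherwise the set `Y` of missed vertices contains all its black neighbours, so it is a dense
spot with `T = ∅` and hence large. Then `bigEvent` gives an edge from `Y` to a black vertex outside
`Y`; beyond `0.26 n` the target set consists of the black ends of paths reachable from `Q`, all of
which lie on `Q`. -/
theorem Frame.IsMaxSys.connect {Q : List V} (hQ : F.IsMaxSys (toGraph ω) Q)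
    (hKF : F.K ⊆ K) (hB : 0.998 * (Fintype.card V : ℝ) ≤ F.B.card) (hBne : F.B.Nonempty)
    (hdeg : MinDegFour (toGraph ω) F.B F.K) (hbig : ω ∈ bigEvent F.B K)
    (hsmall : ω ∈ smallEvent F.B K) (hy : ∃ y ∈ F.K, y ∉ Q) :
    ∃ y ∈ F.K, y ∉ Q ∧ ∃ v ∈ Q, v ∈ F.B ∧ (toGraph ω).Adj y v := by
  classical
  by_contra hcon
  push Not at hcon
  set Y := F.K.filter fun y => y ∉ Q with hY
  have hYm : ∀ y, y ∈ Y ↔ y ∈ F.K ∧ y ∉ Q := fun y => by simp [hY]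
  have hYK : Y ⊆ K := (Finset.filter_subset _ _).trans hKF
  have hclosed : ∀ y ∈ Y, ∀ w ∈ F.B, (toGraph ω).Adj y w → w ∈ Y := fun y hy w hw h => by
    rw [hYm] at hy ⊢
    exact ⟨F.B_subset hw, fun hwQ => hcon y hy.1 hy.2 w hwQ hw h⟩
  have hdegY : MinDegFour (toGraph ω) F.B Y := fun u hu => hdeg u ((hYm u).mp hu).1
  have hY4 : 4 ≤ Y.card := by
    obtain ⟨y, hyK, hyQ⟩ := hy
    have hyY := (hYm y).mpr ⟨hyK, hyQ⟩
    obtain ⟨N, hN, hNw⟩ := hdegY y hyY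
    exact hN.trans (Finset.card_le_card fun w hw => hclosed y hyY w (hNw w hw).1 (hNw w hw).2)
  obtain ⟨i, a, h1, h2, -, -⟩ := exists_edge_counts (toGraph ω) Y F.B ∅ hdegY (by simp)
  have hd : DenseSpot (toGraph ω) F.B Y ∅ := by
    refine ⟨by simp, by simp, by simp; omega, fun u hu w hw hwY _ h => hwY (hclosed u hu w hw h), ?_⟩
    rw [h1, Finset.card_empty]
    omega
  have h075 : 0.075 * (Fintype.card V : ℝ) ≤ Y.card := by
    by_contra hc
    exact hsmall Y hYK ∅ (not_le.mp hc) hd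
  have hends := hQ.card_ends_ge hKF hB hBne hdeg hbig hsmall
  by_cases h26 : (Y.card : ℝ) ≤ 0.26 * Fintype.card V
  · obtain ⟨u, hu, w, hw, hwY, -, h⟩ := exists_edge_of_bigEvent (T := ∅) hbig hB hYK
      (by simp) h075 h26
    exact hwY (hclosed u hu w hw h)
  · have hint := card_inter_ge (S := F.ends (toGraph ω) Q) hB
    have hmem : ∀ w ∈ F.ends (toGraph ω) Q, w ∈ Q := fun w hw => by
      by_contra hwQ
      obtain ⟨R, hR, hRw⟩ := Frame.mem_ends.mp hw
      have hp : R.Perm Q := by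
        clear hRw
        induction hR with
        | refl => exact List.Perm.refl _
        | tail _ h ih =>
          obtain ⟨u, l₁, v, l₂, rfl, -, -, rfl⟩ := h
          exact ((List.reverse_perm _).append_right _).trans ih
      exact hwQ (hp.mem_iff.mp (List.mem_of_mem_head? hRw))
    obtain ⟨u, hu, w, hw, h⟩ := hbig Y hYK (F.ends (toGraph ω) Q ∩ F.B) Finset.inter_subset_right
      (Finset.disjoint_left.mpr fun x hx hx' =>
        ((hYm x).mp hx).2 (hmem x (Finset.mem_inter.mp hx').1)) (by
      push Not at h26
      have hn : (0 : ℝ) ≤ Fintype.card V := Nat.cast_nonneg _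
      have h3 : 0.258 * (Fintype.card V : ℝ) ≤ (F.ends (toGraph ω) Q ∩ F.B).card := by linarith
      have := mul_le_mul h26.le h3 (by positivity) (Nat.cast_nonneg _)
      nlinarith)
    exact ((hYm w).mp (hclosed u hu w (Finset.mem_inter.mp hw).2 h)).2
      (hmem w (Finset.mem_inter.mp hw).1)

/-- Each end has at most one neighbour among the black vertices that are neither ends nor pivots, so
by `hugeEvent` there are fewer than `0.315 n` of these; `0.683 = 0.998 - 0.315`. -/
theorem Frame.IsMaxSys.card_pivots_ge {P : List V} (hP : F.IsMaxSys (toGraph ω) P)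
    (hKF : F.K ⊆ K) (hB : 0.998 * (Fintype.card V : ℝ) ≤ F.B.card)
    (hhuge : ω ∈ hugeEvent F.B K)
    (hends : 0.26 * (Fintype.card V : ℝ) ≤ (F.ends (toGraph ω) P).card) :
    0.683 * (Fintype.card V : ℝ) ≤
      (F.pivots (toGraph ω) P).card + (F.ends (toGraph ω) P).card := by
  set S := F.ends (toGraph ω) P
  set R := F.pivots (toGraph ω) P
  have hSK : S ⊆ K := fun u hu => hKF (Frame.endSet_subset hP (Frame.mem_ends.mp hu))
  have hW : ((F.B \ (S ∪ R)).card : ℝ) < 0.315 * Fintype.card V := by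
    by_contra hc
    obtain ⟨u, hu, h2⟩ := hhuge S hSK (F.B \ (S ∪ R)) Finset.sdiff_subset
      (Finset.disjoint_left.mpr fun x hx hx' =>
        (Finset.mem_sdiff.mp hx').2 (Finset.mem_union_left _ hx)) hends (not_lt.mp hc)
    obtain ⟨w, hw, w', hw', hne⟩ := Finset.one_lt_card.mp h2
    simp only [mem_nbrs, Finset.mem_sdiff, Finset.mem_union, not_or] at hw hw'
    exact hne (Frame.nbr_unique_of_not_pivot (Frame.mem_ends.mp hu) hw.1.1
      (fun h => hw.1.2.1 (Frame.mem_ends.mpr h)) (fun h => hw.1.2.2 (Frame.mem_pivots.mpr h))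
      hw'.1.1 (fun h => hw'.1.2.1 (Frame.mem_ends.mpr h))
      (fun h => hw'.1.2.2 (Frame.mem_pivots.mpr h)) hw.2 hw'.2)
  have hcard : F.B.card ≤ (F.B \ (S ∪ R)).card + (S.card + R.card) := by
    have := Finset.le_card_sdiff (S ∪ R) F.B
    have := Finset.card_union_le S R
    omega
  have hcard' : (F.B.card : ℝ) ≤ (F.B \ (S ∪ R)).card + (S.card + R.card) := by
    exact_mod_cast hcard
  linarith

theorem card_pairsIn_le (B : Finset V) :
    ((pairsIn B).card : ℝ) ≤ (Fintype.card V : ℝ) ^ 2 / 2 := by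
  rw [card_pairsIn, Nat.cast_choose_two]
  have h : (B.card : ℝ) ≤ Fintype.card V := by exact_mod_cast Finset.card_le_univ B
  have h0 : (0 : ℝ) ≤ B.card := Nat.cast_nonneg _
  nlinarith

theorem MinDegFour.mono {H : SimpleGraph V} {B S S' : Finset V} (h : MinDegFour H B S)
    (hS : S' ⊆ S) : MinDegFour H B S' := fun u hu => h u (hS hu)

/-- For typical configurations without Hamilton cycle there are many more ways to delete an edge
than to add one. -/
theorem Frame.out_sub_inn_ge {p : ℝ} (h0 : 0 ≤ p) (h1 : p ≤ 1)
    (hc : 20 ≤ p * Fintype.card V) (hKF : F.K ⊆ K)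
    (hB : 0.998 * (Fintype.card V : ℝ) ≤ F.B.card) (hBne : F.B.Nonempty)
    (hD : ω ∈ degEvent F.B K) (hT : ω ∈ typical p F.B K) (hH : ¬ F.Ham (toGraph ω)) :
    0.003 * (p * Fintype.card V) * Fintype.card V
      ≤ (1 - p) * (F.out K ω).card - p * (F.inn ω).card := by
  obtain ⟨⟨⟨⟨hbig, hhuge⟩, hsmall⟩, hlow⟩, hedge⟩ := hT
  have hdeg : MinDegFour (toGraph ω) F.B F.K := (minDegFour_iff.mpr hD).mono hKF
  obtain ⟨P, hP⟩ := F.exists_isMaxSys (toGraph ω)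
  have hends : ∀ Q, F.IsMaxSys (toGraph ω) Q →
      0.26 * (Fintype.card V : ℝ) ≤ (F.ends (toGraph ω) Q).card := fun Q hQ =>
    hQ.card_ends_ge hKF hB hBne hdeg hbig hsmall
  have hpiv := hP.card_pivots_ge hKF hB hhuge (hends P hP)
  have hout := F.card_out hD hP
  have hinn := F.card_inn hH fun Q hQ => ⟨hQ.three_le_length hBne hdeg,
    hQ.connect hKF hB hBne hdeg hbig hsmall⟩
  have hboost := hP.card_boosters (k := ⌈0.258 * (Fintype.card V : ℝ)⌉₊) fun Q hQ => by
    rw [Nat.ceil_le]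
    have h1 := card_inter_ge (S := F.ends (toGraph ω) Q) hB
    have h2 := hends Q hQ
    linarith
  have hint := card_inter_ge (S := F.ends (toGraph ω) P) hB
  have hKn : (F.K.card : ℝ) ≤ Fintype.card V := by exact_mod_cast Finset.card_le_univ _
  have hN := card_pairsIn_le F.B
  have hE := hends P hP
  have hlow' : ((lowDeg ω F.B).card : ℝ) ≤ 0.002 * Fintype.card V := hlow
  have hedge' : 0.998 * (p * (pairsIn F.B).card) ≤ numEdges ω F.B := hedge
  have hout' : (numEdges ω F.B : ℝ) + (F.pivots (toGraph ω) P).card ≤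
      (F.out K ω).card + F.K.card + 4 * (lowDeg ω F.B).card := by exact_mod_cast hout
  have hinn' : ((F.inn ω).card : ℝ) + numEdges ω F.B + (F.boosters (toGraph ω)).card ≤
      (pairsIn F.B).card := by exact_mod_cast hinn
  have hboost' : ((F.ends (toGraph ω) P ∩ F.B).card : ℝ) * (⌈0.258 * (Fintype.card V : ℝ)⌉₊ : ℕ) ≤
      2 * (F.boosters (toGraph ω)).card := by exact_mod_cast hboost
  have hceil := Nat.le_ceil (0.258 * (Fintype.card V : ℝ))
  have hn : (0 : ℝ) ≤ Fintype.card V := Nat.cast_nonneg _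
  generalize (Fintype.card V : ℝ) = n at *
  generalize ((F.ends (toGraph ω) P).card : ℝ) = s at *
  generalize ((F.ends (toGraph ω) P ∩ F.B).card : ℝ) = sB at *
  generalize ((F.pivots (toGraph ω) P).card : ℝ) = r at *
  generalize ((F.out K ω).card : ℝ) = o at *
  generalize ((F.inn ω).card : ℝ) = i at *
  generalize ((F.boosters (toGraph ω)).card : ℝ) = bo at *
  generalize (numEdges ω F.B : ℝ) = m at *
  generalize ((pairsIn F.B).card : ℝ) = N at *
  generalize ((lowDeg ω F.B).card : ℝ) = lo at *
  generalize (F.K.card : ℝ) = k at *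
  have hb1 : (s - 0.002 * n) * (0.258 * n) ≤ 2 * bo :=
    (mul_le_mul hint hceil (by positivity) (by linarith)).trans hboost'
  have hb2 : p * ((s - 0.002 * n) * (0.258 * n)) ≤ p * (2 * bo) :=
    mul_le_mul_of_nonneg_left hb1 h0
  -- The undeletable edges: `k ≤ n`, `4 lo ≤ 0.008 n` and `r ≥ 0.683 n - s`.
  have hbad : k + 4 * lo - r ≤ 0.325 * n + s := by linarith
  have ho : (1 - p) * (m - (0.325 * n + s)) ≤ (1 - p) * o :=
    mul_le_mul_of_nonneg_left (by linarith) (by linarith)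
  have hi : p * i ≤ p * (N - m - bo) := mul_le_mul_of_nonneg_left (by linarith) h0
  have hpN : p * N ≤ p * (n ^ 2 / 2) := mul_le_mul_of_nonneg_left hN h0
  have hps : 0 ≤ p * (0.325 * n + s) := mul_nonneg h0 (by linarith)
  set c := p * n with hcdef
  have h5 : p * ((s - 0.002 * n) * (0.258 * n)) = 0.258 * c * (s - 0.002 * n) := by
    rw [hcdef]; ring
  have h6 : p * (n ^ 2 / 2) = c * n / 2 := by rw [hcdef]; ring
  -- The difference is at least `0.129 c (s - 0.002 n) - 0.001 c n - 0.325 n - s`. The critical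
  -- point is `c = 20`, `s = 0.26 n`, where this is about `0.0606 n`, against the required `0.06 n`.
  have h7 : 0 ≤ (c - 20) * n := mul_nonneg (by linarith) hn
  have h8 : 0 ≤ (0.129 * c - 1) * (s - 0.26 * n) := mul_nonneg (by linarith) (by linarith)
  nlinarith

/-- Failure of Hamiltonicity is essentially as unlikely as failure of typicality. -/
theorem Frame.prob_not_ham_le (F : Frame V) {K : Finset V} {p : ℝ} (h0 : 0 ≤ p) (h1 : p ≤ 1)
    (hc : 20 ≤ p * Fintype.card V) (hKF : F.K ⊆ K)
    (hB : 0.998 * (Fintype.card V : ℝ) ≤ F.B.card) (hBne : F.B.Nonempty) :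
    prob p (degEvent F.B K ∩ {ω | ¬ F.Ham (toGraph ω)}) ≤
      168 * prob p (degEvent F.B K ∩ (typical p F.B K)ᶜ) := by
  have hsw := F.switching K h0 h1 (typical p F.B K)
    (κ := 0.003 * (p * Fintype.card V) * Fintype.card V)
    fun ω hω => F.out_sub_inn_ge h0 h1 hc hKF hB hBne hω.1.1 hω.1.2 hω.2
  have hn : (0 : ℝ) < Fintype.card V := by
    rcases (Nat.cast_nonneg (α := ℝ) (Fintype.card V)).eq_or_lt with h | h
    · rw [← h] at hc; norm_num at hc
    · exact h
  have hN := card_pairsIn_le F.B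
  set x := prob p (degEvent F.B K ∩ (typical p F.B K)ᶜ)
  set y := prob p ((degEvent F.B K ∩ typical p F.B K) ∩ {ω | ¬ F.Ham (toGraph ω)})
  have hx : 0 ≤ x := prob_nonneg h0 h1 _
  have h3 : prob p (degEvent F.B K ∩ {ω | ¬ F.Ham (toGraph ω)}) ≤ y + x := by
    refine (prob_mono h0 h1 fun ω hω => ?_).trans (prob_union_le h0 h1 _ _)
    by_cases hT : ω ∈ typical p F.B K
    · exact Or.inl ⟨⟨hω.1, hT⟩, hω.2⟩
    · exact Or.inr ⟨hω.1, hT⟩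
  have h4 : p * (pairsIn F.B).card * x ≤ p * ((Fintype.card V : ℝ) ^ 2 / 2) * x :=
    mul_le_mul_of_nonneg_right (mul_le_mul_of_nonneg_left hN h0) hx
  have h5 : (p * (Fintype.card V : ℝ) * Fintype.card V) * (0.003 * y) ≤
      (p * (Fintype.card V : ℝ) * Fintype.card V) * (x / 2) := by
    calc _ = 0.003 * (p * Fintype.card V) * Fintype.card V * y := by ring
      _ ≤ _ := hsw.trans h4
      _ = _ := by ring
  -- From `0.003 y ≤ x / 2` follows `y + x ≤ (500/3 + 1) x ≤ 168 x`.
  have h6 := le_of_mul_le_mul_left h5 (mul_pos (by linarith) hn)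
  linarith

end Typical

/-! ### Elementary inequalities -/

section Estimates

/-- Uniform in `k ≤ m`, because in both union bounds the second set may have any size up to a fixed
multiple of the first. -/
theorem pow_div_factorial_le {a t : ℝ} {k m : ℕ} (ht : (m : ℝ) = t) (hk : k ≤ m) (h0 : 0 < t)
    (ha : t ≤ a) : a ^ k / (k.factorial : ℝ) ≤ (a * Real.exp 1 / t) ^ m := by
  have h1 : a ^ k ≤ (a / t) ^ m * t ^ k := by
    have h2 : (a / t) ^ k ≤ (a / t) ^ m := pow_le_pow_right₀ ((one_le_div h0).mpr ha) hk
    calc a ^ k = (a / t) ^ k * t ^ k := by rw [← mul_pow, div_mul_cancel₀ _ h0.ne']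
      _ ≤ _ := mul_le_mul_of_nonneg_right h2 (by positivity)
  have h3 : t ^ k / (k.factorial : ℝ) ≤ Real.exp 1 ^ m := by
    rw [← Real.exp_nat_mul, mul_one, ht]
    exact Real.pow_div_factorial_le_exp t h0.le k
  calc a ^ k / (k.factorial : ℝ) ≤ (a / t) ^ m * t ^ k / k.factorial := by gcongr
    _ = (a / t) ^ m * (t ^ k / k.factorial) := by ring
    _ ≤ (a / t) ^ m * Real.exp 1 ^ m :=
        mul_le_mul_of_nonneg_left h3 (pow_nonneg (div_nonneg (h0.le.trans ha) h0.le) _)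
    _ = _ := by rw [← mul_pow]; congr 1; ring

theorem choose_le_of_le_mul {M m : ℕ} {x : ℝ} (hx : (M : ℝ) ≤ x * m) :
    (M.choose m : ℝ) ≤ (Real.exp 1 * x) ^ m := by
  rcases Nat.eq_zero_or_pos m with rfl | hm
  · simp
  have hm' : (0 : ℝ) < m := by exact_mod_cast hm
  have hx0 : 0 ≤ x := by
    by_contra hc
    have : x * m < 0 := mul_neg_of_neg_of_pos (not_le.mp hc) hm'
    linarith [Nat.cast_nonneg (α := ℝ) M]
  have h1 : (m : ℝ) ^ m / (m.factorial : ℝ) ≤ Real.exp 1 ^ m := by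
    rw [← Real.exp_nat_mul, mul_one]
    exact Real.pow_div_factorial_le_exp _ hm'.le m
  calc (M.choose m : ℝ) ≤ (M : ℝ) ^ m / m.factorial := Nat.choose_le_pow_div m M
    _ ≤ (x * m) ^ m / m.factorial := by gcongr
    _ = x ^ m * ((m : ℝ) ^ m / m.factorial) := by rw [mul_pow]; ring
    _ ≤ x ^ m * Real.exp 1 ^ m := mul_le_mul_of_nonneg_left h1 (by positivity)
    _ = _ := by rw [← mul_pow]; congr 1; ring

theorem three_le_exp : (3 : ℝ) ≤ Real.exp 1.1 := by
  refine le_trans ?_ (Real.sum_le_exp_of_nonneg (x := 1.1) (by norm_num) 7)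
  norm_num [Finset.sum_range_succ, Nat.factorial]

theorem two_point_seven_le_exp_one : (2.7 : ℝ) ≤ Real.exp 1 := by
  have := Real.exp_one_gt_d9
  linarith

theorem natCast_exp_le (k : ℕ) : (2.7 : ℝ) ^ k ≤ Real.exp k := by
  rw [← mul_one (k : ℝ), Real.exp_nat_mul]
  exact pow_le_pow_left₀ (by norm_num) two_point_seven_le_exp_one k

/-- Exponential decay beats the square. -/
theorem exp_neg_le_div_sq {κ n : ℝ} (hκ : 0 < κ) (hn : 0 < n) :
    Real.exp (-(κ * n)) ≤ (2 / κ ^ 2) / n ^ 2 := by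
  have h := Real.quadratic_le_exp_of_nonneg (x := κ * n) (by positivity)
  have h2 : (κ * n) ^ 2 / 2 ≤ Real.exp (κ * n) := by nlinarith [mul_pos hκ hn]
  rw [Real.exp_neg, inv_le_comm₀ (Real.exp_pos _) (by positivity)]
  refine le_trans (le_of_eq ?_) h2
  field_simp

end Estimates

/-! ### Failure of the increasing typical properties -/

section Decreasing

variable {V : Type*} [Fintype V] [DecidableEq V]

/-- The pairs joining `v` to the elements of `W`. -/
def star (v : V) (W : Finset V) : Finset (Sym2 V) := (W.erase v).image fun w => s(v, w)

theorem card_star (v : V) (W : Finset V) : (star v W).card = (W.erase v).card :=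
  Finset.card_image_of_injective _ fun _ _ h => Sym2.congr_right.mp h

theorem card_nbrs (ω : Sym2 V → Bool) (W : Finset V) (v : V) :
    (nbrs ω W v).card = ((star v W).filter fun e => ω e = true).card := by
  have : ((star v W).filter fun e => ω e = true) = (nbrs ω W v).image fun w => s(v, w) := by
    ext e
    simp only [star, nbrs, Finset.mem_filter, Finset.mem_image, Finset.mem_erase]
    constructor
    · rintro ⟨⟨w, ⟨h1, h2⟩, rfl⟩, h3⟩
      exact ⟨w, ⟨h2, h1.symm, h3⟩, rfl⟩
    · rintro ⟨w, ⟨h1, h2, h3⟩, rfl⟩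
      exact ⟨⟨w, ⟨h2.symm, h1⟩, rfl⟩, h3⟩
  rw [this]
  exact (Finset.card_image_of_injective _ fun _ _ h => Sym2.congr_right.mp h).symm

theorem disjoint_star {u v : V} {W : Finset V} (huv : u ≠ v) (hu : u ∉ W) :
    Disjoint (star u W) (star v W) := by
  rw [Finset.disjoint_left]
  intro e he he'
  obtain ⟨a, ha, rfl⟩ := Finset.mem_image.mp he
  obtain ⟨b, hb, h⟩ := Finset.mem_image.mp he'
  rcases Sym2.eq_iff.mp h with ⟨h1, _⟩ | ⟨_, h2⟩
  · exact huv h1.symm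
  · exact hu (h2 ▸ Finset.mem_of_mem_erase hb)

/-- The pairs between `S` and `W`. -/
def crossPairs (S W : Finset V) : Finset (Sym2 V) := (S ×ˢ W).image fun x => s(x.1, x.2)

theorem mem_crossPairs {S W : Finset V} {e : Sym2 V} :
    e ∈ crossPairs S W ↔ ∃ u ∈ S, ∃ w ∈ W, e = s(u, w) := by
  simp only [crossPairs, Finset.mem_image, Finset.mem_product, Prod.exists]
  constructor
  · rintro ⟨u, w, ⟨hu, hw⟩, rfl⟩
    exact ⟨u, hu, w, hw, rfl⟩
  · rintro ⟨u, hu, w, hw, rfl⟩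
    exact ⟨u, w, ⟨hu, hw⟩, rfl⟩

theorem card_crossPairs {S W : Finset V} (h : Disjoint S W) :
    (crossPairs S W).card = S.card * W.card := by
  rw [← Finset.card_product]
  refine Finset.card_image_of_injOn ?_
  rintro ⟨a, b⟩ hab ⟨a', b'⟩ hab' heq
  simp only [Finset.coe_product, Set.mem_prod, Finset.mem_coe] at hab hab'
  rcases Sym2.eq_iff.mp heq with ⟨h1, h2⟩ | ⟨h1, h2⟩
  · simp_all
  · exact absurd hab'.2 (Finset.disjoint_left.mp h ((show a = b' from h1) ▸ hab.1))

theorem nbrs_mono {ω ω' : Sym2 V → Bool} (h : ω ≤ ω') (W : Finset V) (v : V) :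
    nbrs ω W v ⊆ nbrs ω' W v := fun w hw => by
  rw [mem_nbrs] at hw ⊢
  exact ⟨hw.1, toGraph_mono h hw.2⟩

theorem isUpperSet_degEvent (B S : Finset V) : IsUpperSet (degEvent B S) :=
  fun _ _ h hω v hv => (hω v hv).trans (Finset.card_le_card (nbrs_mono h B v))

theorem isUpperSet_bigEvent (B K : Finset V) : IsUpperSet (bigEvent B K) := by
  intro ω ω' h hω S hS W hW hd hc
  obtain ⟨u, hu, w, hw, huw⟩ := hω S hS W hW hd hc
  exact ⟨u, hu, w, hw, toGraph_mono h huw⟩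

theorem isUpperSet_hugeEvent (B K : Finset V) : IsUpperSet (hugeEvent B K) := by
  intro ω ω' h hω S hS W hW hd hs hw
  obtain ⟨u, hu, h2⟩ := hω S hS W hW hd hs hw
  exact ⟨u, hu, h2.trans (Finset.card_le_card (nbrs_mono h W u))⟩

theorem isUpperSet_lowEvent (B : Finset V) : IsUpperSet (lowEvent B) := by
  intro ω ω' h hω
  refine le_trans ?_ (show ((lowDeg ω B).card : ℝ) ≤ _ from hω)
  exact_mod_cast Finset.card_le_card fun v hv => by
    rw [lowDeg, Finset.mem_filter] at hv ⊢
    exact ⟨hv.1, (Finset.card_le_card (nbrs_mono h B v)).trans hv.2⟩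

theorem isUpperSet_edgeEvent (p : ℝ) (B : Finset V) : IsUpperSet (edgeEvent p B) := by
  intro ω ω' h hω
  refine le_trans (show _ ≤ ((numEdges ω B : ℕ) : ℝ) from hω) ?_
  exact_mod_cast Finset.card_le_card fun e he => by
    rw [Finset.mem_filter] at he ⊢
    refine ⟨he.1, ?_⟩
    have := h e
    rw [he.2] at this
    exact top_le_iff.mp this

variable {p : ℝ} {B K : Finset V}

/-- A union bound over pairs of disjoint sets. -/
theorem prob_le_of_disjoint_pairs (h0 : 0 ≤ p) (h1 : p ≤ 1) (A : Set (Sym2 V → Bool))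
    (P : Finset V → Finset V → Set (Sym2 V → Bool)) {q : ℝ} (hq0 : 0 ≤ q)
    (hA : ∀ ω ∈ A, ∃ S W, Disjoint S W ∧ ω ∈ P S W)
    (hq : ∀ S W, Disjoint S W → prob p (P S W) ≤ q) :
    prob p A ≤ Real.exp (1.1 * Fintype.card V) * q := by
  classical
  -- Disjoint pairs are coded by three-colourings, and `3 ^ n ≤ exp (1.1 n)`.
  let S : (V → Fin 3) → Finset V := fun f => Finset.univ.filter fun v => f v = 0
  let W : (V → Fin 3) → Finset V := fun f => Finset.univ.filter fun v => f v = 1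
  have hd : ∀ f, Disjoint (S f) (W f) := fun f => by
    rw [Finset.disjoint_left]
    intro v hv hv'
    simp only [S, W, Finset.mem_filter, Finset.mem_univ, true_and] at hv hv'
    rw [hv] at hv'
    exact absurd hv' (by decide)
  have h := prob_le_sum h0 h1 Finset.univ A (fun f : V → Fin 3 => P (S f) (W f)) (by
    intro ω hω
    obtain ⟨S', W', hSW, hP⟩ := hA ω hω
    refine ⟨fun v => if v ∈ S' then 0 else if v ∈ W' then 1 else 2, Finset.mem_univ _, ?_⟩
    convert hP using 2
    · ext v
      by_cases h : v ∈ S' <;> by_cases h' : v ∈ W' <;> simp [S, h, h']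
    · ext v
      by_cases h : v ∈ S'
      · simp [W, h, Finset.disjoint_left.mp hSW h]
      · by_cases h' : v ∈ W' <;> simp [W, h, h'])
  refine h.trans ((Finset.sum_le_sum fun f _ => hq _ _ (hd f)).trans ?_)
  rw [Finset.sum_const, nsmul_eq_mul, Finset.card_univ, Fintype.card_fun, Fintype.card_fin]
  refine mul_le_mul_of_nonneg_right ?_ hq0
  rw [mul_comm, Real.exp_nat_mul]
  push_cast
  exact pow_le_pow_left₀ (by norm_num) three_le_exp _

/-- The threshold `0.056 n²` is chosen so that `p · 0.056 n² ≥ 1.12 n`, which beats the exponent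
`1.1 n` of the union bound. -/
theorem prob_bigEvent_compl (h0 : 0 ≤ p) (h1 : p ≤ 1) (hc : 20 ≤ p * Fintype.card V) :
    prob p (bigEvent B K)ᶜ ≤ Real.exp (-(0.01 * Fintype.card V)) := by
  classical
  set n : ℝ := (Fintype.card V : ℝ) with hn
  have hn0 : 0 ≤ n := Nat.cast_nonneg _
  refine (prob_le_of_disjoint_pairs h0 h1 _
    (fun S W => if 0.056 * n ^ 2 ≤ S.card * W.card then
      {ω | ∀ e ∈ crossPairs S W, ω e = false} else ∅) (q := Real.exp (-(1.12 * n)))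
    (Real.exp_pos _).le ?_ ?_).trans ?_
  · intro ω hω
    simp only [bigEvent, Set.mem_compl_iff, Set.mem_ofPred_eq, not_forall] at hω
    obtain ⟨S, hS, W, hW, hd, hcard, hno⟩ := hω
    push Not at hno
    refine ⟨S, W, hd, ?_⟩
    rw [if_pos hcard]
    intro e he
    obtain ⟨u, hu, w, hw, rfl⟩ := mem_crossPairs.mp he
    by_contra hce
    exact hno u hu w hw ⟨fun h => Finset.disjoint_left.mp hd hu (h ▸ hw), by simpa using hce⟩
  · intro S W hd
    split_ifs with hcard
    · rw [prob_all_false, card_crossPairs hd]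
      refine (one_sub_pow_le h1 _).trans (Real.exp_le_exp.mpr (neg_le_neg ?_))
      push_cast
      have h2 := mul_le_mul_of_nonneg_left hcard h0
      have h3 : p * (0.056 * n ^ 2) = 0.056 * n * (p * n) := by ring
      nlinarith
    · rw [prob_empty]
      exact (Real.exp_pos _).le
  · rw [← Real.exp_add]
    exact Real.exp_le_exp.mpr (by linarith)

theorem determinedBy_nbrs (W : Finset V) (v : V) (Q : ℕ → Prop) :
    DeterminedBy {ω : Sym2 V → Bool | Q (nbrs ω W v).card} (star v W : Finset (Sym2 V)) := by
  intro ω ω' h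
  simp only [Set.mem_ofPred_eq, card_nbrs]
  rw [Finset.filter_congr fun e he => by rw [h e he]]

/-- Since `S` and `W` are disjoint, the stars from `S` into `W` are independent. The mean degree
into `W` is at least `20 · 0.315 = 6.3`, so each vertex has at most one neighbour with probability
at most about `7.3 exp (-6.3)`, below `exp (-4.29)`; and `0.26 · 4.29 > 1.115`. -/
theorem prob_hugeEvent_compl (h0 : 0 ≤ p) (h1 : p ≤ 1) (hc : 20 ≤ p * Fintype.card V)
    (hn4 : (10 : ℝ) ^ 4 ≤ Fintype.card V) :
    prob p (hugeEvent B K)ᶜ ≤ Real.exp (-(0.01 * Fintype.card V)) := by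
  classical
  set n : ℝ := (Fintype.card V : ℝ) with hn
  have hn0 : 0 < n := lt_of_lt_of_le (by norm_num) hn4
  refine (prob_le_of_disjoint_pairs h0 h1 _
    (fun S W => if 0.26 * n ≤ S.card ∧ 0.315 * n ≤ W.card then
      {ω | ∀ u ∈ S, ω ∈ {ω : Sym2 V → Bool | (nbrs ω W u).card ≤ 1}} else ∅)
      (q := Real.exp (-(1.115 * n))) (Real.exp_pos _).le ?_ ?_).trans ?_
  · intro ω hω
    simp only [hugeEvent, Set.mem_compl_iff, Set.mem_ofPred_eq, not_forall] at hω
    obtain ⟨S, hS, W, hW, hd, hs, hw, hno⟩ := hω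
    push Not at hno
    refine ⟨S, W, hd, ?_⟩
    rw [if_pos ⟨hs, hw⟩]
    intro u hu
    have := hno u hu
    simp only [Set.mem_ofPred_eq]
    omega
  · intro S W hd
    split_ifs with hcard
    · obtain ⟨hs, hw⟩ := hcard
      rw [prob_iInter_indep S _ (fun u => (star u W : Finset (Sym2 V)))
        (fun u _ => determinedBy_nbrs W u (· ≤ 1))
        (fun u hu v hv huv => by
          exact_mod_cast disjoint_star huv (Finset.disjoint_left.mp hd hu))]
      have hbound : ∀ u ∈ S, prob p {ω : Sym2 V → Bool | (nbrs ω W u).card ≤ 1} ≤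
          Real.exp (-4.29) := fun u hu => by
        simp only [card_nbrs]
        refine (prob_card_le_one h0 h1 _).trans ?_
        rw [card_star, Finset.erase_eq_of_notMem (Finset.disjoint_left.mp hd hu)]
        set w : ℝ := (W.card : ℝ)
        have hx : 6.3 ≤ p * w := by
          have := mul_le_mul_of_nonneg_left hw h0
          nlinarith
        have hpw : p ≤ 0.001 * (p * w) := by
          have : 1000 ≤ w := by linarith
          nlinarith
        -- Tangent bound for the logarithm at `p * w = 6.3`.
        have e1 : 1 + p * w ≤ 7.3 * Real.exp ((p * w - 6.3) / 7.3) := by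
          have := Real.add_one_le_exp ((p * w - 6.3) / 7.3)
          have h7 : (7.3 : ℝ) * ((p * w - 6.3) / 7.3 + 1) = 1 + p * w := by ring
          linarith
        have e2 : (7.3 : ℝ) ≤ Real.exp 2 := by
          have h2 := Real.exp_one_gt_d9
          have h3 : Real.exp 2 = Real.exp 1 * Real.exp 1 := by rw [← Real.exp_add]; norm_num
          rw [h3]
          nlinarith
        calc (1 + p * w) * Real.exp (-(p * (w - 1)))
            ≤ (Real.exp 2 * Real.exp ((p * w - 6.3) / 7.3)) * Real.exp (-(p * (w - 1))) := by
              refine mul_le_mul_of_nonneg_right (e1.trans ?_) (Real.exp_pos _).le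
              exact mul_le_mul_of_nonneg_right e2 (Real.exp_pos _).le
          _ = Real.exp (2 + (p * w - 6.3) / 7.3 + -(p * (w - 1))) := by
              rw [Real.exp_add, Real.exp_add]
          _ ≤ _ := Real.exp_le_exp.mpr (by
              have : (p * w - 6.3) / 7.3 ≤ (p * w - 6.3) * 0.2 := by
                rw [div_le_iff₀ (by norm_num)]
                nlinarith
              nlinarith)
      refine (Finset.prod_le_prod (fun u _ => prob_nonneg h0 h1 _) hbound).trans ?_
      rw [Finset.prod_const, ← Real.exp_nat_mul]
      refine Real.exp_le_exp.mpr ?_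
      linarith
    · rw [prob_empty]
      exact (Real.exp_pos _).le
  · rw [← Real.exp_add]
    exact Real.exp_le_exp.mpr (by linarith)

/-- Fix about `0.002 n` low vertices `Y` and count only their neighbours in `B \ Y`, so that the
stars are disjoint. Chernoff with `t = 1/5`, close to the ratio of 4 to the mean 20, gives `5 ^ 4 *
exp (-15.9)` per vertex, against at most `500 e` per vertex for choosing `Y`. -/
theorem prob_lowEvent_compl (h0 : 0 ≤ p) (h1 : p ≤ 1) (hc : 20 ≤ p * Fintype.card V)
    (hn4 : (10 : ℝ) ^ 4 ≤ Fintype.card V) (hB : 0.998 * (Fintype.card V : ℝ) ≤ B.card) :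
    prob p (lowEvent B)ᶜ ≤ Real.exp (-(0.002 * Fintype.card V)) := by
  classical
  set n : ℝ := (Fintype.card V : ℝ) with hn
  have hn0 : 0 < n := lt_of_lt_of_le (by norm_num) hn4
  set y := ⌈0.002 * n⌉₊ with hy
  have hy1 : 0.002 * n ≤ y := Nat.le_ceil _
  have hy2 : (y : ℝ) < 0.002 * n + 1 := Nat.ceil_lt_add_one (by positivity)
  have hy0 : (0 : ℝ) < y := by linarith
  have h := prob_le_sum h0 h1 (B.powersetCard y) (lowEvent B)ᶜ
    (fun Y => {ω | ∀ v ∈ Y, ω ∈ {ω : Sym2 V → Bool | (nbrs ω (B \ Y) v).card ≤ 4}}) (by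
    intro ω hω
    have hω' : 0.002 * n < (lowDeg ω B).card := not_le.mp hω
    obtain ⟨Y, hY, hYc⟩ := Finset.exists_subset_card_eq (n := y) (s := lowDeg ω B)
      (Nat.ceil_le.mpr hω'.le)
    refine ⟨Y, Finset.mem_powersetCard.mpr ⟨hY.trans (Finset.filter_subset _ _), hYc⟩, ?_⟩
    intro v hv
    refine le_trans (Finset.card_le_card fun w hw => ?_) (Finset.mem_filter.mp (hY hv)).2
    rw [mem_nbrs] at hw ⊢
    exact ⟨(Finset.mem_sdiff.mp hw.1).1, hw.2⟩)
  refine h.trans ?_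
  have hterm : ∀ Y ∈ B.powersetCard y,
      prob p {ω | ∀ v ∈ Y, ω ∈ {ω : Sym2 V → Bool | (nbrs ω (B \ Y) v).card ≤ 4}} ≤
        (625 * Real.exp (-15.9)) ^ y := by
    intro Y hY
    obtain ⟨hYB, hYc⟩ := Finset.mem_powersetCard.mp hY
    rw [prob_iInter_indep Y _ (fun u => (star u (B \ Y) : Finset (Sym2 V)))
        (fun u _ => determinedBy_nbrs (B \ Y) u (· ≤ 4))
        (fun u hu v hv huv => by
          exact_mod_cast disjoint_star huv (fun h => (Finset.mem_sdiff.mp h).2 hu))]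
    rw [← hYc, ← Finset.prod_const]
    refine Finset.prod_le_prod (fun u _ => prob_nonneg h0 h1 _) fun v hv => ?_
    have hch := prob_card_le h0 h1 (star v (B \ Y)) (t := 1 / 5) (a := 4) (by norm_num)
      (by norm_num)
    have hset : {ω : Sym2 V → Bool | (nbrs ω (B \ Y) v).card ≤ 4} =
        {ω | (((star v (B \ Y)).filter fun e => ω e = true).card : ℝ) ≤ 4} := by
      ext ω
      simp only [Set.mem_ofPred_eq, card_nbrs]
      norm_cast
    rw [hset]
    refine hch.trans (mul_le_mul (le_of_eq ?_) (Real.exp_le_exp.mpr ?_) (Real.exp_pos _).le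
      (by norm_num))
    · rw [one_div, Real.inv_rpow (by norm_num), ← Real.rpow_neg (by norm_num)]
      norm_num
    · rw [card_star, Finset.erase_eq_of_notMem fun h => (Finset.mem_sdiff.mp h).2 hv]
      have : ((B \ Y).card : ℝ) = B.card - y := by
        rw [Finset.card_sdiff_of_subset hYB, Nat.cast_sub (Finset.card_le_card hYB), hYc]
      rw [this]
      have h3 : 0.995 * n ≤ B.card - y := by linarith
      have h4 := mul_le_mul_of_nonneg_left h3 h0
      nlinarith
  refine (Finset.sum_le_sum hterm).trans ?_
  rw [Finset.sum_const, Finset.card_powersetCard, nsmul_eq_mul]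
  have hchoose : (B.card.choose y : ℝ) ≤ (Real.exp 1 * 500) ^ y := by
    refine choose_le_of_le_mul ?_
    have : (B.card : ℝ) ≤ n := by rw [hn]; exact_mod_cast Finset.card_le_univ B
    linarith
  calc (B.card.choose y : ℝ) * (625 * Real.exp (-15.9)) ^ y
      ≤ (Real.exp 1 * 500) ^ y * (625 * Real.exp (-15.9)) ^ y := by gcongr
    _ = (312500 * Real.exp (-14.9)) ^ y := by
        rw [← mul_pow]
        congr 1
        have : Real.exp 1 * Real.exp (-15.9) = Real.exp (-14.9) := by
          rw [← Real.exp_add]; norm_num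
        rw [← this]; ring
    _ ≤ Real.exp (-1) ^ y := by
        refine pow_le_pow_left₀ (by positivity) ?_ _
        have e1 : (312500 : ℝ) ≤ Real.exp 13 := by
          refine le_trans ?_ (natCast_exp_le 13)
          norm_num
        calc 312500 * Real.exp (-14.9) ≤ Real.exp 13 * Real.exp (-14.9) := by gcongr
          _ = Real.exp (-1.9) := by rw [← Real.exp_add]; norm_num
          _ ≤ _ := Real.exp_le_exp.mpr (by norm_num)
    _ = Real.exp (-y) := by rw [← Real.exp_nat_mul]; congr 1; ring
    _ ≤ _ := Real.exp_le_exp.mpr (by linarith)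

/-- Chernoff with `t = 0.998`. As `0.0020025` barely exceeds `-log 0.998`, the gain per unit of the
mean is `0.002 - 0.998 · 0.0020025`, about `1.5e-6`, and the mean is at least `9 n`. -/
theorem prob_edgeEvent_compl (h0 : 0 ≤ p) (h1 : p ≤ 1) (hc : 20 ≤ p * Fintype.card V)
    (hn4 : (10 : ℝ) ^ 4 ≤ Fintype.card V) (hB : 0.998 * (Fintype.card V : ℝ) ≤ B.card) :
    prob p (edgeEvent p B)ᶜ ≤ Real.exp (-(1e-6 * Fintype.card V)) := by
  set n : ℝ := (Fintype.card V : ℝ) with hn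
  have hn0 : 0 < n := lt_of_lt_of_le (by norm_num) hn4
  set N : ℝ := ((pairsIn B).card : ℝ) with hN
  have hpN : 9 * n ≤ p * N := by
    have h2 : 0.49 * n ^ 2 ≤ N := by
      rw [hN, card_pairsIn, Nat.cast_choose_two]
      nlinarith
    have h3 := mul_le_mul_of_nonneg_left h2 h0
    have h4 : p * (0.49 * n ^ 2) = 0.49 * n * (p * n) := by ring
    nlinarith
  have h := prob_card_le h0 h1 (pairsIn B) (t := 0.998) (a := 0.998 * (p * N)) (by norm_num)
    (by norm_num)
  refine (prob_mono h0 h1 fun ω hω => ?_).trans (h.trans ?_)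
  · have hω' : ¬ 0.998 * (p * ((pairsIn B).card : ℝ)) ≤ numEdges ω B := hω
    exact (not_le.mp hω').le
  · have e1 : (0.998 : ℝ)⁻¹ ≤ Real.exp 0.0020025 := by
      refine le_trans ?_ (Real.quadratic_le_exp_of_nonneg (by norm_num))
      norm_num
    have e2 : (0.998 : ℝ) ^ (-(0.998 * (p * N))) ≤ Real.exp (0.0020025 * (0.998 * (p * N))) := by
      rw [Real.rpow_neg (by norm_num), ← Real.inv_rpow (by norm_num), Real.exp_mul]
      exact Real.rpow_le_rpow (by norm_num) e1 (by nlinarith)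
    refine (mul_le_mul_of_nonneg_right e2 (Real.exp_pos _).le).trans ?_
    rw [← Real.exp_add]
    refine Real.exp_le_exp.mpr ?_
    rw [← hN]
    nlinarith

end Decreasing

/-! ### The first-moment term for dense spots -/

section SpotEstimate

/-- The tangent bound `c ≤ 20 exp ((c - 20) / 20)` reduces everything to `c = 20`, where the
exponent is `6 - 15.46 = -9.46`. The remaining decay in `c - 20` later absorbs a factor `c ^ 2`. -/
theorem dense_spot_rate {c : ℝ} (hc : 20 ≤ c) :
    Real.exp 1 ^ 2 * c * (Real.exp 1 ^ 2 * c / 2) ^ 2 * (10 / 9) ^ 3 * Real.exp (-(0.773 * c)) ≤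
      1 / 4 * Real.exp (-(0.6 * (c - 20))) := by
  have h1 : c ≤ 20 * Real.exp ((c - 20) / 20) := by
    have := Real.add_one_le_exp ((c - 20) / 20)
    linarith
  have h3 : c ^ 3 ≤ 8000 * Real.exp (0.15 * (c - 20)) := by
    calc c ^ 3 ≤ (20 * Real.exp ((c - 20) / 20)) ^ 3 := pow_le_pow_left₀ (by linarith) h1 3
      _ = 8000 * Real.exp (0.15 * (c - 20)) := by
        rw [mul_pow, ← Real.exp_nat_mul]
        norm_num
        ring
  have h4 : (10974 : ℝ) ≤ Real.exp 9.46 := by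
    have e1 := natCast_exp_le 9
    have e2 : (1.58 : ℝ) ≤ Real.exp 0.46 := by
      refine le_trans ?_ (Real.sum_le_exp_of_nonneg (x := 0.46) (by norm_num) 4)
      norm_num [Finset.sum_range_succ, Nat.factorial]
    calc (10974 : ℝ) ≤ 2.7 ^ 9 * 1.58 := by norm_num
      _ ≤ Real.exp (9 : ℕ) * Real.exp 0.46 := by gcongr
      _ = Real.exp 9.46 := by rw [← Real.exp_add]; norm_num
  have h5 : (10974 : ℝ) * Real.exp (-9.46) ≤ 1 := by
    rw [Real.exp_neg, ← div_eq_mul_inv, div_le_one (Real.exp_pos _)]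
    exact h4
  calc Real.exp 1 ^ 2 * c * (Real.exp 1 ^ 2 * c / 2) ^ 2 * (10 / 9) ^ 3 * Real.exp (-(0.773 * c))
      = (250 / 729) * c ^ 3 * Real.exp 1 ^ 6 * Real.exp (-(0.773 * c)) := by ring
    _ ≤ (250 / 729) * (8000 * Real.exp (0.15 * (c - 20))) * Real.exp 1 ^ 6 *
          Real.exp (-(0.773 * c)) := by gcongr
    _ = (250 / 729 * 8000) * Real.exp (-9.46) * Real.exp (-(0.623 * (c - 20))) := by
        have : Real.exp (0.15 * (c - 20)) * Real.exp 1 ^ 6 * Real.exp (-(0.773 * c)) =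
            Real.exp (-9.46) * Real.exp (-(0.623 * (c - 20))) := by
          rw [← Real.exp_nat_mul, ← Real.exp_add, ← Real.exp_add, ← Real.exp_add]
          congr 1
          push_cast
          ring
        linear_combination (250 / 729 * 8000) * this
    _ ≤ 1 / 4 * Real.exp (-(0.6 * (c - 20))) := by
        refine mul_le_mul ?_ (Real.exp_le_exp.mpr (by linarith)) (Real.exp_pos _).le (by norm_num)
        have := Real.exp_pos (-9.46)
        linarith

/-- Choices of `S`, of `T` and of `s + k + 2` edges. As many edges as vertices balance the choices
and leave geometric decay in `s`; the two surplus edges contribute `(e s p) ^ 2`, the source of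
`n⁻²`. Here `0.773 = 0.998 - 3 · 0.075` bounds the fraction of vertices to which `S` sends no edge.
-/
theorem dense_spot_term {n s k M : ℕ} {b p : ℝ} (h0 : 0 ≤ p) (hc : 20 ≤ p * n)
    (hs : (s : ℝ) < 0.075 * n) (hk : k + 1 ≤ 2 * s) (hb : 0.998 * n ≤ b)
    (hM : M ≤ s * (s + k)) :
    (n.choose s : ℝ) * (n.choose k * (M.choose (s + k + 2) * (p ^ (s + k + 2) *
      Real.exp (-(p * (s * (b - s - k)))) * (10 / 9) ^ (s + k)))) ≤
      400 * Real.exp 1 ^ 2 * (s ^ 2 * (1 / 4) ^ s) / n ^ 2 := by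
  have hs1 : 1 ≤ s := by omega
  have hs0 : (0 : ℝ) < s := by exact_mod_cast hs1
  have hn0 : (0 : ℝ) < n := by linarith
  set e := Real.exp 1 with he
  have he0 : 0 < e := Real.exp_pos 1
  have he1 : 1 ≤ e := by linarith [two_point_seven_le_exp_one]
  set c := p * n with hcdef
  have hk2 : (k : ℝ) ≤ 2 * s := by exact_mod_cast (by omega : k ≤ 2 * s)
  have a1 : (n.choose s : ℝ) ≤ (e * (n / s)) ^ s := choose_le_of_le_mul (by
    rw [div_mul_cancel₀ _ hs0.ne'])
  have a2 : (n.choose k : ℝ) ≤ (n : ℝ) ^ k / k.factorial := Nat.choose_le_pow_div k n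
  have a3 : (M.choose (s + k + 2) : ℝ) ≤ (e * s) ^ (s + k + 2) := choose_le_of_le_mul (by
    have : M ≤ s * (s + k + 2) := hM.trans (Nat.mul_le_mul_left s (by omega))
    exact_mod_cast this)
  have a4 : Real.exp (-(p * (s * (b - s - k)))) ≤ Real.exp (-(0.773 * c)) ^ s := by
    rw [← Real.exp_nat_mul]
    refine Real.exp_le_exp.mpr ?_
    have h1 : 0.773 * n ≤ b - s - k := by linarith
    have h2 : p * (s * (0.773 * n)) ≤ p * (s * (b - s - k)) := by gcongr
    have h3 : p * (s * (0.773 * n)) = s * (0.773 * c) := by rw [hcdef]; ring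
    linarith
  have a5 : ((10 : ℝ) / 9) ^ (s + k) ≤ ((10 / 9) ^ 3) ^ s := by
    rw [← pow_mul]
    exact pow_le_pow_right₀ (by norm_num) (by omega)
  have a6 : (e * s * c) ^ k / (k.factorial : ℝ) ≤ (e ^ 2 * c / 2) ^ (2 * s) := by
    refine (pow_div_factorial_le (t := 2 * s) (m := 2 * s) (by push_cast; ring) (by omega)
      (by positivity) ?_).trans (le_of_eq ?_)
    · nlinarith [mul_le_mul he1 hc (by norm_num) he0.le]
    · congr 1
      rw [← he]
      field_simp
  calc (n.choose s : ℝ) * (n.choose k * (M.choose (s + k + 2) * (p ^ (s + k + 2) *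
      Real.exp (-(p * (s * (b - s - k)))) * (10 / 9) ^ (s + k))))
      ≤ (e * (n / s)) ^ s * ((n : ℝ) ^ k / k.factorial * ((e * s) ^ (s + k + 2) *
        (p ^ (s + k + 2) * Real.exp (-(0.773 * c)) ^ s * ((10 / 9) ^ 3) ^ s))) := by gcongr
    _ = (e ^ 2 * c) ^ s * ((e * s * c) ^ k / k.factorial) * ((10 / 9) ^ 3) ^ s *
        Real.exp (-(0.773 * c)) ^ s * (e * s * p) ^ 2 := by
        have h1 : (e * (n / s)) ^ s * ((e * s) ^ s * p ^ s) = (e ^ 2 * c) ^ s := by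
          rw [← mul_pow, ← mul_pow]
          congr 1
          rw [hcdef]
          field_simp
        have h2 : (n : ℝ) ^ k * ((e * s) ^ k * p ^ k) = (e * s * c) ^ k := by
          rw [← mul_pow, ← mul_pow, hcdef]
          congr 1
          ring
        rw [← h1, ← h2, pow_add, pow_add, pow_add, pow_add]
        ring
    _ ≤ (e ^ 2 * c) ^ s * ((e ^ 2 * c / 2) ^ (2 * s)) * ((10 / 9) ^ 3) ^ s *
        Real.exp (-(0.773 * c)) ^ s * (e * s * p) ^ 2 := by gcongr
    _ = (e ^ 2 * c * (e ^ 2 * c / 2) ^ 2 * (10 / 9) ^ 3 * Real.exp (-(0.773 * c))) ^ s *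
        (e * s * p) ^ 2 := by
        rw [pow_mul, ← mul_pow, ← mul_pow, ← mul_pow]
    _ ≤ (1 / 4 * Real.exp (-(0.6 * (c - 20)))) ^ s * (e * s * p) ^ 2 := by
        exact mul_le_mul_of_nonneg_right
          (pow_le_pow_left₀ (by positivity) (dense_spot_rate hc) s) (by positivity)
    _ = (1 / 4) ^ s * (Real.exp (-(0.6 * (c - 20))) ^ s * c ^ 2) * (e ^ 2 * s ^ 2) / n ^ 2 := by
        rw [mul_pow, hcdef]
        field_simp
    _ ≤ (1 / 4) ^ s * 400 * (e ^ 2 * s ^ 2) / n ^ 2 := by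
        have h1 : Real.exp (-(0.6 * (c - 20))) ^ s ≤ Real.exp (-(0.6 * (c - 20))) := by
          refine pow_le_of_le_one (Real.exp_pos _).le ?_ (by omega)
          rw [Real.exp_le_one_iff]
          linarith
        have h2 : c ≤ 20 * Real.exp ((c - 20) / 20) := by
          have := Real.add_one_le_exp ((c - 20) / 20)
          linarith
        have h3 : c ^ 2 ≤ 400 * Real.exp (0.1 * (c - 20)) := by
          calc c ^ 2 ≤ (20 * Real.exp ((c - 20) / 20)) ^ 2 := pow_le_pow_left₀ (by linarith) h2 2
            _ = 400 * Real.exp (0.1 * (c - 20)) := by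
              rw [mul_pow, ← Real.exp_nat_mul]
              norm_num
              ring
        have h4 : Real.exp (-(0.6 * (c - 20))) ^ s * c ^ 2 ≤ 400 := by
          calc _ ≤ Real.exp (-(0.6 * (c - 20))) * (400 * Real.exp (0.1 * (c - 20))) := by gcongr
            _ = 400 * Real.exp (-(0.5 * (c - 20))) := by
              rw [mul_left_comm, ← Real.exp_add]
              congr 2
              ring
            _ ≤ 400 * 1 := by
              gcongr
              rw [Real.exp_le_one_iff]
              linarith
            _ = 400 := by norm_num
        gcongr
    _ = _ := by ring

end SpotEstimate

/-! ### Dense spots and atypicality under the degree condition -/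

section Spots

variable {V : Type*} [Fintype V] [DecidableEq V] {p : ℝ} {B K : Finset V}

theorem prob_four_le_nbrs (h0 : 0 ≤ p) (h1 : p ≤ 1) (hc : 20 ≤ p * Fintype.card V)
    (hn4 : (10 : ℝ) ^ 4 ≤ Fintype.card V) (hB : 0.998 * (Fintype.card V : ℝ) ≤ B.card) (v : V) :
    9 / 10 ≤ prob p {ω : Sym2 V → Bool | 4 ≤ (nbrs ω B v).card} := by
  have h := prob_card_le h0 h1 (star v B) (t := 1 / 4) (a := 3) (by norm_num) (by norm_num)
  have hset : {ω : Sym2 V → Bool | 4 ≤ (nbrs ω B v).card}ᶜ =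
      {ω | (((star v B).filter fun e => ω e = true).card : ℝ) ≤ 3} := by
    ext ω
    simp only [Set.mem_compl_iff, Set.mem_ofPred_eq, card_nbrs, not_le]
    norm_cast
    omega
  have hadd := prob_add_compl (p := p) {ω : Sym2 V → Bool | 4 ≤ (nbrs ω B v).card}
  rw [hset] at hadd
  have hcard : (B.card : ℝ) - 1 ≤ (star v B).card := by
    have := Finset.pred_card_le_card_erase (a := v) (s := B)
    rw [card_star]
    have h2 : B.card ≤ (B.erase v).card + 1 := by omega
    have h3 : (B.card : ℝ) ≤ (B.erase v).card + 1 := by exact_mod_cast h2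
    linarith
  have hexp : ((1 : ℝ) / 4) ^ (-(3 : ℝ)) * Real.exp (-(p * (1 - 1 / 4) * (star v B).card)) ≤
      1 / 10 := by
    have e1 : ((1 : ℝ) / 4) ^ (-(3 : ℝ)) = 64 := by
      rw [one_div, Real.inv_rpow (by norm_num), ← Real.rpow_neg (by norm_num)]
      norm_num
    have e2 : Real.exp (-(p * (1 - 1 / 4) * (star v B).card)) ≤ Real.exp (-(7 : ℕ)) := by
      refine Real.exp_le_exp.mpr ?_
      have h3 : 0.9 * (Fintype.card V : ℝ) ≤ (star v B).card := by linarith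
      have := mul_le_mul_of_nonneg_left h3 h0
      push_cast
      nlinarith
    have e3 := natCast_exp_le 7
    have e4 : Real.exp (-(7 : ℕ)) ≤ 1 / 640 := by
      rw [Real.exp_neg, ← one_div]
      exact one_div_le_one_div_of_le (by norm_num) (le_trans (by norm_num) e3)
    rw [e1]
    linarith
  linarith

/-- Each degree condition is increasing and has probability at least `9/10`; by Harris, restoring
those on `R` costs at most this factor per vertex. -/
theorem prob_degEvent_ge (h0 : 0 ≤ p) (h1 : p ≤ 1) (hc : 20 ≤ p * Fintype.card V)
    (hn4 : (10 : ℝ) ^ 4 ≤ Fintype.card V) (hB : 0.998 * (Fintype.card V : ℝ) ≤ B.card)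
    (R : Finset V) :
    prob p (degEvent B (K \ R)) ≤ (10 / 9) ^ R.card * prob p (degEvent B K) := by
  have h2 : prob p (degEvent B (K \ R)) * (9 / 10) ^ R.card ≤ prob p (degEvent B K) := by
    have hprod : (9 / 10 : ℝ) ^ R.card ≤
        prob p {ω | ∀ v ∈ R, ω ∈ {ω : Sym2 V → Bool | 4 ≤ (nbrs ω B v).card}} := by
      rw [← Finset.prod_const]
      exact (Finset.prod_le_prod (fun _ _ => by norm_num)
        (fun v _ => prob_four_le_nbrs h0 h1 hc hn4 hB v)).trans
        (prod_prob_le_iInter h0 h1 R _ fun v _ ω ω' h hω =>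
          le_trans hω (Finset.card_le_card (nbrs_mono h B v)))
    have hup : IsUpperSet {ω | ∀ v ∈ R, ω ∈ {ω : Sym2 V → Bool | 4 ≤ (nbrs ω B v).card}} :=
      isUpperSet_degEvent B R
    refine (mul_le_mul_of_nonneg_left hprod (prob_nonneg h0 h1 _)).trans
      ((prob_mul_le_inter h0 h1 (isUpperSet_degEvent B (K \ R)) hup).trans
        (prob_mono h0 h1 ?_))
    intro ω hω v hv
    by_cases hvR : v ∈ R
    · exact hω.2 v hvR
    · exact hω.1 v (Finset.mem_sdiff.mpr ⟨hv, hvR⟩)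
  have h3 : (10 / 9 : ℝ) ^ R.card * (9 / 10) ^ R.card = 1 := by
    rw [← mul_pow]
    norm_num
  calc prob p (degEvent B (K \ R))
      = (10 / 9) ^ R.card * (prob p (degEvent B (K \ R)) * (9 / 10) ^ R.card) := by
        rw [mul_left_comm, h3, mul_one]
    _ ≤ _ := mul_le_mul_of_nonneg_left h2 (by positivity)

/-- A dense spot is not a monotone event. Without the degree conditions on `R = S ∪ T`, the
prescribed edges, all inside `R`, are independent of the rest. The prescribed non-edges form a
decreasing event, which Harris separates from the other degree conditions; `prob_degEvent_ge`
restores the dropped ones. -/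
theorem prob_spot_le (h0 : 0 ≤ p) (h1 : p ≤ 1) (hc : 20 ≤ p * Fintype.card V)
    (hn4 : (10 : ℝ) ^ 4 ≤ Fintype.card V) (hB : 0.998 * (Fintype.card V : ℝ) ≤ B.card)
    {S T : Finset V} (hST : Disjoint S T) {E : Finset (Sym2 V)} (hE : E ⊆ crossPairs S (S ∪ T)) :
    prob p ({ω | ∀ e ∈ E, ω e = true} ∩
      ({ω | ∀ e ∈ crossPairs S (B \ (S ∪ T)), ω e = false} ∩ degEvent B K)) ≤
      p ^ E.card * Real.exp (-(p * (S.card * (B.card - S.card - T.card)))) *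
        (10 / 9) ^ (S.card + T.card) * prob p (degEvent B K) := by
  set R := S ∪ T with hR
  have hRc : R.card = S.card + T.card := Finset.card_union_of_disjoint hST
  have hSR : Disjoint S (B \ R) := Finset.disjoint_left.mpr fun x hx hx' =>
    (Finset.mem_sdiff.mp hx').2 (Finset.mem_union_left _ hx)
  have hstep1 : prob p ({ω | ∀ e ∈ E, ω e = true} ∩
      ({ω | ∀ e ∈ crossPairs S (B \ R), ω e = false} ∩ degEvent B K)) ≤
      prob p ({ω | ∀ e ∈ E, ω e = true} ∩
      ({ω | ∀ e ∈ crossPairs S (B \ R), ω e = false} ∩ degEvent B (K \ R))) :=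
    prob_mono h0 h1 fun ω hω => ⟨hω.1, hω.2.1, fun v hv => hω.2.2 v (Finset.mem_sdiff.mp hv).1⟩
  have hdet : DeterminedBy ({ω : Sym2 V → Bool | ∀ e ∈ crossPairs S (B \ R), ω e = false} ∩
      degEvent B (K \ R)) {e | e ∉ E} := by
    have hout : ∀ u w, u ∉ R ∨ w ∉ R → s(u, w) ∉ E := by
      intro u w h hin
      obtain ⟨a, ha, b, hb, heq⟩ := mem_crossPairs.mp (hE hin)
      have ha' : a ∈ R := Finset.mem_union_left _ ha
      rcases Sym2.eq_iff.mp heq with ⟨rfl, rfl⟩ | ⟨rfl, rfl⟩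
      · exact h.elim (· ha') (· hb)
      · exact h.elim (· hb) (· ha')
    refine DeterminedBy.inter ((determinedBy_all _ false).mono fun e he => ?_) fun ω ω' h => ?_
    · obtain ⟨u, _, w, hw, rfl⟩ := mem_crossPairs.mp he
      exact hout u w (Or.inr (Finset.mem_sdiff.mp hw).2)
    · refine forall₂_congr fun v hv => ?_
      have : nbrs ω B v = nbrs ω' B v := by
        refine Finset.filter_congr fun w _ => ?_
        rw [h s(v, w) (hout v w (Or.inl (Finset.mem_sdiff.mp hv).2))]
      rw [this]
  have hstep2 := prob_indep (p := p) (determinedBy_all E true) hdet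
    (Set.disjoint_left.mpr fun e he he' => he' he)
  have hlow : IsLowerSet {ω : Sym2 V → Bool | ∀ e ∈ crossPairs S (B \ R), ω e = false} := by
    intro ω ω' h hω e he
    have := h e
    rw [hω e he] at this
    exact le_bot_iff.mp this
  have hstep3 := prob_inter_le_mul h0 h1 hlow (isUpperSet_degEvent B (K \ R))
  have hstep4 := prob_degEvent_ge (K := K) h0 h1 hc hn4 hB R
  have hstep5 : prob p {ω : Sym2 V → Bool | ∀ e ∈ crossPairs S (B \ R), ω e = false} ≤
      Real.exp (-(p * (S.card * (B.card - S.card - T.card)))) := by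
    rw [prob_all_false, card_crossPairs hSR]
    refine (one_sub_pow_le h1 _).trans (Real.exp_le_exp.mpr (neg_le_neg ?_))
    push_cast
    have hc1 : B.card ≤ (B \ R).card + (S.card + T.card) := by
      have := Finset.le_card_sdiff R B
      omega
    have hc2 : (B.card : ℝ) ≤ (B \ R).card + (S.card + T.card) := by exact_mod_cast hc1
    have : (B.card : ℝ) - S.card - T.card ≤ (B \ R).card := by linarith
    gcongr
  refine hstep1.trans (hstep2.le.trans ?_)
  rw [prob_all_true]
  have hD := prob_nonneg h0 h1 (degEvent B K)
  calc _ ≤ p ^ E.card * (prob p {ω : Sym2 V → Bool | ∀ e ∈ crossPairs S (B \ R), ω e = false} *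
        prob p (degEvent B (K \ R))) := by gcongr
    _ ≤ p ^ E.card * (Real.exp (-(p * (S.card * (B.card - S.card - T.card)))) *
        ((10 / 9) ^ R.card * prob p (degEvent B K))) := by
        have := prob_nonneg h0 h1 (degEvent B (K \ R))
        gcongr
    _ = _ := by rw [hRc]; ring

/-- The constant in the estimate for dense spots. -/
noncomputable def spotConst : ℝ :=
  800 * Real.exp 1 ^ 2 * ∑' s : ℕ, (s : ℝ) ^ 3 * (1 / 4) ^ s

/-- First moment over sizes, sets and exactly `s + k + 2` of the edges. The at most `2 s` values of
`k` turn `s ^ 2` into the `s ^ 3` of the convergent series in `spotConst`. -/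
theorem prob_smallEvent_compl (h0 : 0 ≤ p) (h1 : p ≤ 1) (hc : 20 ≤ p * Fintype.card V)
    (hn4 : (10 : ℝ) ^ 4 ≤ Fintype.card V) (hB : 0.998 * (Fintype.card V : ℝ) ≤ B.card) :
    prob p ((smallEvent B K)ᶜ ∩ degEvent B K) ≤
      spotConst / (Fintype.card V : ℝ) ^ 2 * prob p (degEvent B K) := by
  classical
  set n := Fintype.card V with hn
  have hD := prob_nonneg h0 h1 (degEvent B K)
  let I : Finset (Σ _ : ℕ, Σ _ : ℕ, Σ _ : Finset V, Σ _ : Finset V, Finset (Sym2 V)) :=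
    ((Finset.range (n + 1)).filter fun s : ℕ => (s : ℝ) < 0.075 * n).sigma fun s : ℕ =>
      ((Finset.range (2 * s)).filter fun k : ℕ => k + 1 ≤ 2 * s).sigma fun k : ℕ =>
        (Finset.univ.powersetCard s).sigma fun S : Finset V =>
          ((Finset.univ.powersetCard k).filter fun T : Finset V => Disjoint S T).sigma fun T =>
            (crossPairs S (S ∪ T)).powersetCard (s + k + 2)
  have hsum := prob_le_sum h0 h1 I ((smallEvent B K)ᶜ ∩ degEvent B K)
    (fun x => {ω | ∀ e ∈ x.2.2.2.2, ω e = true} ∩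
      ({ω | ∀ e ∈ crossPairs x.2.2.1 (B \ (x.2.2.1 ∪ x.2.2.2.1)), ω e = false} ∩
        degEvent B K)) (by
    rintro ω ⟨hω, hωD⟩
    simp only [smallEvent, Set.mem_compl_iff, Set.mem_ofPred_eq, not_forall, not_not] at hω
    obtain ⟨S, hS, T, hs, hd⟩ := hω
    have hk := hd.card_le
    obtain ⟨E, hE, hEc⟩ := Finset.exists_subset_card_eq hd.edges
    have hEm : ∀ e ∈ E, e ∈ crossPairs S (S ∪ T) ∧ ω e = true := fun e he => by
      obtain ⟨u, hu, w, hw, huw, rfl⟩ := mem_edgesTo.mp (hE he)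
      refine ⟨mem_crossPairs.mpr ⟨u, hu, w, ?_, rfl⟩, huw.2⟩
      by_contra hc
      rw [Finset.mem_union, not_or] at hc
      exact hd.no_edge u hu w hw hc.1 hc.2 huw
    refine ⟨⟨S.card, T.card, S, T, E⟩, ?_, fun e he => (hEm e he).2, ?_, hωD⟩
    · simp only [I, Finset.mem_sigma, Finset.mem_filter, Finset.mem_range,
        Finset.mem_powersetCard, Finset.subset_univ, true_and]
      exact ⟨⟨Nat.lt_succ_of_le (Finset.card_le_univ S), hs⟩, ⟨by omega, hk⟩,
        hd.disj, fun e he => (hEm e he).1, hEc⟩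
    · intro e he
      obtain ⟨u, hu, w, hw, rfl⟩ := mem_crossPairs.mp he
      by_contra hce
      rw [Finset.mem_sdiff, Finset.mem_union, not_or] at hw
      exact hd.no_edge u hu w hw.1 hw.2.1 hw.2.2
        ⟨fun h => hw.2.1 (h ▸ hu), by simpa using hce⟩)
  refine hsum.trans ?_
  simp only [I, Finset.sum_sigma]
  have hinner : ∀ s ∈ (Finset.range (n + 1)).filter fun s : ℕ => (s : ℝ) < 0.075 * n,
      ∀ k ∈ (Finset.range (2 * s)).filter fun k => k + 1 ≤ 2 * s,
      (∑ S ∈ Finset.univ.powersetCard s, ∑ T ∈ (Finset.univ.powersetCard k).filter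
        (fun T : Finset V => Disjoint S T),
        ∑ E ∈ (crossPairs S (S ∪ T)).powersetCard (s + k + 2),
        prob p ({ω | ∀ e ∈ E, ω e = true} ∩
          ({ω | ∀ e ∈ crossPairs S (B \ (S ∪ T)), ω e = false} ∩ degEvent B K))) ≤
        400 * Real.exp 1 ^ 2 * (s ^ 2 * (1 / 4) ^ s) / n ^ 2 * prob p (degEvent B K) := by
    intro s hs k hk
    have hs' := (Finset.mem_filter.mp hs).2
    have hk' := (Finset.mem_filter.mp hk).2
    set τ : ℝ := p ^ (s + k + 2) * Real.exp (-(p * (s * (B.card - s - k)))) *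
      (10 / 9) ^ (s + k) with hτ
    have hτ0 : 0 ≤ τ := by positivity
    calc _ ≤ ∑ S ∈ (Finset.univ : Finset V).powersetCard s,
          ∑ T ∈ ((Finset.univ.powersetCard k).filter fun T : Finset V => Disjoint S T),
            ((s * (s + k)).choose (s + k + 2) : ℝ) * (τ * prob p (degEvent B K)) := by
          refine Finset.sum_le_sum fun S hS => Finset.sum_le_sum fun T hT => ?_
          have hSc := (Finset.mem_powersetCard.mp hS).2
          have hTc := (Finset.mem_powersetCard.mp (Finset.mem_filter.mp hT).1).2
          have hd := (Finset.mem_filter.mp hT).2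
          have hcp : (crossPairs S (S ∪ T)).card ≤ s * (s + k) := by
            refine Finset.card_image_le.trans ?_
            rw [Finset.card_product, hSc]
            exact Nat.mul_le_mul_left s ((Finset.card_union_le S T).trans (by rw [hSc, hTc]))
          calc _ ≤ ∑ E ∈ (crossPairs S (S ∪ T)).powersetCard (s + k + 2),
                τ * prob p (degEvent B K) := by
                refine Finset.sum_le_sum fun E hE => ?_
                obtain ⟨hE1, hE2⟩ := Finset.mem_powersetCard.mp hE
                have := prob_spot_le (K := K) h0 h1 hc hn4 hB hd hE1
                rwa [hE2, hSc, hTc] at this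
            _ ≤ _ := by
                rw [Finset.sum_const, Finset.card_powersetCard, nsmul_eq_mul]
                gcongr
      _ ≤ ∑ S ∈ (Finset.univ : Finset V).powersetCard s,
          (n.choose k : ℝ) * (((s * (s + k)).choose (s + k + 2) : ℝ) *
            (τ * prob p (degEvent B K))) := by
          refine Finset.sum_le_sum fun S _ => ?_
          rw [Finset.sum_const, nsmul_eq_mul]
          gcongr
          refine (Finset.card_filter_le _ _).trans (le_of_eq ?_)
          rw [Finset.card_powersetCard, Finset.card_univ]
      _ = ((n.choose s : ℝ) * (n.choose k * ((s * (s + k)).choose (s + k + 2) * τ))) *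
            prob p (degEvent B K) := by
          rw [Finset.sum_const, Finset.card_powersetCard, nsmul_eq_mul, Finset.card_univ]
          ring
      _ ≤ _ := by
          refine mul_le_mul_of_nonneg_right ?_ hD
          exact dense_spot_term h0 hc hs' hk' hB le_rfl
  refine (Finset.sum_le_sum fun s hs => Finset.sum_le_sum (hinner s hs)).trans ?_
  have hsm : Summable fun s : ℕ => (s : ℝ) ^ 3 * (1 / 4 : ℝ) ^ s :=
    summable_pow_mul_geometric_of_norm_lt_one 3 (by norm_num)
  calc _ ≤ ∑ s ∈ (Finset.range (n + 1)).filter fun s : ℕ => (s : ℝ) < 0.075 * n,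
        (800 * Real.exp 1 ^ 2 / n ^ 2 * prob p (degEvent B K)) * ((s : ℝ) ^ 3 * (1 / 4) ^ s) := by
        refine Finset.sum_le_sum fun s _ => ?_
        rw [Finset.sum_const, nsmul_eq_mul]
        have hcard : ((((Finset.range (2 * s)).filter fun k => k + 1 ≤ 2 * s).card : ℕ) : ℝ) ≤
            2 * s := by
          have := Finset.card_filter_le (Finset.range (2 * s)) fun k => k + 1 ≤ 2 * s
          rw [Finset.card_range] at this
          exact_mod_cast this
        calc _ ≤ (2 * s : ℝ) * (400 * Real.exp 1 ^ 2 * (s ^ 2 * (1 / 4) ^ s) / n ^ 2 *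
              prob p (degEvent B K)) := by gcongr
          _ = _ := by ring
    _ ≤ (800 * Real.exp 1 ^ 2 / n ^ 2 * prob p (degEvent B K)) *
          ∑' s : ℕ, (s : ℝ) ^ 3 * (1 / 4) ^ s := by
        rw [← Finset.mul_sum]
        gcongr
        exact hsm.sum_le_tsum _ fun s _ => by positivity
    _ = _ := by unfold spotConst; ring

/-- The constant in the estimate for atypical configurations. -/
noncomputable def typicalConst : ℝ :=
  2 * (2 / 0.01 ^ 2) + 2 / 0.002 ^ 2 + 2 / (1e-6) ^ 2 + spotConst

/-- Apart from `smallEvent` all properties are increasing, so their unconditional failure bounds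
survive the conditioning; `smallEvent` was estimated jointly with the degree event. -/
theorem prob_typical_compl (h0 : 0 ≤ p) (h1 : p ≤ 1) (hc : 20 ≤ p * Fintype.card V)
    (hn4 : (10 : ℝ) ^ 4 ≤ Fintype.card V) (hB : 0.998 * (Fintype.card V : ℝ) ≤ B.card) :
    prob p (degEvent B K ∩ (typical p B K)ᶜ) ≤
      typicalConst / (Fintype.card V : ℝ) ^ 2 * prob p (degEvent B K) := by
  set D := degEvent B K
  have hn0 : (0 : ℝ) < Fintype.card V := lt_of_lt_of_le (by norm_num) hn4
  have hD := prob_nonneg h0 h1 D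
  have hup : IsUpperSet D := isUpperSet_degEvent B K
  have hsub : D ∩ (typical p B K)ᶜ ⊆ (((bigEvent B K)ᶜ ∩ D ∪ (hugeEvent B K)ᶜ ∩ D) ∪
      ((lowEvent B)ᶜ ∩ D ∪ (edgeEvent p B)ᶜ ∩ D)) ∪ (smallEvent B K)ᶜ ∩ D := by
    rintro ω ⟨hωD, hω⟩
    simp only [typical, Set.mem_compl_iff, Set.mem_inter_iff, Set.mem_union] at hω ⊢
    tauto
  have hu1 := prob_union_le h0 h1 (((bigEvent B K)ᶜ ∩ D ∪ (hugeEvent B K)ᶜ ∩ D) ∪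
      ((lowEvent B)ᶜ ∩ D ∪ (edgeEvent p B)ᶜ ∩ D)) ((smallEvent B K)ᶜ ∩ D)
  have hu2 := prob_union_le h0 h1 ((bigEvent B K)ᶜ ∩ D ∪ (hugeEvent B K)ᶜ ∩ D)
      ((lowEvent B)ᶜ ∩ D ∪ (edgeEvent p B)ᶜ ∩ D)
  have hu3 := prob_union_le h0 h1 ((bigEvent B K)ᶜ ∩ D) ((hugeEvent B K)ᶜ ∩ D)
  have hu4 := prob_union_le h0 h1 ((lowEvent B)ᶜ ∩ D) ((edgeEvent p B)ᶜ ∩ D)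
  have g : ∀ {A : Set (Sym2 V → Bool)} {κ : ℝ}, 0 < κ → IsUpperSet A →
      prob p Aᶜ ≤ Real.exp (-(κ * Fintype.card V)) →
      prob p (Aᶜ ∩ D) ≤ 2 / κ ^ 2 / (Fintype.card V : ℝ) ^ 2 * prob p D := fun hκ hA h =>
    (prob_inter_le_mul h0 h1 hA.compl hup).trans
      (mul_le_mul_of_nonneg_right (h.trans (exp_neg_le_div_sq hκ hn0)) hD)
  have b1 := g (by norm_num) (isUpperSet_bigEvent B K) (prob_bigEvent_compl h0 h1 hc)
  have b2 := g (by norm_num) (isUpperSet_hugeEvent B K) (prob_hugeEvent_compl h0 h1 hc hn4)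
  have b3 := g (by norm_num) (isUpperSet_lowEvent B) (prob_lowEvent_compl h0 h1 hc hn4 hB)
  have b4 := g (by norm_num) (isUpperSet_edgeEvent p B) (prob_edgeEvent_compl h0 h1 hc hn4 hB)
  have b5 := prob_smallEvent_compl (K := K) h0 h1 hc hn4 hB
  have hm := prob_mono h0 h1 hsub
  have hfin : typicalConst / (Fintype.card V : ℝ) ^ 2 * prob p D =
      2 / 0.01 ^ 2 / (Fintype.card V : ℝ) ^ 2 * prob p D +
      2 / 0.01 ^ 2 / (Fintype.card V : ℝ) ^ 2 * prob p D +
      2 / 0.002 ^ 2 / (Fintype.card V : ℝ) ^ 2 * prob p D +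
      2 / (1e-6) ^ 2 / (Fintype.card V : ℝ) ^ 2 * prob p D +
      spotConst / (Fintype.card V : ℝ) ^ 2 * prob p D := by
    unfold typicalConst
    ring
  rw [hfin]
  linarith

end Spots

/-! ### Peeling: a small core forces a set with few outer neighbours -/

section Peeling

variable {V : Type*} [DecidableEq V]

/-- A set `R` of removed vertices all of whose neighbours outside `R` lie in a small set `Y`, each
of whose elements has a neighbour in `R`. -/
structure Peeled (G : SimpleGraph V) (R Y : Finset V) : Prop where
  disj : Disjoint R Y
  card_le : Y.card ≤ 3 * R.card
  closed : ∀ u ∈ R, ∀ v, G.Adj u v → v ∈ R ∪ Y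
  touch : ∀ y ∈ Y, ∃ u ∈ R, G.Adj u y

/-- The vertex `v` may come from `Y`, hence the erasure. One vertex enters `R` and at most three
enter `Y`, which keeps the ratio. -/
theorem Peeled.step {G : SimpleGraph V} {R Y A : Finset V} (h : Peeled G R Y) {v : V} (hvR : v ∉ R)
    (hA : ∀ w, w ∈ A ↔ w ∉ R ∪ Y ∧ G.Adj v w) (hAc : A.card ≤ 3) :
    Peeled G (insert v R) (Y.erase v ∪ A) where
  disj := by
    rw [Finset.disjoint_left]
    intro x hx hx'
    rcases Finset.mem_insert.mp hx with rfl | hxR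
    · rcases Finset.mem_union.mp hx' with h' | h'
      · exact Finset.notMem_erase _ _ h'
      · exact G.loopless.irrefl _ ((hA _).mp h').2
    · rcases Finset.mem_union.mp hx' with h' | h'
      · exact Finset.disjoint_left.mp h.disj hxR (Finset.mem_of_mem_erase h')
      · exact ((hA _).mp h').1 (Finset.mem_union_left _ hxR)
  card_le := by
    rw [Finset.card_insert_of_notMem hvR]
    have h1 := Finset.card_union_le (Y.erase v) A
    have h2 := Finset.card_erase_le (s := Y) (a := v)
    have h3 := h.card_le
    omega
  closed := by
    have key : ∀ w, w ∈ R ∪ Y ∨ w ∈ A → w ∈ insert v R ∪ (Y.erase v ∪ A) := by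
      intro w hw
      simp only [Finset.mem_union, Finset.mem_insert, Finset.mem_erase] at hw ⊢
      by_cases hwv : w = v
      · exact Or.inl (Or.inl hwv)
      · tauto
    intro u hu w huw
    refine key w ?_
    rcases Finset.mem_insert.mp hu with rfl | huR
    · by_cases hw : w ∈ R ∪ Y
      · exact Or.inl hw
      · exact Or.inr ((hA w).mpr ⟨hw, huw⟩)
    · exact Or.inl (h.closed u huR w huw)
  touch := by
    intro y hy
    rcases Finset.mem_union.mp hy with hy | hy
    · obtain ⟨u, hu, huy⟩ := h.touch y (Finset.mem_of_mem_erase hy)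
      exact ⟨u, Finset.mem_insert_of_mem hu, huy⟩
    · exact ⟨v, Finset.mem_insert_self v R, ((hA y).mp hy).2⟩

/-- Either the strong `4`-core misses few vertices or a peeled set of size `r` exists. -/
theorem exists_peeled [Fintype V] (G : SimpleGraph V) (r : ℕ) :
    (∃ Z : Finset V, Z.card ≤ 4 * r ∧ ∀ v, v ∉ Z → v ∈ black G) ∨
      ∃ R Y : Finset V, R.card = r ∧ Peeled G R Y := by
  classical
  induction r with
  | zero => exact Or.inr ⟨∅, ∅, rfl, by simp, by simp, by simp, by simp⟩
  | succ r ih =>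
    rcases ih with ⟨Z, hZ, h⟩ | ⟨R, Y, hR, h⟩
    · exact Or.inl ⟨Z, by omega, h⟩
    -- If the complement of `R ∪ Y` is strong, it lies in the core. Otherwise some vertex of its
    -- closed neighbourhood has at most three neighbours in it; that vertex is not in `R`, whose
    -- neighbours all lie in `R ∪ Y`, so it can be peeled.
    by_cases hS : HasStrongProperty G 4 {v | v ∉ R ∪ Y}
    · refine Or.inl ⟨R ∪ Y, ?_, fun v hv => ⟨_, hS, hv⟩⟩
      have h1 := Finset.card_union_le R Y
      have h2 := h.card_le
      omega
    · unfold HasStrongProperty at hS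
      push Not at hS
      obtain ⟨v, hv, hcard⟩ := hS
      have hvR : v ∉ R := by
        intro hvR
        rcases hv with hv | ⟨-, u, hu, huv⟩
        · exact hv (Finset.mem_union_left _ hvR)
        · exact hu (h.closed v hvR u huv.symm)
      set A : Finset V := Finset.univ.filter fun w => w ∉ R ∪ Y ∧ G.Adj v w with hAdef
      have hAset : G.neighborSet v ∩ {v | v ∉ R ∪ Y} = (A : Set V) := by
        ext w
        simp [hAdef, and_comm]
      rw [hAset, Set.encard_coe_eq_coe_finsetCard] at hcard
      have hAc : A.card < 4 := by exact_mod_cast hcard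
      exact Or.inr ⟨_, _, by rw [Finset.card_insert_of_notMem hvR, hR],
        h.step (A := A) hvR (fun w => by simp [hAdef]) (by omega)⟩

end Peeling

/-! ### The first moment for peeled sets -/

section PeelingEstimate

theorem peeling_rate {c : ℝ} (hc : 20 ≤ c) :
    Real.exp 1 * 2400 * (c * Real.exp 1 / 3) ^ 3 * Real.exp (-(0.998 * c)) ≤ 1 / 4 := by
  have h1 : c ≤ 20 * Real.exp ((c - 20) / 20) := by
    have := Real.add_one_le_exp ((c - 20) / 20)
    linarith
  have h3 : c ^ 3 ≤ 8000 * Real.exp (0.15 * (c - 20)) := by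
    calc c ^ 3 ≤ (20 * Real.exp ((c - 20) / 20)) ^ 3 := pow_le_pow_left₀ (by linarith) h1 3
      _ = 8000 * Real.exp (0.15 * (c - 20)) := by
        rw [mul_pow, ← Real.exp_nat_mul]
        norm_num
        ring
  have h4 : (2844448 : ℝ) * Real.exp (-(15 : ℕ)) ≤ 1 := by
    rw [Real.exp_neg, ← div_eq_mul_inv, div_le_one (Real.exp_pos _)]
    exact le_trans (by norm_num) (natCast_exp_le 15)
  calc Real.exp 1 * 2400 * (c * Real.exp 1 / 3) ^ 3 * Real.exp (-(0.998 * c))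
      = (2400 / 27) * c ^ 3 * Real.exp 1 ^ 4 * Real.exp (-(0.998 * c)) := by ring
    _ ≤ (2400 / 27) * (8000 * Real.exp (0.15 * (c - 20))) * Real.exp 1 ^ 4 *
          Real.exp (-(0.998 * c)) := by gcongr
    _ = (2400 / 27 * 8000) * Real.exp (-(15.96 + 0.848 * (c - 20))) := by
        have : Real.exp (0.15 * (c - 20)) * Real.exp 1 ^ 4 * Real.exp (-(0.998 * c)) =
            Real.exp (-(15.96 + 0.848 * (c - 20))) := by
          rw [← Real.exp_nat_mul, ← Real.exp_add, ← Real.exp_add]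
          congr 1
          push_cast
          ring
        linear_combination (2400 / 27 * 8000) * this
    _ ≤ (2400 / 27 * 8000) * Real.exp (-(15 : ℕ)) := by
        gcongr
        push_cast
        linarith
    _ ≤ 1 / 4 := by
        have h5 := Real.exp_pos (-((15 : ℕ) : ℝ))
        generalize Real.exp (-((15 : ℕ) : ℝ)) = x at h4 h5 ⊢
        linarith

/-- Per vertex of `R`: `2400 e` for choosing `R`, `(c e / 3) ^ 3` for choosing `Y` and its edges to
`R`, uniformly in `y ≤ 3 r`, and `exp (-0.998 c)` for the missing edges. -/
theorem peeling_term {n r y : ℕ} {p : ℝ} (h0 : 0 ≤ p) (hc : 20 ≤ p * n) (hr : 1 ≤ r)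
    (hn : (n : ℝ) ≤ 2400 * r) (hrn : 4 * r ≤ 0.002 * (n : ℝ)) (hy : y ≤ 3 * r) :
    (n.choose r : ℝ) * (n.choose y * ((r * p) ^ y * Real.exp (-(p * (r * (n - r - y)))))) ≤
      (1 / 4) ^ r := by
  have hr0 : (0 : ℝ) < r := by exact_mod_cast hr
  have hy' : (y : ℝ) ≤ 3 * r := by exact_mod_cast hy
  set c := p * n with hcdef
  have a1 : (n.choose r : ℝ) ≤ (Real.exp 1 * 2400) ^ r := choose_le_of_le_mul hn
  have a2 : (n.choose y : ℝ) ≤ (n : ℝ) ^ y / y.factorial := Nat.choose_le_pow_div y n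
  have a3 : (c * r) ^ y / (y.factorial : ℝ) ≤ ((c * Real.exp 1 / 3) ^ 3) ^ r := by
    refine (pow_div_factorial_le (t := 3 * r) (m := 3 * r) (by push_cast; ring) hy
      (by positivity) (by nlinarith)).trans (le_of_eq ?_)
    rw [pow_mul]
    congr 2
    field_simp
  have a4 : Real.exp (-(p * (r * (n - r - y)))) ≤ Real.exp (-(0.998 * c)) ^ r := by
    rw [← Real.exp_nat_mul]
    refine Real.exp_le_exp.mpr ?_
    have h1 : 0.998 * (n : ℝ) ≤ n - r - y := by linarith
    have h2 : p * (r * (0.998 * n)) ≤ p * (r * (n - r - y)) := by gcongr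
    have h3 : p * (r * (0.998 * n)) = r * (0.998 * c) := by rw [hcdef]; ring
    linarith
  have hc0 : 0 ≤ c := by linarith
  calc _ ≤ (Real.exp 1 * 2400) ^ r * ((n : ℝ) ^ y / y.factorial * ((r * p) ^ y *
        Real.exp (-(0.998 * c)) ^ r)) := by gcongr
    _ = (Real.exp 1 * 2400) ^ r * ((c * r) ^ y / (y.factorial : ℝ)) *
        Real.exp (-(0.998 * c)) ^ r := by
        have : (n : ℝ) ^ y * (r * p) ^ y = (c * r) ^ y := by
          rw [← mul_pow, hcdef]
          congr 1
          ring
        rw [← this]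
        ring
    _ ≤ (Real.exp 1 * 2400) ^ r * ((c * Real.exp 1 / 3) ^ 3) ^ r *
        Real.exp (-(0.998 * c)) ^ r := by gcongr
    _ = (Real.exp 1 * 2400 * (c * Real.exp 1 / 3) ^ 3 * Real.exp (-(0.998 * c))) ^ r := by
        rw [← mul_pow, ← mul_pow]
    _ ≤ (1 / 4) ^ r := pow_le_pow_left₀ (by positivity) (peeling_rate hc) r

theorem cube_le_four_pow (r : ℕ) : r ^ 3 ≤ 4 ^ r := by
  induction r with
  | zero => norm_num
  | succ r ih =>
    rcases Nat.lt_or_ge r 2 with h | h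
    · interval_cases r <;> norm_num
    · calc (r + 1) ^ 3 ≤ 4 * r ^ 3 := by nlinarith [sq_nonneg ((r : ℤ)), mul_le_mul h h (by omega) (by omega)]
        _ ≤ 4 * 4 ^ r := by omega
        _ = 4 ^ (r + 1) := by ring

variable {V : Type*} [Fintype V] [DecidableEq V] {p : ℝ}

/-- The vertices of `Y` touch `R` through disjoint sets of pairs, which also avoid the pairs from
`R` to the rest; so all these requirements are independent. -/
theorem prob_peeled_le (h0 : 0 ≤ p) (h1 : p ≤ 1) {R Y : Finset V} (hd : Disjoint R Y) :
    prob p {ω | Peeled (toGraph ω) R Y} ≤ (R.card * p) ^ Y.card *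
      Real.exp (-(p * (R.card * (Fintype.card V - R.card - Y.card)))) := by
  set W := Finset.univ \ (R ∪ Y) with hW
  have hRW : Disjoint R W := Finset.disjoint_left.mpr fun x hx hx' =>
    (Finset.mem_sdiff.mp hx').2 (Finset.mem_union_left _ hx)
  let A : V → Set (Sym2 V → Bool) := fun y => {ω | ∃ u ∈ R, ω s(u, y) = true}
  have hA : ∀ y, DeterminedBy (A y) (crossPairs R {y} : Finset (Sym2 V)) := fun y ω ω' h => by
    refine exists_congr fun u => and_congr_right fun hu => ?_
    rw [h s(u, y) (by exact_mod_cast mem_crossPairs.mpr ⟨u, hu, y, by simp, rfl⟩)]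
  have hsub : {ω | Peeled (toGraph ω) R Y} ⊆ {ω | ∀ y ∈ Y, ω ∈ A y} ∩
      {ω | ∀ e ∈ crossPairs R W, ω e = false} := by
    refine fun ω hω => ⟨fun y hy => ?_, fun e he => ?_⟩
    · obtain ⟨u, hu, huy⟩ := hω.touch y hy
      exact ⟨u, hu, huy.2⟩
    · obtain ⟨u, hu, w, hw, rfl⟩ := mem_crossPairs.mp he
      by_contra hce
      have hw' := (Finset.mem_sdiff.mp hw).2
      refine hw' (hω.closed u hu w ⟨fun h => hw' ?_, by simpa using hce⟩)
      exact h ▸ Finset.mem_union_left _ hu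
  have hcross : ∀ {a b c d : V}, a ∈ R → c ∈ R → b ∉ R → s(a, b) = s(c, d) → b = d := by
    intro a b c d ha hc hb heq
    rcases Sym2.eq_iff.mp heq with ⟨_, h⟩ | ⟨_, h⟩
    · exact h
    · exact absurd (h ▸ hc) hb
  have hYR : ∀ y ∈ Y, y ∉ R := fun y hy hyR => Finset.disjoint_left.mp hd hyR hy
  have hind := prob_indep (p := p) (A := {ω | ∀ y ∈ Y, ω ∈ A y}) (S := (crossPairs R Y : Set _))
    (fun ω ω' h => forall₂_congr fun y hy => hA y ω ω' fun e he => h e (by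
      obtain ⟨u, hu, w, hw, rfl⟩ := mem_crossPairs.mp (Finset.mem_coe.mp he)
      exact Finset.mem_coe.mpr (mem_crossPairs.mpr
        ⟨u, hu, w, by rw [Finset.mem_singleton.mp hw]; exact hy, rfl⟩)))
    (determinedBy_all (crossPairs R W) false) (by
      rw [Set.disjoint_left]
      intro e he he'
      obtain ⟨u, hu, w, hw, rfl⟩ := mem_crossPairs.mp (Finset.mem_coe.mp he)
      obtain ⟨u', hu', w', hw', heq⟩ := mem_crossPairs.mp (Finset.mem_coe.mp he')
      obtain rfl := hcross hu hu' (hYR w hw) heq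
      exact (Finset.mem_sdiff.mp hw').2 (Finset.mem_union_right _ hw))
  have hprod := prob_iInter_indep (p := p) Y A (fun y => (crossPairs R {y} : Finset (Sym2 V)))
    (fun y _ => hA y) (by
      intro y hy y' hy' hne
      rw [Set.disjoint_left]
      intro e he he'
      obtain ⟨u, hu, w, hw, rfl⟩ := mem_crossPairs.mp (Finset.mem_coe.mp he)
      obtain ⟨u', hu', w', hw', heq⟩ := mem_crossPairs.mp (Finset.mem_coe.mp he')
      obtain rfl := Finset.mem_singleton.mp hw
      obtain rfl := Finset.mem_singleton.mp hw'
      exact hne (hcross hu hu' (hYR w hy) heq))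
  have hAy : ∀ y, prob p (A y) ≤ R.card * p := by
    intro y
    refine (prob_le_sum h0 h1 R (A y) (fun u => {ω | ω s(u, y) = true})
      fun ω hω => hω).trans (le_of_eq ?_)
    simp only [prob_coord_true, Finset.sum_const, nsmul_eq_mul]
  have hfalse : prob p {ω : Sym2 V → Bool | ∀ e ∈ crossPairs R W, ω e = false} ≤
      Real.exp (-(p * (R.card * (Fintype.card V - R.card - Y.card)))) := by
    rw [prob_all_false, card_crossPairs hRW]
    refine (one_sub_pow_le h1 _).trans (Real.exp_le_exp.mpr (neg_le_neg ?_))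
    push_cast
    have hc1 : Fintype.card V ≤ W.card + (R.card + Y.card) := by
      have h2 := Finset.le_card_sdiff (R ∪ Y) (Finset.univ : Finset V)
      have h3 := Finset.card_union_le R Y
      rw [Finset.card_univ, ← hW] at h2
      omega
    have hc2 : (Fintype.card V : ℝ) ≤ W.card + (R.card + Y.card) := by exact_mod_cast hc1
    have : (Fintype.card V : ℝ) - R.card - Y.card ≤ W.card := by linarith
    gcongr
  refine (prob_mono h0 h1 hsub).trans (hind.le.trans ?_)
  rw [hprod]
  refine mul_le_mul ?_ hfalse (prob_nonneg h0 h1 _) (by positivity)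
  rw [← Finset.prod_const]
  exact Finset.prod_le_prod (fun y _ => prob_nonneg h0 h1 _) fun y _ => hAy y

/-- With high probability the strong `4`-core misses few vertices. -/
theorem prob_core_small_le (h0 : 0 ≤ p) (h1 : p ≤ 1) (hc : 20 ≤ p * Fintype.card V)
    (hn4 : (10 : ℝ) ^ 4 ≤ Fintype.card V) :
    prob p {ω : Sym2 V → Bool | ¬ ∃ B : Finset V, 0.998 * (Fintype.card V : ℝ) ≤ B.card ∧
      ∀ v ∈ B, v ∈ black (toGraph ω)} ≤ 23040000 / (Fintype.card V : ℝ) ^ 2 := by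
  classical
  set n := Fintype.card V with hn
  -- Gives `4 r ≤ 0.002 n`; for `n ≥ 10 ^ 4` rounding costs little enough that `n ≤ 2400 r`.
  set r := n / 2000 with hrdef
  have hn4' : 10 ^ 4 ≤ n := by exact_mod_cast hn4
  have hr : 1 ≤ r := by omega
  have hr0 : (0 : ℝ) < r := by exact_mod_cast hr
  have hnr : (n : ℝ) ≤ 2400 * r := by exact_mod_cast (by omega : n ≤ 2400 * r)
  have hrn : 4 * r ≤ 0.002 * (n : ℝ) := by
    have : ((2000 * r : ℕ) : ℝ) ≤ n := by exact_mod_cast (by omega : 2000 * r ≤ n)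
    push_cast at this
    linarith
  let I : Finset (Σ _ : Finset V, Σ _ : ℕ, Finset V) :=
    (Finset.univ.powersetCard r).sigma fun R : Finset V =>
      (Finset.range (3 * r + 1)).sigma fun y : ℕ =>
        (Finset.univ.powersetCard y).filter fun Y : Finset V => Disjoint R Y
  have hsum := prob_le_sum h0 h1 I {ω : Sym2 V → Bool | ¬ ∃ B : Finset V,
      0.998 * (n : ℝ) ≤ B.card ∧ ∀ v ∈ B, v ∈ black (toGraph ω)}
    (fun x => {ω | Peeled (toGraph ω) x.1 x.2.2}) (by
    intro ω hω
    rcases exists_peeled (toGraph ω) r with ⟨Z, hZ, h⟩ | ⟨R, Y, hR, h⟩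
    · refine absurd ⟨Finset.univ \ Z, ?_, fun v hv => h v (Finset.mem_sdiff.mp hv).2⟩ hω
      have h2 := Finset.le_card_sdiff Z (Finset.univ : Finset V)
      rw [Finset.card_univ] at h2
      have h3 : n ≤ (Finset.univ \ Z).card + 4 * r := by omega
      have h4 : (n : ℝ) ≤ (Finset.univ \ Z).card + 4 * r := by exact_mod_cast h3
      linarith
    · refine ⟨⟨R, Y.card, Y⟩, ?_, h⟩
      simp only [I, Finset.mem_sigma, Finset.mem_filter, Finset.mem_range,
        Finset.mem_powersetCard, Finset.subset_univ, true_and]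
      have := h.card_le
      exact ⟨hR, by omega, h.disj⟩)
  refine hsum.trans ?_
  simp only [I, Finset.sum_sigma]
  rw [Finset.sum_comm' (t' := Finset.range (3 * r + 1))
    (s' := fun _ => (Finset.univ : Finset V).powersetCard r) (by simp)]
  have hinner : ∀ y ∈ Finset.range (3 * r + 1),
      (∑ R ∈ (Finset.univ : Finset V).powersetCard r,
        ∑ Y ∈ (Finset.univ.powersetCard y).filter (fun Y : Finset V => Disjoint R Y),
          prob p {ω | Peeled (toGraph ω) R Y}) ≤ (1 / 4) ^ r := by
    intro y hy
    set τ : ℝ := (r * p) ^ y * Real.exp (-(p * (r * (n - r - y)))) with hτ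
    have hτ0 : 0 ≤ τ := by positivity
    calc _ ≤ ∑ R ∈ (Finset.univ : Finset V).powersetCard r,
          ∑ Y ∈ ((Finset.univ.powersetCard y).filter fun Y : Finset V => Disjoint R Y), τ := by
          refine Finset.sum_le_sum fun R hR => Finset.sum_le_sum fun Y hY => ?_
          have hRc := (Finset.mem_powersetCard.mp hR).2
          have hYc := (Finset.mem_powersetCard.mp (Finset.mem_filter.mp hY).1).2
          have := prob_peeled_le h0 h1 (Finset.mem_filter.mp hY).2
          rwa [hRc, hYc] at this
      _ ≤ ∑ R ∈ (Finset.univ : Finset V).powersetCard r, (n.choose y : ℝ) * τ := by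
          refine Finset.sum_le_sum fun R _ => ?_
          rw [Finset.sum_const, nsmul_eq_mul]
          gcongr
          refine (Finset.card_filter_le _ _).trans (le_of_eq ?_)
          rw [Finset.card_powersetCard, Finset.card_univ]
      _ = (n.choose r : ℝ) * (n.choose y * τ) := by
          rw [Finset.sum_const, Finset.card_powersetCard, nsmul_eq_mul, Finset.card_univ]
      _ ≤ _ := peeling_term h0 hc hr hnr hrn (by rw [Finset.mem_range] at hy; omega)
  refine (Finset.sum_le_sum hinner).trans ?_
  rw [Finset.sum_const, nsmul_eq_mul, Finset.card_range, le_div_iff₀ (by positivity)]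
  have h3 : (r : ℝ) ^ 3 ≤ 4 ^ r := by exact_mod_cast cube_le_four_pow r
  have h4 : ((1 : ℝ) / 4) ^ r * 4 ^ r = 1 := by rw [← mul_pow]; norm_num
  have hr1 : (1 : ℝ) ≤ r := by exact_mod_cast hr
  calc ((3 * r + 1 : ℕ) : ℝ) * (1 / 4) ^ r * (n : ℝ) ^ 2
      ≤ (4 * r) * (1 / 4) ^ r * (2400 * r) ^ 2 := by
        gcongr
        push_cast
        linarith
    _ = 23040000 * ((1 / 4) ^ r * (r : ℝ) ^ 3) := by ring
    _ ≤ 23040000 * ((1 / 4) ^ r * 4 ^ r) := by gcongr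
    _ = 23040000 := by rw [h4, mul_one]

end PeelingEstimate

/-! ### Stability of the core under resampling -/

section CoreStability

variable {V : Type*}

/-- Changing edges between the strong `4`-core and its closed neighbourhood does not change the
core as long as every vertex of the closed neighbourhood keeps four neighbours in it. -/
theorem black_blue_eq_of_agree {G G' : SimpleGraph V}
    (h : ∀ u v, u ∉ black G ∪ blue G ∨ (u ∉ black G ∧ v ∉ black G) → (G.Adj u v ↔ G'.Adj u v))
    (hdeg : ∀ v ∈ black G ∪ blue G, ((4 : ℕ) : ℕ∞) ≤ (G'.neighborSet v ∩ black G).encard) :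
    black G' = black G ∧ blue G' = blue G := by
  have hblue : outerNeighbors G' (black G) = blue G := by
    ext v
    constructor
    · rintro ⟨hv, u, hu, huv⟩
      by_contra hvL
      have := h v u (Or.inl fun hc => hc.elim hv hvL)
      exact hvL ⟨hv, u, hu, (this.mpr huv.symm).symm⟩
    · intro hv
      refine ⟨hv.1, ?_⟩
      have h4 := hdeg v (Or.inr hv)
      have hne : (G'.neighborSet v ∩ black G).Nonempty := by
        rw [← Set.encard_pos]
        exact lt_of_lt_of_le (by norm_num) h4
      obtain ⟨u, huv, hu⟩ := hne
      exact ⟨u, hu, huv.symm⟩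
  have hsub : black G ⊆ black G' :=
    (isGreatest_strongCore G' 4).2 fun v hv => hdeg v (by rwa [hblue] at hv)
  -- Vertices of the old closed neighbourhood have four neighbours already in the old core; all
  -- others have the same neighbours in both graphs.
  have hstrong : HasStrongProperty G 4 (black G') := by
    intro v hv
    by_cases hvB : v ∈ black G ∪ blue G
    · exact ((isGreatest_strongCore G 4).1 v hvB).trans
        (Set.encard_le_encard (Set.inter_subset_inter_right _ hsub))
    · have hagree : ∀ w, G.Adj v w ↔ G'.Adj v w := fun w => h v w (Or.inl hvB)
      have hv' : v ∈ black G' ∪ outerNeighbors G' (black G') := by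
        rcases hv with hv | ⟨hv, u, hu, huv⟩
        · exact Or.inl hv
        · exact Or.inr ⟨hv, u, hu, ((hagree u).mp huv.symm).symm⟩
      have hnb : G.neighborSet v = G'.neighborSet v := Set.ext hagree
      rw [hnb]
      exact (isGreatest_strongCore G' 4).1 v hv'
  have heq : black G' = black G :=
    ((isGreatest_strongCore G 4).2 hstrong).antisymm hsub
  exact ⟨heq, by rw [← hblue, ← heq]; rfl⟩

end CoreStability

/-! ### Conditioning on the classes of a partition -/

section Partition

variable {E : Type*} [Fintype E] [DecidableEq E] {p : ℝ}

/-- A conditional bound on the classes of a partition gives an unconditional bound. -/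
theorem prob_le_of_partition (h0 : 0 ≤ p) (h1 : p ≤ 1)
    (cls : (E → Bool) → Set (E → Bool)) (hself : ∀ ω, ω ∈ cls ω)
    (heq : ∀ ω₀, ∀ ω ∈ cls ω₀, cls ω = cls ω₀) (A : Set (E → Bool)) {q : ℝ} (hq : 0 ≤ q)
    (h : ∀ ω₀ ∈ A, prob p (A ∩ cls ω₀) ≤ q * prob p (cls ω₀)) : prob p A ≤ q := by
  classical
  have hsplit : ∀ C : Set (E → Bool),
      prob p C = ∑ s ∈ Finset.univ.image cls, prob p (C ∩ s) := by
    intro C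
    unfold prob
    rw [← Finset.sum_fiberwise_of_maps_to (s := Finset.univ) (t := Finset.univ.image cls) (g := cls)
      (fun ω _ => Finset.mem_image_of_mem _ (Finset.mem_univ ω))]
    refine Finset.sum_congr rfl fun s hs => ?_
    obtain ⟨ω₀, -, rfl⟩ := Finset.mem_image.mp hs
    rw [Finset.sum_filter]
    refine Finset.sum_congr rfl fun ω _ => ?_
    by_cases hω : ω ∈ cls ω₀
    · simp [heq ω₀ ω hω, hω]
    · have : cls ω ≠ cls ω₀ := fun hc => hω (hc ▸ hself ω)
      simp [this, hω]
  have hall : ∀ ω₀, prob p (A ∩ cls ω₀) ≤ q * prob p (cls ω₀) := by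
    intro ω₀
    rcases (A ∩ cls ω₀).eq_empty_or_nonempty with he | ⟨ω, hωA, hω⟩
    · rw [he, prob_empty]
      exact mul_nonneg hq (prob_nonneg h0 h1 _)
    · rw [← heq ω₀ ω hω]
      exact h ω hωA
  rw [hsplit A]
  calc _ ≤ ∑ s ∈ Finset.univ.image cls, q * prob p s := by
        refine Finset.sum_le_sum fun s hs => ?_
        obtain ⟨ω₀, -, rfl⟩ := Finset.mem_image.mp hs
        exact hall ω₀
    _ = q * prob p (Set.univ : Set (E → Bool)) := by
        rw [← Finset.mul_sum, hsplit Set.univ]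
        simp only [Set.univ_inter]
    _ = q := by rw [prob_univ, mul_one]

end Partition

/-! ### Colour classes and the bound for the random core -/

section Classes

variable {V : Type*} [Fintype V] [DecidableEq V] {p : ℝ}

open Classical in
/-- The strong `4`-core as a finset. -/
noncomputable def blackSet (G : SimpleGraph V) : Finset V := Finset.univ.filter (· ∈ black G)

open Classical in
/-- The set of blue vertices as a finset. -/
noncomputable def blueSet (G : SimpleGraph V) : Finset V := Finset.univ.filter (· ∈ blue G)

theorem mem_blackSet {G : SimpleGraph V} {v : V} : v ∈ blackSet G ↔ v ∈ black G := by
  simp [blackSet]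

theorem mem_blueSet {G : SimpleGraph V} {v : V} : v ∈ blueSet G ↔ v ∈ blue G := by
  simp [blueSet]

/-- The configurations that agree with `ω` on all pairs but those that join the core to its closed
neighbourhood. -/
def agreeEvent (ω : Sym2 V → Bool) : Set (Sym2 V → Bool) :=
  {ω' | ∀ e, e ∉ crossPairs (blackSet (toGraph ω)) (blackSet (toGraph ω) ∪ blueSet (toGraph ω)) →
    ω' e = ω e}

/-- The configurations with the same colour classes as `ω` that agree with `ω` on all pairs but
those that join the core to its closed neighbourhood. -/
def colourClass (ω : Sym2 V → Bool) : Set (Sym2 V → Bool) :=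
  agreeEvent ω ∩ degEvent (blackSet (toGraph ω)) (blackSet (toGraph ω) ∪ blueSet (toGraph ω))

theorem encard_neighborSet_inter (ω : Sym2 V → Bool) (B : Finset V) (v : V) :
    ((toGraph ω).neighborSet v ∩ B).encard = (nbrs ω B v).card := by
  rw [← Set.encard_coe_eq_coe_finsetCard]
  congr 1
  ext w
  simp only [Set.mem_inter_iff, SimpleGraph.mem_neighborSet, Finset.mem_coe, mem_nbrs]
  tauto

theorem coe_blackSet (G : SimpleGraph V) : (blackSet G : Set V) = black G := by
  ext v
  exact mem_blackSet

theorem mem_union_colours {G : SimpleGraph V} {v : V} :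
    v ∈ blackSet G ∪ blueSet G ↔ v ∈ black G ∪ blue G := by
  rw [Finset.mem_union, mem_blackSet, mem_blueSet, Set.mem_union]

theorem mem_colourClass_self (ω : Sym2 V → Bool) : ω ∈ colourClass ω := by
  refine ⟨fun e _ => rfl, fun v hv => ?_⟩
  have := (isGreatest_strongCore (toGraph ω) 4).1 v (mem_union_colours.mp hv)
  change ((4 : ℕ) : ℕ∞) ≤ ((toGraph ω).neighborSet v ∩ black (toGraph ω)).encard at this
  rw [← coe_blackSet, encard_neighborSet_inter] at this
  exact_mod_cast this

theorem agree_of_mem_colourClass {ω ω' : Sym2 V → Bool} (h : ω' ∈ colourClass ω) {u v : V}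
    (huv : u ∉ black (toGraph ω) ∪ blue (toGraph ω) ∨
      (u ∉ black (toGraph ω) ∧ v ∉ black (toGraph ω))) :
    (toGraph ω).Adj u v ↔ (toGraph ω').Adj u v := by
  rw [toGraph_adj, toGraph_adj, h.1]
  intro hc
  obtain ⟨a, ha, b, hb, heq⟩ := mem_crossPairs.mp hc
  rw [mem_blackSet] at ha
  rw [mem_union_colours] at hb
  rcases Sym2.eq_iff.mp heq with ⟨rfl, rfl⟩ | ⟨rfl, rfl⟩
  · rcases huv with huv | huv
    · exact huv (Or.inl ha)
    · exact huv.1 ha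
  · rcases huv with huv | huv
    · exact huv hb
    · exact huv.2 ha

theorem colours_eq_of_mem_colourClass {ω ω' : Sym2 V → Bool} (h : ω' ∈ colourClass ω) :
    black (toGraph ω') = black (toGraph ω) ∧ blue (toGraph ω') = blue (toGraph ω) := by
  refine black_blue_eq_of_agree (fun u v huv => agree_of_mem_colourClass h huv) fun v hv => ?_
  rw [← coe_blackSet, encard_neighborSet_inter]
  exact_mod_cast h.2 v (mem_union_colours.mpr hv)

theorem sameRedBlue_of_mem_colourClass {ω ω' : Sym2 V → Bool} (h : ω' ∈ colourClass ω) :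
    SameRedBlue (toGraph ω) (toGraph ω') := by
  obtain ⟨h1, h2⟩ := colours_eq_of_mem_colourClass h
  exact ⟨h1.symm, h2.symm, fun u v hu hv => agree_of_mem_colourClass h (Or.inr ⟨hu, hv⟩)⟩

theorem colourClass_eq {ω ω' : Sym2 V → Bool} (h : ω' ∈ colourClass ω) :
    colourClass ω' = colourClass ω := by
  obtain ⟨h1, h2⟩ := colours_eq_of_mem_colourClass h
  have e1 : blackSet (toGraph ω') = blackSet (toGraph ω) := by
    ext v
    rw [mem_blackSet, mem_blackSet, h1]
  have e2 : blueSet (toGraph ω') = blueSet (toGraph ω) := by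
    ext v
    rw [mem_blueSet, mem_blueSet, h2]
  unfold colourClass agreeEvent
  rw [e1, e2]
  congr 1
  ext ω''
  exact forall₂_congr fun e he => by rw [h.1 e he]

/-- A cycle uses only matching pairs and edges from the core to `K`, exactly the pairs left free in
a colour class. -/
theorem Frame.determinedBy_ham (F : Frame V) {K : Finset V} (hKF : F.K ⊆ K) :
    DeterminedBy {ω | F.Ham (toGraph ω)} (crossPairs F.B K : Finset (Sym2 V)) := by
  have key : ∀ ω ω' : Sym2 V → Bool, (∀ e ∈ (crossPairs F.B K : Set (Sym2 V)), ω e = ω' e) →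
      F.Ham (toGraph ω) → F.Ham (toGraph ω') := by
    rintro ω ω' h ⟨l, u, x, hl, hK, hu, hx, hux, h3⟩
    have hlnk : ∀ a ∈ l, ∀ b ∈ l, F.Lnk (toGraph ω) a b → F.Lnk (toGraph ω') a b := by
      rintro a ha b hb (⟨hab, hB⟩ | hab)
      · refine Or.inl ⟨⟨hab.1, ?_⟩, hB⟩
        rw [← h s(a, b), hab.2]
        refine Finset.mem_coe.mpr (mem_crossPairs.mpr ?_)
        rcases hB with hB | hB
        · exact ⟨a, hB, b, hKF (hl.mem_K b hb), rfl⟩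
        · exact ⟨b, hB, a, hKF (hl.mem_K a ha), Sym2.eq_swap⟩
      · exact Or.inr hab
    exact ⟨l, u, x, ⟨hl.nodup, hl.mem_K, fun a b hab =>
      hlnk a hab.mem_left b hab.mem_right (hl.lnk a b hab), hl.closed⟩, hK, hu, hx,
      hlnk u (List.mem_of_mem_head? hu) x (List.mem_of_mem_getLast? hx) hux, h3⟩
  exact fun ω ω' h => ⟨key ω ω' h, key ω' ω fun e he => (h e he).symm⟩

theorem determinedBy_degEvent (B K : Finset V) :
    DeterminedBy (degEvent B K) (crossPairs B K : Finset (Sym2 V)) := by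
  intro ω ω' h
  refine forall₂_congr fun v hv => ?_
  have : nbrs ω B v = nbrs ω' B v := by
    refine Finset.filter_congr fun w hw => ?_
    rw [h s(v, w) (Finset.mem_coe.mpr (mem_crossPairs.mpr ⟨w, hw, v, hv, Sym2.eq_swap⟩))]
  rw [this]

/-- The Hamiltonicity bound, summed over the colour classes. -/
theorem prob_not_ham_of_large_core_le (h0 : 0 ≤ p) (h1 : p ≤ 1) (hc : 20 ≤ p * Fintype.card V)
    (hn4 : (10 : ℝ) ^ 4 ≤ Fintype.card V) (F : (Sym2 V → Bool) → Frame V)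
    (hFB : ∀ ω, (F ω).B = blackSet (toGraph ω))
    (hFK : ∀ ω, (F ω).K ⊆ blackSet (toGraph ω) ∪ blueSet (toGraph ω))
    (hF : ∀ ω, ∀ ω' ∈ colourClass ω, F ω' = F ω) :
    prob p {ω | 0.998 * (Fintype.card V : ℝ) ≤ (blackSet (toGraph ω)).card ∧
      ¬ (F ω).Ham (toGraph ω)} ≤ 168 * typicalConst / (Fintype.card V : ℝ) ^ 2 := by
  have hn0 : (0 : ℝ) < Fintype.card V := lt_of_lt_of_le (by norm_num) hn4
  have hq : 0 ≤ 168 * typicalConst / (Fintype.card V : ℝ) ^ 2 := by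
    have : 0 ≤ spotConst := by
      unfold spotConst
      exact mul_nonneg (by positivity) (tsum_nonneg fun s => by positivity)
    unfold typicalConst
    positivity
  refine prob_le_of_partition h0 h1 colourClass mem_colourClass_self
    (fun ω₀ ω h => colourClass_eq h) _ hq ?_
  rintro ω₀ ⟨hB, -⟩
  set K := blackSet (toGraph ω₀) ∪ blueSet (toGraph ω₀) with hK
  rw [← hFB ω₀] at hB
  have hBne : (F ω₀).B.Nonempty := by
    rw [← Finset.card_pos]
    have : (0 : ℝ) < (F ω₀).B.card := lt_of_lt_of_le (by positivity) hB
    exact_mod_cast this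
  have hdis : Disjoint {e | e ∉ crossPairs (F ω₀).B K} (crossPairs (F ω₀).B K : Set (Sym2 V)) :=
    Set.disjoint_left.mpr fun e he he' => he he'
  have hag : DeterminedBy (agreeEvent ω₀) {e | e ∉ crossPairs (F ω₀).B K} := by
    have hset : agreeEvent ω₀ = {ω | ∀ e, e ∉ crossPairs (F ω₀).B K → ω e = ω₀ e} := by
      rw [hFB]
      rfl
    rw [hset]
    exact fun ω ω' h => forall₂_congr fun e he => by rw [h e he]
  have hcls : colourClass ω₀ = agreeEvent ω₀ ∩ degEvent (F ω₀).B K := by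
    rw [hFB]
    rfl
  have hsub : {ω | 0.998 * (Fintype.card V : ℝ) ≤ (blackSet (toGraph ω)).card ∧
      ¬ (F ω).Ham (toGraph ω)} ∩ colourClass ω₀ ⊆
      agreeEvent ω₀ ∩ (degEvent (F ω₀).B K ∩ {ω | ¬ (F ω₀).Ham (toGraph ω)}) := by
    rintro ω ⟨⟨-, hω⟩, hcl⟩
    rw [hF ω₀ ω hcl] at hω
    rw [hcls] at hcl
    exact ⟨hcl.1, hcl.2, hω⟩
  have hdetD := determinedBy_degEvent (F ω₀).B K
  have hdetH : DeterminedBy {ω | ¬ (F ω₀).Ham (toGraph ω)}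
      (crossPairs (F ω₀).B K : Finset (Sym2 V)) := fun ω ω' h =>
    not_congr ((F ω₀).determinedBy_ham (hFK ω₀) ω ω' h)
  have hcond : prob p (degEvent (F ω₀).B K ∩ {ω | ¬ (F ω₀).Ham (toGraph ω)}) ≤
      168 * typicalConst / (Fintype.card V : ℝ) ^ 2 * prob p (degEvent (F ω₀).B K) := by
    have := (F ω₀).prob_not_ham_le h0 h1 hc (hFK ω₀) hB hBne
    have h2 := prob_typical_compl (K := K) h0 h1 hc hn4 hB
    calc _ ≤ _ := this
      _ ≤ 168 * (typicalConst / (Fintype.card V : ℝ) ^ 2 * prob p (degEvent (F ω₀).B K)) := by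
          gcongr
      _ = _ := by ring
  -- The agreement event concerns only the other pairs, so it factors out of both the bad event and
  -- the class.
  calc _ ≤ _ := prob_mono h0 h1 hsub
    _ = prob p (agreeEvent ω₀) *
        prob p (degEvent (F ω₀).B K ∩ {ω | ¬ (F ω₀).Ham (toGraph ω)}) :=
        prob_indep hag (hdetD.inter hdetH) hdis
    _ ≤ prob p (agreeEvent ω₀) * (168 * typicalConst / (Fintype.card V : ℝ) ^ 2 *
        prob p (degEvent (F ω₀).B K)) :=
        mul_le_mul_of_nonneg_left hcond (prob_nonneg h0 h1 _)
    _ = 168 * typicalConst / (Fintype.card V : ℝ) ^ 2 * prob p (colourClass ω₀) := by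
        rw [hcls, prob_indep hag hdetD hdis]
        ring

theorem prob_not_ham_core_le (h0 : 0 ≤ p) (h1 : p ≤ 1) (hc : 20 ≤ p * Fintype.card V)
    (hn4 : (10 : ℝ) ^ 4 ≤ Fintype.card V) (F : (Sym2 V → Bool) → Frame V)
    (hFB : ∀ ω, (F ω).B = blackSet (toGraph ω))
    (hFK : ∀ ω, (F ω).K ⊆ blackSet (toGraph ω) ∪ blueSet (toGraph ω))
    (hF : ∀ ω, ∀ ω' ∈ colourClass ω, F ω' = F ω) :
    prob p {ω | ¬ (F ω).Ham (toGraph ω)} ≤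
      (23040000 + 168 * typicalConst) / (Fintype.card V : ℝ) ^ 2 := by
  refine le_trans (prob_mono h0 h1 (B := {ω : Sym2 V → Bool | ¬ ∃ B : Finset V,
    0.998 * (Fintype.card V : ℝ) ≤ B.card ∧ ∀ v ∈ B, v ∈ black (toGraph ω)} ∪
    {ω | 0.998 * (Fintype.card V : ℝ) ≤ (blackSet (toGraph ω)).card ∧
      ¬ (F ω).Ham (toGraph ω)}) ?_) ((prob_union_le h0 h1 _ _).trans ?_)
  · intro ω hω
    by_cases hB : 0.998 * (Fintype.card V : ℝ) ≤ (blackSet (toGraph ω)).card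
    · exact Or.inr ⟨hB, hω⟩
    · refine Or.inl ?_
      rintro ⟨B, hB', h⟩
      refine hB (hB'.trans ?_)
      exact_mod_cast Finset.card_le_card fun v hv => mem_blackSet.mpr (h v hv)
  · rw [add_div]
    exact add_le_add (prob_core_small_le h0 h1 hc hn4)
      (prob_not_ham_of_large_core_le h0 h1 hc hn4 F hFB hFK hF)

end Classes

/-! ### Identification with the binomial random graph -/

section RandomGraph

variable {V : Type*} [Fintype V] [DecidableEq V]

/-- The coordinates on the diagonal of `Sym2 V` are ignored by `toGraph`, so only the proper pairs
contribute factors. -/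
theorem prob_toGraph_eq (p : ℝ) (G : SimpleGraph V) :
    prob p {ω | toGraph ω = G} = p ^ G.edgeSet.ncard *
      (1 - p) ^ ((Fintype.card V).choose 2 - G.edgeSet.ncard) := by
  classical
  set E₁ : Finset (Sym2 V) := Finset.univ.filter (· ∈ G.edgeSet) with hE₁
  set E₂ : Finset (Sym2 V) := (Finset.univ.filter fun e => ¬ e.IsDiag) \ E₁ with hE₂
  have hset : {ω : Sym2 V → Bool | toGraph ω = G} =
      {ω | ∀ e ∈ E₁, ω e = true} ∩ {ω | ∀ e ∈ E₂, ω e = false} := by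
    ext ω
    constructor
    · rintro rfl
      refine ⟨fun e he => ?_, fun e he => ?_⟩
      · induction e with
        | _ u v => exact (show (toGraph ω).Adj u v by simpa [hE₁] using he).2
      · induction e with
        | _ u v =>
          by_contra hce
          have h1 := Finset.mem_sdiff.mp he
          have huv : u ≠ v := by simpa using h1.1
          exact h1.2 (by simpa [hE₁] using show (toGraph ω).Adj u v from ⟨huv, by simpa using hce⟩)
    · rintro ⟨h1, h2⟩
      ext u v
      constructor
      · rintro ⟨huv, hω⟩
        by_contra hG
        have := h2 s(u, v) (by simp [hE₂, hE₁, huv, hG])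
        rw [hω] at this
        exact absurd this (by decide)
      · exact fun h => ⟨h.ne, h1 s(u, v) (by simpa [hE₁] using h)⟩
  have hc₁ : E₁.card = G.edgeSet.ncard := by
    rw [← Set.ncard_coe_finset]
    congr 1
    ext e
    simp [hE₁]
  have hsub : E₁ ⊆ Finset.univ.filter fun e : Sym2 V => ¬ e.IsDiag := by
    intro e he
    have : e ∈ G.edgeSet := by simpa [hE₁] using he
    simpa using G.not_isDiag_of_mem_edgeSet this
  have hdiag : (Finset.univ.filter fun e : Sym2 V => ¬ e.IsDiag).card =
      (Fintype.card V).choose 2 := by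
    rw [← Sym2.card_subtype_not_diag, Fintype.card_subtype]
  have hc₂ : E₂.card = (Fintype.card V).choose 2 - G.edgeSet.ncard := by
    rw [hE₂, Finset.card_sdiff_of_subset hsub, hc₁, hdiag]
  rw [hset, prob_indep (determinedBy_all E₁ true) (determinedBy_all E₂ false)
    (Finset.disjoint_coe.mpr Finset.sdiff_disjoint.symm), prob_all_true, prob_all_false, hc₁, hc₂]

/-- The binomial random graph is the graph of a family of independent Bernoulli variables. -/
theorem binomialRandom_real_eq_prob (p : unitInterval) (S : Set (SimpleGraph V)) :
    (SimpleGraph.binomialRandom V p).real S = prob (p : ℝ) {ω | toGraph ω ∈ S} := by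
  classical
  have : MeasurableSingletonClass (SimpleGraph V) := ⟨fun G => by
    have h : ({G} : Set (SimpleGraph V)) = SimpleGraph.edgeSet ⁻¹' {G.edgeSet} := by
      ext H
      simp
    rw [h]
    exact SimpleGraph.measurable_edgeSet (Set.toFinite _).measurableSet⟩
  have hS : S = ((Finset.univ.filter (· ∈ S) : Finset (SimpleGraph V)) : Set (SimpleGraph V)) := by
    ext G
    simp
  have hG : ∀ G, (SimpleGraph.binomialRandom V p).real {G} = prob (p : ℝ) {ω | toGraph ω = G} := by
    intro G
    rw [MeasureTheory.measureReal_def, SimpleGraph.binomialRandom_singleton, prob_toGraph_eq,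
      Nat.card_eq_fintype_card]
    simp
  calc (SimpleGraph.binomialRandom V p).real S
      = ∑ G ∈ Finset.univ.filter (· ∈ S), (SimpleGraph.binomialRandom V p).real {G} := by
        rw [MeasureTheory.sum_measureReal_singleton, ← hS]
    _ = ∑ G ∈ Finset.univ.filter (· ∈ S), prob (p : ℝ) {ω | toGraph ω = G} :=
        Finset.sum_congr rfl fun G _ => hG G
    _ = prob (p : ℝ) {ω | toGraph ω ∈ S} := by
        unfold prob
        rw [Finset.sum_comm]
        refine Finset.sum_congr rfl fun ω _ => ?_
        simp only [Set.mem_ofPred_eq]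
        rw [Finset.sum_ite_eq]
        simp

end RandomGraph

/-! ### From cyclic lists to Hamilton cycles -/

section Walks

variable {V : Type*}

theorem pair_infix_map {W : Type*} {f : W → V} (hf : Function.Injective f) {l : List W} {a b : W} :
    [f a, f b] <:+: l.map f ↔ [a, b] <:+: l := by
  rw [List.infix_map_iff]
  constructor
  · rintro ⟨l', hl', h⟩
    have : l' = [a, b] := List.map_injective_iff.mpr hf (by simpa using h.symm)
    rwa [← this]
  · exact fun h => ⟨_, h, rfl⟩

theorem isChain_of_pair_infix {R : V → V → Prop} {l : List V}
    (h : ∀ a b, [a, b] <:+: l → R a b) : l.IsChain R := by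
  induction l with
  | nil => exact List.IsChain.nil
  | cons x l ih =>
    have ih' := ih fun a b hab => h a b (pair_infix_cons.mpr (Or.inr hab))
    cases l with
    | nil => exact List.IsChain.singleton x
    | cons y l => exact List.IsChain.cons_cons (h x y (pair_infix_cons.mpr (Or.inl ⟨rfl, rfl⟩))) ih'

/-- Ensures that the closing edge is not already on the path, so that the closed walk is a cycle. -/
theorem not_nb_ends {l : List V} (hl : l.Nodup) {u x : V} (hu : l.head? = some u)
    (hx : l.getLast? = some x) (h3 : 3 ≤ l.length) : ¬ Nb l u x := by
  rintro (h | h)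
  · match l, h3 with
    | a :: b :: c :: t, _ =>
      obtain rfl : a = u := by simpa using hu
      have hab : [a, b] <:+: a :: b :: c :: t := pair_infix_cons.mpr (Or.inl ⟨rfl, rfl⟩)
      obtain rfl := next_unique hl hab h
      have hmem : b ∈ c :: t := by
        rw [List.getLast?_cons_cons, List.getLast?_cons_cons] at hx
        exact List.mem_of_mem_getLast? hx
      simp only [List.nodup_cons] at hl
      exact hl.2.1 hmem
  · exact not_prev_head hl hu h

/-- A list of all vertices in which consecutive entries and the two ends are adjacent gives a
Hamilton cycle. -/
theorem exists_isHamiltonianCycle_of_list [DecidableEq V] {G : SimpleGraph V} {l : List V}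
    (hl : l.Nodup) (hall : ∀ v, v ∈ l) (h3 : 3 ≤ l.length) (hadj : ∀ a b, Nb l a b → G.Adj a b)
    {u x : V} (hu : l.head? = some u) (hx : l.getLast? = some x) (hux : G.Adj u x) :
    ∃ (a : V) (w : G.Walk a a), w.IsHamiltonianCycle ∧ ∀ a b, Nb l a b → s(a, b) ∈ w.edges := by
  have hne : l ≠ [] := by
    rintro rfl
    simp at h3
  have hchain : l.IsChain G.Adj := isChain_of_pair_infix fun a b h => hadj a b (Or.inl h)
  obtain rfl : l.head hne = u := by
    rw [List.head?_eq_some_head hne] at hu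
    exact Option.some.inj hu
  obtain rfl : l.getLast hne = x := by
    rw [List.getLast?_eq_some_getLast hne] at hx
    exact Option.some.inj hx
  set q := SimpleGraph.Walk.ofSupport l hne hchain with hq
  have hsupp : q.support = l := SimpleGraph.Walk.support_ofSupport hne hchain
  have hpath : q.IsPath := SimpleGraph.Walk.IsPath.mk' (by rw [hsupp]; exact hl)
  have hnot : s(l.getLast hne, l.head hne) ∉ q.edges := by
    rw [← SimpleGraph.Walk.infix_support_iff_mem_edges, hsupp]
    exact fun h => not_nb_ends hl hu hx h3 h.symm
  refine ⟨_, SimpleGraph.Walk.cons hux.symm q, ?_, fun a b h => ?_⟩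
  · rw [SimpleGraph.Walk.isHamiltonianCycle_iff_isCycle_and_support_count_tail_eq_one]
    refine ⟨(SimpleGraph.Walk.cons_isCycle_iff _ _).mpr ⟨hpath, hnot⟩, fun v => ?_⟩
    rw [SimpleGraph.Walk.support_cons, List.tail_cons, hsupp]
    exact List.count_eq_one_of_mem hl (hall v)
  · rw [SimpleGraph.Walk.edges_cons]
    refine List.mem_cons_of_mem _ (SimpleGraph.Walk.infix_support_iff_mem_edges.mp ?_)
    rw [hsupp]
    exact h

end Walks

/-! ### The frame of the strong core, and the theorem -/

section CoreFrame

variable {V : Type*} [Fintype V] [DecidableEq V]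

open Classical in
/-- The frame given by the strong `4`-core, a set `U` of blue vertices and a matching on the other
blue vertices. -/
noncomputable def coreFrame (G : SimpleGraph V) (U : Set V) (M : (⊤ : SimpleGraph V).Subgraph)
    (hU : U ⊆ blue G) (hM : M.IsMatching ∧ M.verts ⊆ blue G \ U) : Frame V where
  B := blackSet G
  K := (blackSet G ∪ blueSet G).filter (· ∉ U)
  M := M.Adj
  B_subset := fun _ hv => Finset.mem_filter.mpr
    ⟨Finset.mem_union_left _ hv, fun hvU => (hU hvU).1 (mem_blackSet.mp hv)⟩
  M_symm := fun h => h.symm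
  M_mem := fun h => Finset.mem_filter.mpr
    ⟨Finset.mem_union_right _ (mem_blueSet.mpr (hM.2 (M.edge_vert h)).1), (hM.2 (M.edge_vert h)).2⟩
  M_notMem := fun h ha => (hM.2 (M.edge_vert h)).1.1 (mem_blackSet.mp ha)
  M_unique := fun h h' => (hM.1 (M.edge_vert h)).unique h h'
  M_irrefl := fun _ h => h.ne rfl

/-- The frame sees the graph only through the colours, `U` and `M`; therefore it is constant on
colour classes. -/
theorem coreFrame_congr {G G' : SimpleGraph V} {U U' : Set V}
    {M M' : (⊤ : SimpleGraph V).Subgraph} (hU : U ⊆ blue G)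
    (hM : M.IsMatching ∧ M.verts ⊆ blue G \ U) (hU' : U' ⊆ blue G')
    (hM' : M'.IsMatching ∧ M'.verts ⊆ blue G' \ U') (hblack : black G = black G')
    (hblue : blue G = blue G') (hUU : U = U') (hMM : M = M') :
    coreFrame G U M hU hM = coreFrame G' U' M' hU' hM' := by
  have e1 : blackSet G = blackSet G' := by
    ext v
    rw [mem_blackSet, mem_blackSet, hblack]
  have e2 : blueSet G = blueSet G' := by
    ext v
    rw [mem_blueSet, mem_blueSet, hblue]
  subst hUU hMM
  unfold coreFrame
  rw [Frame.mk.injEq]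
  exact ⟨e1, by rw [e1, e2], rfl⟩

theorem mem_coreFrame_K {G : SimpleGraph V} {U : Set V} {M : (⊤ : SimpleGraph V).Subgraph}
    {hU : U ⊆ blue G} {hM : M.IsMatching ∧ M.verts ⊆ blue G \ U} {v : V} :
    v ∈ (coreFrame G U M hU hM).K ↔ v ∈ keptVerts G U := by
  simp [coreFrame, keptVerts, mem_blackSet, mem_blueSet]

theorem coreFrame_K_subset {G : SimpleGraph V} {U : Set V} {M : (⊤ : SimpleGraph V).Subgraph}
    {hU : U ⊆ blue G} {hM : M.IsMatching ∧ M.verts ⊆ blue G \ U} :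
    (coreFrame G U M hU hM).K ⊆ blackSet G ∪ blueSet G := fun _ hv =>
  mem_union_colours.mpr (mem_coreFrame_K.mp hv).1

/-- Every link is an edge of `augmented`, and since the list visits all kept vertices, closedness
puts every matching pair on the cycle. -/
theorem hasHamiltonCycleThrough_of_ham {G : SimpleGraph V} {U : Set V}
    {M : (⊤ : SimpleGraph V).Subgraph} (hU : U ⊆ blue G)
    (hM : M.IsMatching ∧ M.verts ⊆ blue G \ U) (h : (coreFrame G U M hU hM).Ham G) :
    HasHamiltonCycleThrough G U M := by
  obtain ⟨l, u, x, hl, hK, hu, hx, hux, h3⟩ := h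
  lift l to List (keptVerts G U) using fun v hv => mem_coreFrame_K.mp (hl.mem_K v hv)
  have hinj : Function.Injective (Subtype.val : keptVerts G U → V) := Subtype.val_injective
  have hnb : ∀ a b : keptVerts G U, Nb (l.map Subtype.val) (a : V) b ↔ Nb l a b := fun a b =>
    or_congr (pair_infix_map hinj) (pair_infix_map hinj)
  have hlnk : ∀ a b : keptVerts G U, (coreFrame G U M hU hM).Lnk G a b →
      (augmented G U M).Adj a b := by
    rintro a b (⟨hab, -⟩ | hab)
    · exact Or.inl hab
    · exact Or.inr hab
  rw [List.head?_map, Option.map_eq_some_iff] at hu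
  rw [List.getLast?_map, Option.map_eq_some_iff] at hx
  obtain ⟨u, hu, rfl⟩ := hu
  obtain ⟨x, hx, rfl⟩ := hx
  have hall : ∀ v, v ∈ l := fun v => by
    have := hK v (mem_coreFrame_K.mpr v.2)
    rwa [List.mem_map_of_injective hinj] at this
  obtain ⟨a, w, hw, hedges⟩ := exists_isHamiltonianCycle_of_list (G := augmented G U M)
    (List.Nodup.of_map _ hl.nodup) hall (by simpa using h3)
    (fun a b hab => hlnk a b (hl.lnk a b ((hnb a b).mpr hab))) hu hx (hlnk u x hux)
  exact ⟨a, w, hw, fun y z hyz => hedges y z ((hnb y z).mp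
    (hl.closed y z hyz (List.mem_map_of_mem (hall y))))⟩

end CoreFrame

end StrongCore

theorem mainTheorem4 :
    ∃ C : ℝ, ∀ (n : ℕ) (c : ℝ) (p : unitInterval), 0 < n → 20 ≤ c → (p : ℝ) = c / n →
      ∀ (U : SimpleGraph (Fin n) → Set (Fin n))
        (M : SimpleGraph (Fin n) → (⊤ : SimpleGraph (Fin n)).Subgraph),
        (∀ G, U G ⊆ StrongCore.blue G) →
        (∀ G, (M G).IsMatching ∧ (M G).verts ⊆ StrongCore.blue G \ U G) →
        (∀ G₁ G₂, StrongCore.SameRedBlue G₁ G₂ → U G₁ = U G₂ ∧ M G₁ = M G₂) →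
        1 - C / (n : ℝ) ^ 2 ≤ (SimpleGraph.binomialRandom (Fin n) p).real
          {G | StrongCore.HasHamiltonCycleThrough G (U G) (M G)} := by
  open StrongCore in
  -- The entry `10 ^ 8` makes the claim trivial for `n < 10 ^ 4`; the other one adds the small-core
  -- and the conditional error.
  refine ⟨max (10 ^ 8) (23040000 + 168 * typicalConst), ?_⟩
  intro n c p hn hc hp U M hU hM hUM
  have hn0 : (0 : ℝ) < n := by exact_mod_cast hn
  rcases lt_or_ge (n : ℝ) (10 ^ 4) with hsmall | hlarge
  · refine le_trans ?_ MeasureTheory.measureReal_nonneg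
    rw [sub_nonpos, one_le_div (by positivity)]
    exact le_trans (by nlinarith) (le_max_left _ _)
  have h0 : (0 : ℝ) ≤ p := p.2.1
  have h1 : (p : ℝ) ≤ 1 := p.2.2
  have hcard : (Fintype.card (Fin n) : ℝ) = n := by rw [Fintype.card_fin]
  have hc' : 20 ≤ (p : ℝ) * Fintype.card (Fin n) := by
    rwa [hcard, hp, div_mul_cancel₀ _ hn0.ne']
  let F : (Sym2 (Fin n) → Bool) → Frame (Fin n) := fun ω =>
    coreFrame (toGraph ω) (U (toGraph ω)) (M (toGraph ω)) (hU _) (hM _)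
  have hmain := prob_not_ham_core_le h0 h1 hc' (by rwa [hcard]) F (fun _ => rfl)
    (fun _ => coreFrame_K_subset) (fun ω ω' h => by
      obtain ⟨hb, hl⟩ := colours_eq_of_mem_colourClass h
      obtain ⟨hu, hm⟩ := hUM _ _ (sameRedBlue_of_mem_colourClass h)
      exact coreFrame_congr _ _ _ _ hb hl hu.symm hm.symm)
  rw [hcard] at hmain
  have hadd := prob_add_compl (p := (p : ℝ)) {ω | (F ω).Ham (toGraph ω)}
  rw [binomialRandom_real_eq_prob]
  calc 1 - max (10 ^ 8) (23040000 + 168 * typicalConst) / (n : ℝ) ^ 2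
      ≤ 1 - (23040000 + 168 * typicalConst) / (n : ℝ) ^ 2 := by
        gcongr
        exact le_max_right _ _
    _ ≤ 1 - prob (p : ℝ) {ω | (F ω).Ham (toGraph ω)}ᶜ := by
        gcongr
        exact hmain
    _ = prob (p : ℝ) {ω | (F ω).Ham (toGraph ω)} := by linarith
    _ ≤ _ := prob_mono h0 h1 fun ω hω => hasHamiltonCycleThrough_of_ham (hU _) (hM _) hω
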